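/- **Setting.** Let $f:(\mathbb R^2,0)\to(\mathbb R,0)$ be a smooth ($C^\infty$) function germ with an $A_1^-$ singularity at the origin: $f(0)=0$, $df(0)=0$ and $c_{21}^2-4c_{20}c_{22}>0$, where $c_{20}x^2+c_{21}xy+c_{22}y^2$ is the quadratic part of $f$. Let $A$ be a linear similarity of $\mathbb R^2$ (a composition of a linear isometry and a homothety) such that $$(f\circ A)(x,y)=xy+a_{22}y^2+\sum_{i\ge 3}\sum_{j=0}^{i}a_{ij}x^{i-j}y^{j}$$ as a Taylor expansion at the origin, and put $$\eta_1=a_{30},\qquad \eta_2=a_{22}^3a_{30}-a_{22}^2a_{31}+a_{22}a_{32}-a_{33},\qquad \eta_3=a_{22}a_{30}^2-a_{30}a_{31}+a_{40},$$ $$\begin{aligned}\eta_4={}&3a_{22}^5a_{30}^2+a_{22}^7a_{30}^2-5a_{22}^4a_{30}a_{31}-a_{22}^6a_{30}a_{31}+2a_{22}^3a_{31}^2+a_{22}^4a_{40}+a_{22}^6a_{40}-3a_{22}^2a_{31}a_{32}+a_{22}^4a_{31}a_{32}\\&+a_{22}a_{32}^2-a_{22}^3a_{32}^2-3a_{22}^2a_{30}a_{33}+a_{22}^4a_{30}a_{33}+2a_{22}a_{31}a_{33}-2a_{22}^3a_{31}a_{33}-a_{32}a_{33}+3a_{22}^2a_{32}a_{33}-2a_{22}a_{33}^2\\&+4a_{22}^3a_{30}a_{32}-a_{22}^3a_{41}-a_{22}^5a_{41}+a_{22}^2a_{42}+a_{22}^4a_{42}-a_{22}a_{43}-a_{22}^3a_{43}+a_{44}+a_{22}^2a_{44}.\end{aligned}$$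 The singularity is *generic* if $\eta_1,\eta_2,\eta_3,\eta_4$ are all nonzero (neither branch of $f=0$ has an inflection or a vertex at the origin). **Inflections and vertices.** A point of a curve $g=0$ is an *inflection* if $i_g=0$ there and a *vertex* if $v_g=0$ there, where, writing $D=g_y\partial_x-g_x\partial_y$ and $n=g_x^2+g_y^2$, $i_g=g_{xx}g_y^2-2g_{xy}g_xg_y+g_{yy}g_x^2$ and $v_g=n\,D(i_g)-\tfrac32\, i_g\,D(n)$ (the numerators of the curvature of the level curves and of its derivative along them). Singular points of the curve count as both. **Versality.** A $q$-parameter deformation of $f$ is a smooth germ $F$ at $0$ on $\mathbb R^2\times\mathbb R^q$ with $F(\cdot,0)=f$; write $F_s=F(\cdot,s)$. It is ($\mathcal A$-)*versal* if for every deformation $G$ of $f$, with any number of parameters, $G_v=\psi_v\circ F_{h(v)}\circ\varphi_v$ for some smooth germ $h$ with $h(0)=0$ and smooth families of germs $\varphi_v$ of maps in the source $\mathbb R^2$ and $\psi_v$ in the target $\mathbb R$ with $\varphi_0=\mathrm{id}$, $\psi_0=\mathrm{id}$ and $\psi_v(0)=0$ (so that zero levels correspond). **FRS-equivalence.** Two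 curves have the *same geometry* if there is a diffeomorphism between them (smooth in both directions as maps of subsets of the plane) that matches singular points, inflections and vertices, hence their numbers and their relative positions along the curves. Two deformations $F,G$ of $f$ with the same parameter space are *FRS-equivalent* if there are germs at $0$ of stratifications $S_1,S_2$ of the parameter space, such that parameters in the same stratum of $S_1$ (resp. $S_2$) give curves $F_s=0$ (resp. $G_s=0$) with the same geometry, and a germ of homeomorphism $k$ with $k(0)=0$, carrying strata of $S_1$ to strata of $S_2$, such that $F_s=0$ and $G_{k(s)}=0$ have the same geometry for all $s$. Here the curves are taken in an arbitrary sufficiently small Euclidean disc of radius $\varepsilon$ about the origin, and then the parameters in a sufficiently small neighbourhood of $0$ (depending on $\varepsilon$). **Configurations.** A one-parameter family has the *configuration* $w_1-w_2\leftrightarrow w_3-w_4$ if for one sign of the parameter $t$ and $|t|$ small the curve, in the above sense, has exactly two connected components, both regular open arcs, along which one meets the inflections ($i$) and vertices ($v$) in the order given by the words $w_1$ and $w_2$ respectively, and for the other sign of $t$ the same holds with $w_3$ and $w_4$. (Arcs are unordered and unoriented, and which sign of $t$ belongs to which side of the arrow is not specified.) **Theorem.** Let $f$ have a generic $A_1^-$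 singularity at the origin, with $A$ and $\eta_1,\dots,\eta_4$ as above. Then every 1-parameter $\mathcal A$-versal deformation of $f$ is FRS-equivalent to $F(x,y,t)=f(x,y)+t$. Moreover $F$ has the configuration - $vivi-vv\leftrightarrow viv-vvi$ if $\eta_3\eta_4<0$; - $vi-vi\leftrightarrow viviv-vvv$ if $\eta_3\eta_4>0$ and $\eta_1\eta_2\eta_3>0$; - $ivi-v\leftrightarrow vviv-vviv$ if $\eta_3\eta_4>0$ and $\eta_1\eta_2\eta_3<0$. -/

import Mathlib

open Set Filter Topology
open scoped ContDiff

noncomputable section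

namespace PlaneCurve

/-- The plane, with points written as pairs of coordinates. -/
abbrev Plane : Type := ℝ × ℝ

/-! ## Smooth germs, partial derivatives, Taylor coefficients -/

/-- `g` represents a smooth function germ at `x`: it is `C^∞` at every point of a neighbourhood
of `x`. -/
def SmoothGermAt {E F : Type*} [NormedAddCommGroup E] [NormedSpace ℝ E]
    [NormedAddCommGroup F] [NormedSpace ℝ F] (g : E → F) (x : E) : Prop :=
  ∀ᶠ z in 𝓝 x, ContDiffAt ℝ ∞ g z

/-- The partial derivative with respect to the first coordinate. -/
def dx (g : Plane → ℝ) : Plane → ℝ := fun p => fderiv ℝ g p (1, 0)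

/-- The partial derivative with respect to the second coordinate. -/
def dy (g : Plane → ℝ) : Plane → ℝ := fun p => fderiv ℝ g p (0, 1)

/-- The coefficient of `x ^ m * y ^ n` in the Taylor expansion of `g` at the origin. -/
def taylorCoeff (g : Plane → ℝ) (m n : ℕ) : ℝ :=
  (dx^[m] (dy^[n] g)) 0 / ((m.factorial : ℝ) * (n.factorial : ℝ))

/-! ## Singular points, inflections and vertices of the curve `g = 0` -/

/-- The numerator `i_g` of the curvature of the level curves of `g`. -/
def inflFun (g : Plane → ℝ) (p : Plane) : ℝ :=
  dx (dx g) p * dy g p ^ 2 - 2 * dx (dy g) p * dx g p * dy g p + dy (dy g) p * dx g p ^ 2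

/-- The numerator `v_g` of the derivative of the curvature along the level curves of `g`. -/
def vertFun (g : Plane → ℝ) (p : Plane) : ℝ :=
  let fx := dx g p
  let fy := dy g p
  let fxx := dx (dx g) p
  let fxy := dx (dy g) p
  let fyy := dy (dy g) p
  let fxxx := dx (dx (dx g)) p
  let fxxy := dx (dx (dy g)) p
  let fxyy := dx (dy (dy g)) p
  let fyyy := dy (dy (dy g)) p
  (fx ^ 2 + fy ^ 2) *
      (-fx ^ 3 * fyyy + 3 * fx ^ 2 * fy * fxyy - 3 * fx * fy ^ 2 * fxxy + fy ^ 3 * fxxx)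
    + 3 * fx * fy * (fyy - fxx) * (fx ^ 2 * fyy + fxx * fy ^ 2)
    + 6 * fx * fy * fxy ^ 2 * (fy ^ 2 - fx ^ 2)
    + 3 * fxy * (fx ^ 4 * fyy + 3 * fx ^ 2 * fy ^ 2 * (fxx - fyy) - fxx * fy ^ 4)

/-- `p` is a singular point of the curve `g = 0`.  (Points of self-intersection of an implicitly
defined curve are singular points of it.) -/
def IsSingularPoint (g : Plane → ℝ) (p : Plane) : Prop := g p = 0 ∧ dx g p = 0 ∧ dy g p = 0

/-- `p` is an inflection of the curve `g = 0`; singular points count as inflections. -/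
def IsInflection (g : Plane → ℝ) (p : Plane) : Prop := g p = 0 ∧ inflFun g p = 0

/-- `p` is a vertex of the curve `g = 0`; singular points count as vertices. -/
def IsVertex (g : Plane → ℝ) (p : Plane) : Prop := g p = 0 ∧ vertFun g p = 0

/-- The curve `g = 0` inside the open Euclidean disc of radius `ε` about the origin. -/
def curve (g : Plane → ℝ) (ε : ℝ) : Set Plane := {p | p.1 ^ 2 + p.2 ^ 2 < ε ^ 2 ∧ g p = 0}

/-! ## Generic singularities of type `A₁⁻` -/

/-- `f` is a smooth germ `(ℝ², 0) → (ℝ, 0)` with an `A₁⁻` singularity (a nondegenerate saddle)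
at the origin. -/
def IsA1Minus (f : Plane → ℝ) : Prop :=
  SmoothGermAt f 0 ∧ taylorCoeff f 0 0 = 0 ∧ taylorCoeff f 1 0 = 0 ∧ taylorCoeff f 0 1 = 0 ∧
    0 < taylorCoeff f 1 1 ^ 2 - 4 * taylorCoeff f 2 0 * taylorCoeff f 0 2

/-- `A` is a composition of a linear isometry and a homothety of the Euclidean plane. -/
def IsSimilarity (A : Plane →ₗ[ℝ] Plane) : Prop :=
  ∃ c : ℝ, 0 < c ∧ ∀ p : Plane, (A p).1 ^ 2 + (A p).2 ^ 2 = c ^ 2 * (p.1 ^ 2 + p.2 ^ 2)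

/-- The similarity `A` brings the quadratic part of `f` to the form `x y + a₂₂ y²`. -/
def IsNormalizing (f : Plane → ℝ) (A : Plane →ₗ[ℝ] Plane) : Prop :=
  IsSimilarity A ∧ taylorCoeff (f ∘ A) 2 0 = 0 ∧ taylorCoeff (f ∘ A) 1 1 = 1

/-- For `g = x y + a₂₂ y² + ∑ a_{ij} x^{i-j} y^j`: the number `η₁ = a₃₀`. -/
def eta1 (g : Plane → ℝ) : ℝ := taylorCoeff g 3 0

/-- The number `η₂`. -/
def eta2 (g : Plane → ℝ) : ℝ :=
  let a22 := taylorCoeff g 0 2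
  let a30 := taylorCoeff g 3 0
  let a31 := taylorCoeff g 2 1
  let a32 := taylorCoeff g 1 2
  let a33 := taylorCoeff g 0 3
  a22 ^ 3 * a30 - a22 ^ 2 * a31 + a22 * a32 - a33

/-- The number `η₃`. -/
def eta3 (g : Plane → ℝ) : ℝ :=
  let a22 := taylorCoeff g 0 2
  let a30 := taylorCoeff g 3 0
  let a31 := taylorCoeff g 2 1
  let a40 := taylorCoeff g 4 0
  a22 * a30 ^ 2 - a30 * a31 + a40

/-- The number `η₄`. -/
def eta4 (g : Plane → ℝ) : ℝ :=
  let a22 := taylorCoeff g 0 2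
  let a30 := taylorCoeff g 3 0
  let a31 := taylorCoeff g 2 1
  let a32 := taylorCoeff g 1 2
  let a33 := taylorCoeff g 0 3
  let a40 := taylorCoeff g 4 0
  let a41 := taylorCoeff g 3 1
  let a42 := taylorCoeff g 2 2
  let a43 := taylorCoeff g 1 3
  let a44 := taylorCoeff g 0 4
  3 * a22 ^ 5 * a30 ^ 2 + a22 ^ 7 * a30 ^ 2 - 5 * a22 ^ 4 * a30 * a31 - a22 ^ 6 * a30 * a31
    + 2 * a22 ^ 3 * a31 ^ 2 + a22 ^ 4 * a40 + a22 ^ 6 * a40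
    - 3 * a22 ^ 2 * a31 * a32 + a22 ^ 4 * a31 * a32 + a22 * a32 ^ 2 - a22 ^ 3 * a32 ^ 2
    - 3 * a22 ^ 2 * a30 * a33 + a22 ^ 4 * a30 * a33
    + 2 * a22 * a31 * a33 - 2 * a22 ^ 3 * a31 * a33 - a32 * a33 + 3 * a22 ^ 2 * a32 * a33
    - 2 * a22 * a33 ^ 2 + 4 * a22 ^ 3 * a30 * a32
    - a22 ^ 3 * a41 - a22 ^ 5 * a41 + a22 ^ 2 * a42 + a22 ^ 4 * a42 - a22 * a43 - a22 ^ 3 * a43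
    + a44 + a22 ^ 2 * a44

/-! ## Deformations and versality -/

/-- `F` represents the germ of a smooth deformation of `f` with parameter space `P`. -/
def IsDeformation {P : Type*} [NormedAddCommGroup P] [NormedSpace ℝ P]
    (f : Plane → ℝ) (F : Plane × P → ℝ) : Prop :=
  SmoothGermAt F 0 ∧ ∀ᶠ p in 𝓝 (0 : Plane), F (p, 0) = f p

/-- `F` is a versal deformation of `f`: every smooth deformation `G` of `f`, with any number `q`
of parameters, is obtained from `F` by a smooth change of parameters `h` and smooth families of
changes of coordinates `φ` in the source and `ψ` in the target that start at the identity, as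
`G (p, v) = ψ_v (F (φ_v p, h v))`.  The deformations are deformations of the curve `f = 0`, so the
families `ψ` preserve the level `0`. -/
def IsVersalDeformation {P : Type*} [NormedAddCommGroup P] [NormedSpace ℝ P]
    (f : Plane → ℝ) (F : Plane × P → ℝ) : Prop :=
  IsDeformation f F ∧
  ∀ (q : ℕ) (G : Plane × (Fin q → ℝ) → ℝ), IsDeformation f G →
    ∃ (h : (Fin q → ℝ) → P) (φ : Plane × (Fin q → ℝ) → Plane) (ψ : ℝ × (Fin q → ℝ) → ℝ),
      SmoothGermAt h 0 ∧ h 0 = 0 ∧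
      SmoothGermAt φ 0 ∧ (∀ᶠ p in 𝓝 (0 : Plane), φ (p, 0) = p) ∧
      SmoothGermAt ψ 0 ∧ (∀ᶠ y in 𝓝 (0 : ℝ), ψ (y, 0) = y) ∧
      (∀ᶠ v in 𝓝 (0 : Fin q → ℝ), ψ (0, v) = 0) ∧
      ∀ᶠ z in 𝓝 (0 : Plane × (Fin q → ℝ)), G z = ψ (F (φ z, h z.2), z.2)

/-! ## FRS-equivalence -/

/-- The curves `g = 0` and `g' = 0` in the disc of radius `ε` are diffeomorphic by a diffeomorphism
that matches their singular points, their inflections and their vertices.  In particular they have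
the same numbers of these points, in the same relative position along the curves.  A map between
subsets of the plane is smooth if it extends smoothly to an open neighbourhood. -/
def SameGeometry (ε : ℝ) (g g' : Plane → ℝ) : Prop :=
  ∃ (Φ Ψ : Plane → Plane) (N N' : Set Plane),
    IsOpen N ∧ curve g ε ⊆ N ∧ ContDiffOn ℝ ∞ Φ N ∧
    IsOpen N' ∧ curve g' ε ⊆ N' ∧ ContDiffOn ℝ ∞ Ψ N' ∧
    MapsTo Φ (curve g ε) (curve g' ε) ∧ MapsTo Ψ (curve g' ε) (curve g ε) ∧
    LeftInvOn Ψ Φ (curve g ε) ∧ RightInvOn Ψ Φ (curve g' ε) ∧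
    ∀ p ∈ curve g ε,
      (IsSingularPoint g p ↔ IsSingularPoint g' (Φ p)) ∧
      (IsInflection g p ↔ IsInflection g' (Φ p)) ∧
      (IsVertex g p ↔ IsVertex g' (Φ p))

/-- `S` is a smooth embedded submanifold of `P`. -/
def IsSmoothSubmanifold {P : Type*} [NormedAddCommGroup P] [NormedSpace ℝ P] (S : Set P) : Prop :=
  ∀ x ∈ S, ∃ (e : OpenPartialHomeomorph P P) (V : Submodule ℝ P),
    x ∈ e.source ∧ ContDiffOn ℝ ∞ e e.source ∧ ContDiffOn ℝ ∞ e.symm e.target ∧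
    e '' (S ∩ e.source) = (V : Set P) ∩ e.target

/-- `𝒮` is a stratification of `W`: a finite partition into connected smooth submanifolds that
satisfies the frontier condition. -/
structure IsStratification {P : Type*} [NormedAddCommGroup P] [NormedSpace ℝ P]
    (W : Set P) (𝒮 : Set (Set P)) : Prop where
  finite : 𝒮.Finite
  connected : ∀ S ∈ 𝒮, IsConnected S
  smooth : ∀ S ∈ 𝒮, IsSmoothSubmanifold S
  disjoint : 𝒮.PairwiseDisjoint id
  covers : ⋃₀ 𝒮 = W
  frontier : ∀ S ∈ 𝒮, ∀ T ∈ 𝒮, (S ∩ closure T).Nonempty → S ⊆ closure T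

/-- Curves of the family `F` with parameters in the same stratum of `𝒮` have the same geometry.
As everything is a germ, the curves are taken in any sufficiently small disc about the origin, and
then the parameters in a sufficiently small neighbourhood of `0`. -/
def IsGeometricStratification {P : Type*} [NormedAddCommGroup P] [NormedSpace ℝ P]
    (F : Plane × P → ℝ) (𝒮 : Set (Set P)) : Prop :=
  ∃ ε₀ > 0, ∀ ε : ℝ, 0 < ε → ε < ε₀ → ∃ V ∈ 𝓝 (0 : P),
    ∀ S ∈ 𝒮, ∀ s₁ ∈ S ∩ V, ∀ s₂ ∈ S ∩ V,
      SameGeometry ε (fun p => F (p, s₁)) (fun p => F (p, s₂))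

/-- FRS-equivalence of two deformation germs with the same parameter space. -/
def FRSEquivalent {P : Type*} [NormedAddCommGroup P] [NormedSpace ℝ P]
    (F G : Plane × P → ℝ) : Prop :=
  ∃ (k : OpenPartialHomeomorph P P) (𝒮₁ 𝒮₂ : Set (Set P)),
    (0 : P) ∈ k.source ∧ k 0 = 0 ∧
    IsStratification k.source 𝒮₁ ∧ IsGeometricStratification F 𝒮₁ ∧
    IsStratification k.target 𝒮₂ ∧ IsGeometricStratification G 𝒮₂ ∧
    (∀ S ∈ 𝒮₁, k '' S ∈ 𝒮₂) ∧
    ∃ ε₀ > 0, ∀ ε : ℝ, 0 < ε → ε < ε₀ → ∃ V ∈ 𝓝 (0 : P),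
      ∀ s ∈ k.source ∩ V, SameGeometry ε (fun p => F (p, s)) (fun p => G (p, k s))

/-! ## Geometric configurations -/

/-- The letters of a configuration: `i` for an inflection, `v` for a vertex. -/
inductive Mark : Type
  | i : Mark
  | v : Mark

/-- The part `K` of the curve `g = 0` is a regular smooth open arc along which one meets exactly
the inflections and vertices listed by the word `w`, in this order. -/
def HasWord (g : Plane → ℝ) (K : Set Plane) (w : List Mark) : Prop :=
  ∃ (γ : ℝ → Plane) (s : Fin w.length → ℝ),
    ContDiffOn ℝ ∞ γ (Ioo 0 1) ∧ (∀ u ∈ Ioo (0 : ℝ) 1, deriv γ u ≠ 0) ∧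
    InjOn γ (Ioo 0 1) ∧ γ '' Ioo 0 1 = K ∧
    StrictMono s ∧ (∀ j, s j ∈ Ioo (0 : ℝ) 1) ∧
    ∀ u ∈ Ioo (0 : ℝ) 1,
      (IsInflection g (γ u) ↔ ∃ j, s j = u ∧ w.get j = Mark.i) ∧
      (IsVertex g (γ u) ↔ ∃ j, s j = u ∧ w.get j = Mark.v)

/-- The curve `g = 0` in the disc of radius `ε` has configuration `w₁ - w₂`: it has exactly two
connected components, and these carry the words `w₁` and `w₂`. -/
def HasConfiguration (g : Plane → ℝ) (ε : ℝ) (w₁ w₂ : List Mark) : Prop :=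
  ∃ p ∈ curve g ε, ∃ q ∈ curve g ε,
    connectedComponentIn (curve g ε) p ≠ connectedComponentIn (curve g ε) q ∧
    curve g ε = connectedComponentIn (curve g ε) p ∪ connectedComponentIn (curve g ε) q ∧
    HasWord g (connectedComponentIn (curve g ε) p) w₁ ∧
    HasWord g (connectedComponentIn (curve g ε) q) w₂

/-- The curves `F_t = 0` have configuration `w₁ - w₂` for all small `t` of the sign `σ = ±1`. -/
def HasConfigurationOnSide (F : Plane × ℝ → ℝ) (σ : ℝ) (w₁ w₂ : List Mark) : Prop :=
  ∃ ε₀ > 0, ∀ ε : ℝ, 0 < ε → ε < ε₀ → ∃ δ > 0, ∀ t : ℝ, 0 < t → t < δ →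
    HasConfiguration (fun p => F (p, σ * t)) ε w₁ w₂

/-- The one-parameter family `F` has the geometric configuration `w₁ - w₂ ↔ w₃ - w₄`: one side of
the arrow describes one sign of the parameter and the other side the other sign. -/
def HasTransition (F : Plane × ℝ → ℝ) (w₁ w₂ w₃ w₄ : List Mark) : Prop :=
  (HasConfigurationOnSide F 1 w₁ w₂ ∧ HasConfigurationOnSide F (-1) w₃ w₄) ∨
  (HasConfigurationOnSide F (-1) w₁ w₂ ∧ HasConfigurationOnSide F 1 w₃ w₄)

/-- The deformation `f(x, y) + t`. -/
def levelDeformation (f : Plane → ℝ) : Plane × ℝ → ℝ := fun z => f z.1 + z.2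

end PlaneCurve

end

noncomputable section

namespace PlaneCurve

/-! ## Smooth germs -/

section SmoothGerm

variable {E F G : Type*} [NormedAddCommGroup E] [NormedSpace ℝ E]
  [NormedAddCommGroup F] [NormedSpace ℝ F] [NormedAddCommGroup G] [NormedSpace ℝ G]

/-! All curves of a deformation `F` with ∂F/∂s ≠ 0 at the origin are straightened at once. By
Hadamard's lemma the saddle factors as g = uv, where u = 0 and v = 0 are its branches, and F = g + s
k with k(0) ≠ 0. So F_s = 0 reads u · (-v/k) = s, and the inverse function theorem gives one smooth
germ Φ of maps of the plane carrying every hyperbola UV = s onto F_s = 0 (`exists_chart`). Versality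
is needed only to get ∂F/∂s ≠ 0 (`IsVersalDeformation.fderiv_ne_zero`).

A branch of a hyperbola is x ↦ (q eˣ, q e⁻ˣ), and differentiation in x is the Euler field E = U∂_U -
V∂_V. Hence inflections and vertices are zeros of expressions in EΦ, E²Φ, E³Φ (`mark_iff_of_curve`),
which are smooth germs at the origin. With p and b the images of the coordinate directions, and d
their determinant, there are two regimes.

Middle, |x| ≤ L (`middle_zone`): divided by q, the arc tends to the hyperbola eˣ p + e⁻ˣ b, which
has no inflection and exactly one nondegenerate vertex.

Ends, x > L (`blowUp`, `outer_zone`, `half_arc`): after the blow-up V = Ur, inflections solve U³ g_I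
+ q² = 0 and vertices U⁴ g_V + q² = 0. At the origin g_I and g_V are, up to factors of known sign,
the curvature and the derivative of curvature of the limiting branch, divided by d. Each equation
has one root or none according to that sign. The roots sit at U of order q^(2/3) and q^(1/2), so the
inflection lies nearer the middle than the vertex.

Thus an arc carries a central `v`, and on each side at most one `i` followed outwards by at most one
`v` (`arc_word`). Along the arc the squared distance to the origin is convex in x, so a small disc
cuts out one interval of it (`arc_domain`). The invariants of the two branches are η₁, η₃ and η₂, η₄
up to factors of controlled sign (`first_branch`, `second_branch`), and the four quadrants of the
chart change only signs (`HypChart.exists_arc`). Reading off the words is then a finite check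
(`SideArcs.transitions`).

The words are the same for every admissible `F` once the parameter is oriented by ∂F/∂s > 0. Curves
made of two arcs with equal words are diffeomorphic compatibly with the marks
(`HasArcs.sameGeometry`), and at s = 0 all deformations give f itself. So the two half-lines and the
origin serve as strata for FRS-equivalence (`frsEquivalent_of_sideArcs`). -/

theorem SmoothGermAt.contDiffAt {f : E → F} {x : E} (hf : SmoothGermAt f x) :
    ContDiffAt ℝ ∞ f x := hf.self_of_nhds

theorem SmoothGermAt.continuousAt {f : E → F} {x : E} (hf : SmoothGermAt f x) :
    ContinuousAt f x := hf.contDiffAt.continuousAt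

theorem SmoothGermAt.differentiableAt {f : E → F} {x : E} (hf : SmoothGermAt f x) :
    DifferentiableAt ℝ f x := hf.contDiffAt.differentiableAt (by simp)

theorem SmoothGermAt.hasFDerivAt {f : E → F} {x : E} (hf : SmoothGermAt f x) :
    HasFDerivAt f (fderiv ℝ f x) x := hf.differentiableAt.hasFDerivAt

theorem SmoothGermAt.eventually {f : E → F} {x : E} (hf : SmoothGermAt f x) :
    ∀ᶠ y in 𝓝 x, SmoothGermAt f y := eventually_eventually_nhds.2 hf

theorem _root_.ContDiff.smoothGermAt {f : E → F} (hf : ContDiff ℝ ∞ f) (x : E) :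
    SmoothGermAt f x := Eventually.of_forall fun _ => hf.contDiffAt

theorem smoothGermAt_const (c : F) (x : E) : SmoothGermAt (fun _ => c) x :=
  contDiff_const.smoothGermAt x

theorem smoothGermAt_fst (x : E × F) : SmoothGermAt (fun z : E × F => z.1) x :=
  contDiff_fst.smoothGermAt x

theorem smoothGermAt_snd (x : E × F) : SmoothGermAt (fun z : E × F => z.2) x :=
  contDiff_snd.smoothGermAt x

theorem SmoothGermAt.comp {g : F → G} {f : E → F} (x : E) (hg : SmoothGermAt g (f x))
    (hf : SmoothGermAt f x) : SmoothGermAt (fun y => g (f y)) x := by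
  filter_upwards [hf, hf.continuousAt.eventually hg] with y h1 h2
  exact h2.comp y h1

theorem SmoothGermAt.comp_of_eq {g : F → G} {f : E → F} {x : E} {y : F} (hg : SmoothGermAt g y)
    (hf : SmoothGermAt f x) (h : f x = y) : SmoothGermAt (fun y => g (f y)) x := by
  subst h; exact hg.comp x hf

theorem SmoothGermAt.prodMk {f : E → F} {g : E → G} {x : E} (hf : SmoothGermAt f x)
    (hg : SmoothGermAt g x) : SmoothGermAt (fun y => (f y, g y)) x := by
  filter_upwards [hf, hg] with y h1 h2
  exact h1.prodMk h2

theorem SmoothGermAt.fst {f : E → F × G} {x : E} (hf : SmoothGermAt f x) :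
    SmoothGermAt (fun y => (f y).1) x := by
  filter_upwards [hf] with y h1
  exact h1.fst

theorem SmoothGermAt.snd {f : E → F × G} {x : E} (hf : SmoothGermAt f x) :
    SmoothGermAt (fun y => (f y).2) x := by
  filter_upwards [hf] with y h1
  exact h1.snd

theorem SmoothGermAt.add {f g : E → F} {x : E} (hf : SmoothGermAt f x) (hg : SmoothGermAt g x) :
    SmoothGermAt (fun y => f y + g y) x := by
  filter_upwards [hf, hg] with y h1 h2
  exact h1.add h2

theorem SmoothGermAt.sub {f g : E → F} {x : E} (hf : SmoothGermAt f x) (hg : SmoothGermAt g x) :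
    SmoothGermAt (fun y => f y - g y) x := by
  filter_upwards [hf, hg] with y h1 h2
  exact h1.sub h2

theorem SmoothGermAt.neg {f : E → F} {x : E} (hf : SmoothGermAt f x) :
    SmoothGermAt (fun y => -f y) x := by
  filter_upwards [hf] with y h1
  exact h1.neg

theorem SmoothGermAt.smul {f : E → ℝ} {g : E → F} {x : E} (hf : SmoothGermAt f x)
    (hg : SmoothGermAt g x) : SmoothGermAt (fun y => f y • g y) x := by
  filter_upwards [hf, hg] with y h1 h2
  exact h1.smul h2

theorem SmoothGermAt.mul {f g : E → ℝ} {x : E} (hf : SmoothGermAt f x)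
    (hg : SmoothGermAt g x) : SmoothGermAt (fun y => f y * g y) x := by
  filter_upwards [hf, hg] with y h1 h2
  exact h1.mul h2

theorem SmoothGermAt.div {f g : E → ℝ} {x : E} (hf : SmoothGermAt f x)
    (hg : SmoothGermAt g x) (h : g x ≠ 0) : SmoothGermAt (fun y => f y / g y) x := by
  filter_upwards [hf, hg, hg.continuousAt.eventually_ne h] with y h1 h2 h3
  exact h1.div h2 h3

theorem SmoothGermAt.sqrt {f : E → ℝ} {x : E} (hf : SmoothGermAt f x)
    (h : f x ≠ 0) : SmoothGermAt (fun y => Real.sqrt (f y)) x := by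
  filter_upwards [hf, hf.continuousAt.eventually_ne h] with y h1 h3
  exact h1.sqrt h3

theorem SmoothGermAt.clm_comp {f : E → F} (L : F →L[ℝ] G) {x : E} (hf : SmoothGermAt f x) :
    SmoothGermAt (fun y => L (f y)) x :=
  (L.contDiff.smoothGermAt (f x)).comp x hf

theorem SmoothGermAt.smooth_fderiv {f : E → F} {x : E} (hf : SmoothGermAt f x) :
    SmoothGermAt (fderiv ℝ f) x := by
  filter_upwards [hf] with y h1
  exact h1.fderiv_right (m := ∞) (by simp)

theorem SmoothGermAt.smooth_fderiv_apply {f : E → F} {x : E} (hf : SmoothGermAt f x) {v : E → E}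
    (hv : SmoothGermAt v x) : SmoothGermAt (fun y => fderiv ℝ f y (v y)) x := by
  filter_upwards [hf.smooth_fderiv, hv] with y h1 h2
  exact h1.clm_apply h2

theorem SmoothGermAt.smooth_deriv {f : ℝ → F} {x : ℝ} (hf : SmoothGermAt f x) :
    SmoothGermAt (deriv f) x := by
  have := hf.smooth_fderiv_apply (smoothGermAt_const (1 : ℝ) x)
  simpa using this

end SmoothGerm

/-! ## Parametric integrals and Hadamard's lemma -/

section Hadamard

open MeasureTheory intervalIntegral

/-- Differentiation under the integral sign; the derivative is bounded on the compact set (closed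
unit ball) × [0, 1], so a constant dominates it. -/
theorem hasFDerivAt_integral_unitInterval {E G : Type} [NormedAddCommGroup E] [NormedSpace ℝ E]
    [FiniteDimensional ℝ E] [NormedAddCommGroup G] [NormedSpace ℝ G] [CompleteSpace G]
    {H : E × ℝ → G} (hH : ContDiff ℝ 1 H) (z : E) :
    HasFDerivAt (fun z => ∫ b in (0 : ℝ)..1, H (z, b))
      (∫ b in (0 : ℝ)..1, (fderiv ℝ H (z, b)).comp (ContinuousLinearMap.inl ℝ E ℝ)) z := by
  have hc : Continuous fun p : E × ℝ => (fderiv ℝ H p).comp (ContinuousLinearMap.inl ℝ E ℝ) :=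
    (hH.continuous_fderiv (by simp)).clm_comp continuous_const
  have : ProperSpace E := FiniteDimensional.proper ℝ E
  obtain ⟨C, hC⟩ := ((isCompact_closedBall z 1).prod (isCompact_Icc (a := (0 : ℝ)) (b := 1))
    ).exists_bound_of_continuousOn hc.continuousOn
  refine hasFDerivAt_integral_of_dominated_of_fderiv_le (bound := fun _ => C)
    (F := fun z b => H (z, b))
    (F' := fun z b => (fderiv ℝ H (z, b)).comp (ContinuousLinearMap.inl ℝ E ℝ))
    (s := Metric.ball z 1) (Metric.ball_mem_nhds z one_pos) ?_ ?_ ?_ ?_ ?_ ?_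
  · refine Eventually.of_forall fun y => ?_
    exact (hH.continuous.comp (Continuous.prodMk_right y)).aestronglyMeasurable
  · exact (hH.continuous.comp (Continuous.prodMk_right z)).intervalIntegrable _ _
  · exact (hc.comp (Continuous.prodMk_right z)).aestronglyMeasurable
  · refine Eventually.of_forall fun b hb y hy => hC (y, b) ⟨Metric.ball_subset_closedBall hy, ?_⟩
    rw [uIoc_of_le zero_le_one] at hb
    exact ⟨hb.1.le, hb.2⟩
  · exact intervalIntegrable_const
  · refine Eventually.of_forall fun b hb y hy => ?_
    have h1 : HasFDerivAt H (fderiv ℝ H (y, b)) (y, b) :=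
      (hH.differentiable (by simp) (y, b)).hasFDerivAt
    exact h1.comp y (hasFDerivAt_prodMk_left y b)

/-- The derivative is an integral of the same kind with values in a space of linear maps, which is
why the induction is over all target spaces simultaneously. -/
theorem contDiff_integral_unitInterval {E : Type} [NormedAddCommGroup E] [NormedSpace ℝ E]
    [FiniteDimensional ℝ E] (n : ℕ) : ∀ {G : Type} [NormedAddCommGroup G] [NormedSpace ℝ G]
    [CompleteSpace G] {H : E × ℝ → G}, ContDiff ℝ ∞ H →
      ContDiff ℝ n (fun z => ∫ b in (0 : ℝ)..1, H (z, b)) := by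
  induction n with
  | zero =>
    intro G _ _ _ H hH
    have : Differentiable ℝ (fun z => ∫ b in (0 : ℝ)..1, H (z, b)) := fun z =>
      (hasFDerivAt_integral_unitInterval (hH.of_le (by simp)) z).differentiableAt
    exact contDiff_zero.2 this.continuous
  | succ n ih =>
    intro G _ _ _ H hH
    have h1 := fun z => hasFDerivAt_integral_unitInterval (hH.of_le (by simp)) z
    push_cast
    rw [contDiff_succ_iff_fderiv]
    refine ⟨fun z => (h1 z).differentiableAt, by simp, ?_⟩
    have h2 : fderiv ℝ (fun z => ∫ b in (0 : ℝ)..1, H (z, b)) = fun z =>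
        ∫ b in (0 : ℝ)..1, (fderiv ℝ H (z, b)).comp (ContinuousLinearMap.inl ℝ E ℝ) :=
      funext fun z => (h1 z).fderiv
    rw [h2]
    exact ih (H := fun p => (fderiv ℝ H p).comp (ContinuousLinearMap.inl ℝ E ℝ))
      ((hH.fderiv_right (m := ∞) (by simp)).clm_comp contDiff_const)

/-- A smooth germ has a globally smooth representative. -/
theorem SmoothGermAt.exists_contDiff {E G : Type*} [NormedAddCommGroup E] [NormedSpace ℝ E]
    [FiniteDimensional ℝ E] [NormedAddCommGroup G] [NormedSpace ℝ G] {f : E → G} {x : E}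
    (hf : SmoothGermAt f x) : ∃ g : E → G, ContDiff ℝ ∞ g ∧ g =ᶠ[𝓝 x] f := by
  obtain ⟨r, hr, hb⟩ := Metric.eventually_nhds_iff_ball.1 hf
  -- The bump is supported in a ball of radius r/2, strictly inside the ball of radius r where f is
  -- smooth, so the product vanishes near every point outside the larger ball.
  let χ : ContDiffBump x := ⟨r / 4, r / 2, by positivity, by linarith⟩
  refine ⟨fun y => χ y • f y, ?_, ?_⟩
  · rw [contDiff_iff_contDiffAt]
    intro y
    by_cases hy : y ∈ Metric.ball x r
    · exact χ.contDiffAt.smul (hb y hy)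
    · have : (fun y => χ y • f y) =ᶠ[𝓝 y] fun _ => 0 := by
        have h1 : (Metric.closedBall x (r / 2))ᶜ ∈ 𝓝 y := by
          refine Metric.isClosed_closedBall.isOpen_compl.mem_nhds ?_
          simp only [Metric.mem_ball, not_lt, mem_compl_iff, Metric.mem_closedBall, not_le] at hy ⊢
          linarith
        filter_upwards [h1] with w hw
        simp only [mem_compl_iff, Metric.mem_closedBall, not_le] at hw
        rw [χ.zero_of_le_dist hw.le, zero_smul]
      exact contDiffAt_const.congr_of_eventuallyEq this
  · filter_upwards [χ.eventuallyEq_one] with y hy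
    simp [hy]

/-- **Hadamard's lemma**: a smooth germ on `E × ℝ` that vanishes on `E × {0}` is divisible by the
last coordinate. -/
theorem SmoothGermAt.exists_eq_smul {E G : Type} [NormedAddCommGroup E] [NormedSpace ℝ E]
    [FiniteDimensional ℝ E] [NormedAddCommGroup G] [NormedSpace ℝ G] [CompleteSpace G]
    {h : E × ℝ → G} (hh : SmoothGermAt h 0) (h0 : ∀ᶠ e in 𝓝 (0 : E), h (e, 0) = 0) :
    ∃ k : E × ℝ → G, SmoothGermAt k 0 ∧ (∀ᶠ z in 𝓝 (0 : E × ℝ), h z = z.2 • k z) ∧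
      k 0 = fderiv ℝ h 0 (0, 1) := by
  obtain ⟨g, hg, hgh⟩ := hh.exists_contDiff
  -- The quotient is the mean of the last partial derivative over the segment from (e, 0) to (e, t),
  -- parametrised by b ∈ [0, 1].
  let H : (E × ℝ) × ℝ → G := fun p => fderiv ℝ g (p.1.1, p.2 * p.1.2) (0, 1)
  have hH : ContDiff ℝ ∞ H := by
    have h1 : ContDiff ℝ ∞ (fderiv ℝ g) := hg.fderiv_right (m := ∞) (by simp)
    have h2 : ContDiff ℝ ∞ fun p : (E × ℝ) × ℝ => (p.1.1, p.2 * p.1.2) := by fun_prop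
    exact (h1.comp h2).clm_apply contDiff_const
  have key : ∀ z : E × ℝ, g z = g (z.1, 0) + z.2 • ∫ b in (0 : ℝ)..1, H (z, b) := by
    rintro ⟨e, t⟩
    have hd : ∀ b : ℝ, HasDerivAt (fun b : ℝ => g (e, b * t)) (t • H ((e, t), b)) b := by
      intro b
      have h1 : HasFDerivAt g (fderiv ℝ g (e, b * t)) (e, b * t) :=
        (hg.differentiable (by simp) _).hasFDerivAt
      have h2 : HasDerivAt (fun b : ℝ => (e, b * t)) ((0 : E), t) b := by
        simpa using (hasDerivAt_const b e).prodMk ((hasDerivAt_id b).mul_const t)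
      have h3 := h1.comp_hasDerivAt b h2
      have h4 : ((0 : E), t) = t • ((0 : E), (1 : ℝ)) := by simp
      rw [h4, map_smul] at h3
      exact h3
    have hi : ∫ b in (0 : ℝ)..1, t • H ((e, t), b) = g (e, 1 * t) - g (e, 0 * t) := by
      apply integral_eq_sub_of_hasDerivAt (fun b _ => hd b)
      exact ((hH.continuous.comp (Continuous.prodMk_right (e, t))).const_smul t
        ).intervalIntegrable _ _
    rw [intervalIntegral.integral_smul, one_mul, zero_mul] at hi
    simp only
    rw [hi]; abel
  refine ⟨fun z => ∫ b in (0 : ℝ)..1, H (z, b), ?_, ?_, ?_⟩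
  · refine ContDiff.smoothGermAt ?_ 0
    rw [contDiff_infty]
    exact fun n => contDiff_integral_unitInterval n hH
  · have h1 : Tendsto (fun z : E × ℝ => (z.1, (0 : ℝ))) (𝓝 0) (𝓝 0) := by
      have : Continuous (fun z : E × ℝ => (z.1, (0 : ℝ))) := by fun_prop
      exact this.tendsto' 0 0 rfl
    have h2 : Tendsto (fun z : E × ℝ => z.1) (𝓝 0) (𝓝 0) := continuous_fst.tendsto 0
    filter_upwards [hgh, h1.eventually hgh, h2.eventually h0] with z e1 e2 e3
    rw [← e1, key z, e2, e3, zero_add]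
  · have : ∀ b : ℝ, H (0, b) = fderiv ℝ h 0 (0, 1) := fun b => by
      simp only [H, Prod.fst_zero, Prod.snd_zero, mul_zero]
      rw [← hgh.fderiv_eq]; rfl
    simp only [this]; simp

end Hadamard

/-! ## Jets of functions along curves -/

theorem SmoothGermAt.dx {g : Plane → ℝ} {p : Plane} (hg : SmoothGermAt g p) :
    SmoothGermAt (dx g) p := hg.smooth_fderiv_apply (smoothGermAt_const _ p)

theorem SmoothGermAt.dy {g : Plane → ℝ} {p : Plane} (hg : SmoothGermAt g p) :
    SmoothGermAt (dy g) p := hg.smooth_fderiv_apply (smoothGermAt_const _ p)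

theorem dy_dx_eq {g : Plane → ℝ} {p : Plane} (hg : SmoothGermAt g p) :
    dy (dx g) p = dx (dy g) p := by
  have h1 : IsSymmSndFDerivAt ℝ g p :=
    hg.contDiffAt.isSymmSndFDerivAt (by
      rw [minSmoothness_of_isRCLikeNormedField]; exact WithTop.coe_le_coe.2 (le_top : (2 : ℕ∞) ≤ ⊤))
  have h2 : DifferentiableAt ℝ (fderiv ℝ g) p := hg.smooth_fderiv.differentiableAt
  have h3 : ∀ v w : Plane, fderiv ℝ (fun q => fderiv ℝ g q v) p w =
      fderiv ℝ (fderiv ℝ g) p w v := fun v w => by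
    have := h2.hasFDerivAt.clm_apply (hasFDerivAt_const v p)
    rw [this.fderiv]; simp
  unfold PlaneCurve.dy PlaneCurve.dx
  rw [h3, h3]
  exact h1 _ _

theorem dy_dx_eventuallyEq {g : Plane → ℝ} {p : Plane} (hg : SmoothGermAt g p) :
    dy (dx g) =ᶠ[𝓝 p] dx (dy g) := by
  filter_upwards [hg.eventually] with q hq using dy_dx_eq hq

theorem dx_congr {g h : Plane → ℝ} {p : Plane} (e : g =ᶠ[𝓝 p] h) : dx g =ᶠ[𝓝 p] dx h := by
  filter_upwards [e.fderiv (𝕜 := ℝ)] with q hq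
  simp [dx, hq]

theorem dy_congr {g h : Plane → ℝ} {p : Plane} (e : g =ᶠ[𝓝 p] h) : dy g =ᶠ[𝓝 p] dy h := by
  filter_upwards [e.fderiv (𝕜 := ℝ)] with q hq
  simp [dy, hq]

theorem fderiv_apply_eq_dx_dy (g : Plane → ℝ) (p v : Plane) :
    fderiv ℝ g p v = dx g p * v.1 + dy g p * v.2 := by
  have : v = v.1 • ((1 : ℝ), (0 : ℝ)) + v.2 • ((0 : ℝ), (1 : ℝ)) := by ext <;> simp
  conv_lhs => rw [this]
  rw [map_add, map_smul, map_smul]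
  simp [dx, dy, mul_comm]

theorem hasDerivAt_comp_curve {g : Plane → ℝ} {γ : ℝ → Plane} {γ' : Plane} {u : ℝ}
    (hg : SmoothGermAt g (γ u)) (hγ : HasDerivAt γ γ' u) :
    HasDerivAt (fun t => g (γ t)) (dx g (γ u) * γ'.1 + dy g (γ u) * γ'.2) u := by
  rw [← fderiv_apply_eq_dx_dy]
  exact hg.hasFDerivAt.comp_hasDerivAt u hγ

theorem eventually_deriv_eq_zero {e e' : ℝ → ℝ} {u : ℝ} (h : ∀ᶠ t in 𝓝 u, e t = 0)
    (h' : ∀ᶠ t in 𝓝 u, HasDerivAt e (e' t) t) : ∀ᶠ t in 𝓝 u, e' t = 0 := by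
  filter_upwards [h', h.eventually_nhds] with t h1 h2
  have h3 : HasDerivAt e 0 t := (hasDerivAt_const t (0 : ℝ)).congr_of_eventuallyEq h2
  exact h1.unique h3

theorem hasDerivAt_fst_snd {γ : ℝ → Plane} {v : Plane} {t : ℝ} (h : HasDerivAt γ v t) :
    HasDerivAt (fun s => (γ s).1) v.1 t ∧ HasDerivAt (fun s => (γ s).2) v.2 t :=
  ⟨((ContinuousLinearMap.fst ℝ ℝ ℝ).hasFDerivAt.comp_hasDerivAt t h :),
    ((ContinuousLinearMap.snd ℝ ℝ ℝ).hasFDerivAt.comp_hasDerivAt t h :)⟩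

section Jets

variable {g : Plane → ℝ} {γ γ₁ γ₂ γ₃ γ₄ : ℝ → Plane} {u : ℝ}

/-- This relation and the next three are successive derivatives of g(γ(t)) = 0. They hold on a
neighbourhood, not just at u, so that each can be differentiated again. -/
theorem jet_one (hg : SmoothGermAt g (γ u)) (h0 : ∀ᶠ t in 𝓝 u, g (γ t) = 0)
    (h1 : ∀ᶠ t in 𝓝 u, HasDerivAt γ (γ₁ t) t) :
    ∀ᶠ t in 𝓝 u, dx g (γ t) * (γ₁ t).1 + dy g (γ t) * (γ₁ t).2 = 0 := by
  have hc := h1.self_of_nhds.continuousAt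
  refine eventually_deriv_eq_zero h0 ?_
  filter_upwards [h1, hc.eventually hg.eventually] with t e1 e2
  exact hasDerivAt_comp_curve e2 e1

theorem jet_two (hg : SmoothGermAt g (γ u)) (h0 : ∀ᶠ t in 𝓝 u, g (γ t) = 0)
    (h1 : ∀ᶠ t in 𝓝 u, HasDerivAt γ (γ₁ t) t) (h2 : ∀ᶠ t in 𝓝 u, HasDerivAt γ₁ (γ₂ t) t) :
    ∀ᶠ t in 𝓝 u, dx (dx g) (γ t) * (γ₁ t).1 ^ 2 + 2 * dx (dy g) (γ t) * (γ₁ t).1 * (γ₁ t).2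
      + dy (dy g) (γ t) * (γ₁ t).2 ^ 2 + dx g (γ t) * (γ₂ t).1 + dy g (γ t) * (γ₂ t).2 = 0 := by
  have hc := h1.self_of_nhds.continuousAt
  refine eventually_deriv_eq_zero (jet_one hg h0 h1) ?_
  filter_upwards [h1, h2, hc.eventually hg.eventually] with t e1 e2 eg
  have := ((hasDerivAt_comp_curve eg.dx e1).mul (hasDerivAt_fst_snd e2).1).add
    ((hasDerivAt_comp_curve eg.dy e1).mul (hasDerivAt_fst_snd e2).2)
  refine this.congr_deriv ?_
  rw [dy_dx_eq eg]; ring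

theorem jet_three (hg : SmoothGermAt g (γ u)) (h0 : ∀ᶠ t in 𝓝 u, g (γ t) = 0)
    (h1 : ∀ᶠ t in 𝓝 u, HasDerivAt γ (γ₁ t) t) (h2 : ∀ᶠ t in 𝓝 u, HasDerivAt γ₁ (γ₂ t) t)
    (h3 : ∀ᶠ t in 𝓝 u, HasDerivAt γ₂ (γ₃ t) t) :
    ∀ᶠ t in 𝓝 u, dx (dx (dx g)) (γ t) * (γ₁ t).1 ^ 3
      + 3 * dx (dx (dy g)) (γ t) * (γ₁ t).1 ^ 2 * (γ₁ t).2
      + 3 * dx (dy (dy g)) (γ t) * (γ₁ t).1 * (γ₁ t).2 ^ 2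
      + dy (dy (dy g)) (γ t) * (γ₁ t).2 ^ 3
      + 3 * (dx (dx g) (γ t) * (γ₁ t).1 * (γ₂ t).1
        + dx (dy g) (γ t) * ((γ₁ t).1 * (γ₂ t).2 + (γ₁ t).2 * (γ₂ t).1)
        + dy (dy g) (γ t) * (γ₁ t).2 * (γ₂ t).2)
      + dx g (γ t) * (γ₃ t).1 + dy g (γ t) * (γ₃ t).2 = 0 := by
  have hc := h1.self_of_nhds.continuousAt
  refine eventually_deriv_eq_zero (jet_two hg h0 h1 h2) ?_
  filter_upwards [h1, h2, h3, hc.eventually hg.eventually] with t e1 e2 e3 eg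
  have A := (hasDerivAt_comp_curve eg.dx.dx e1).mul ((hasDerivAt_fst_snd e2).1.pow 2)
  have B := (((hasDerivAt_comp_curve eg.dy.dx e1).const_mul 2).mul (hasDerivAt_fst_snd e2).1).mul (hasDerivAt_fst_snd e2).2
  have C := (hasDerivAt_comp_curve eg.dy.dy e1).mul ((hasDerivAt_fst_snd e2).2.pow 2)
  have D := (hasDerivAt_comp_curve eg.dx e1).mul (hasDerivAt_fst_snd e3).1
  have E := (hasDerivAt_comp_curve eg.dy e1).mul (hasDerivAt_fst_snd e3).2
  have c1 : dy (dx (dx g)) (γ t) = dx (dx (dy g)) (γ t) := by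
    rw [dy_dx_eq eg.dx, (dx_congr (dy_dx_eventuallyEq eg)).eq_of_nhds]
  refine ((((A.add B).add C).add D).add E).congr_deriv ?_
  simp only [Pi.pow_apply, Pi.mul_apply, Nat.cast_ofNat, Nat.add_one_sub_one, pow_one]
  rw [c1, dy_dx_eq eg.dy, dy_dx_eq eg]; ring

theorem jet_four (hg : SmoothGermAt g (γ u)) (h0 : ∀ᶠ t in 𝓝 u, g (γ t) = 0)
    (h1 : ∀ᶠ t in 𝓝 u, HasDerivAt γ (γ₁ t) t) (h2 : ∀ᶠ t in 𝓝 u, HasDerivAt γ₁ (γ₂ t) t)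
    (h3 : ∀ᶠ t in 𝓝 u, HasDerivAt γ₂ (γ₃ t) t) (h4 : ∀ᶠ t in 𝓝 u, HasDerivAt γ₃ (γ₄ t) t) :
    ∀ᶠ t in 𝓝 u, dx (dx (dx (dx g))) (γ t) * (γ₁ t).1 ^ 4
      + 4 * dx (dx (dx (dy g))) (γ t) * (γ₁ t).1 ^ 3 * (γ₁ t).2
      + 6 * dx (dx (dy (dy g))) (γ t) * (γ₁ t).1 ^ 2 * (γ₁ t).2 ^ 2
      + 4 * dx (dy (dy (dy g))) (γ t) * (γ₁ t).1 * (γ₁ t).2 ^ 3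
      + dy (dy (dy (dy g))) (γ t) * (γ₁ t).2 ^ 4
      + 6 * (dx (dx (dx g)) (γ t) * (γ₁ t).1 ^ 2 * (γ₂ t).1
        + dx (dx (dy g)) (γ t) * (2 * (γ₁ t).1 * (γ₁ t).2 * (γ₂ t).1 + (γ₁ t).1 ^ 2 * (γ₂ t).2)
        + dx (dy (dy g)) (γ t) * (2 * (γ₁ t).1 * (γ₁ t).2 * (γ₂ t).2 + (γ₁ t).2 ^ 2 * (γ₂ t).1)
        + dy (dy (dy g)) (γ t) * (γ₁ t).2 ^ 2 * (γ₂ t).2)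
      + 4 * (dx (dx g) (γ t) * (γ₁ t).1 * (γ₃ t).1
        + dx (dy g) (γ t) * ((γ₁ t).1 * (γ₃ t).2 + (γ₁ t).2 * (γ₃ t).1)
        + dy (dy g) (γ t) * (γ₁ t).2 * (γ₃ t).2)
      + 3 * (dx (dx g) (γ t) * (γ₂ t).1 ^ 2 + 2 * dx (dy g) (γ t) * (γ₂ t).1 * (γ₂ t).2
        + dy (dy g) (γ t) * (γ₂ t).2 ^ 2)
      + dx g (γ t) * (γ₄ t).1 + dy g (γ t) * (γ₄ t).2 = 0 := by
  have hc := h1.self_of_nhds.continuousAt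
  refine eventually_deriv_eq_zero (jet_three hg h0 h1 h2 h3) ?_
  filter_upwards [h1, h2, h3, h4, hc.eventually hg.eventually] with t e1 e2 e3 e4 eg
  have A := (hasDerivAt_comp_curve eg.dx.dx.dx e1).mul ((hasDerivAt_fst_snd e2).1.pow 3)
  have B := (((hasDerivAt_comp_curve eg.dy.dx.dx e1).const_mul 3).mul ((hasDerivAt_fst_snd e2).1.pow 2)).mul (hasDerivAt_fst_snd e2).2
  have C := (((hasDerivAt_comp_curve eg.dy.dy.dx e1).const_mul 3).mul (hasDerivAt_fst_snd e2).1).mul ((hasDerivAt_fst_snd e2).2.pow 2)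
  have D := (hasDerivAt_comp_curve eg.dy.dy.dy e1).mul ((hasDerivAt_fst_snd e2).2.pow 3)
  have P := ((hasDerivAt_comp_curve eg.dx.dx e1).mul (hasDerivAt_fst_snd e2).1).mul (hasDerivAt_fst_snd e3).1
  have Q := (hasDerivAt_comp_curve eg.dy.dx e1).mul (((hasDerivAt_fst_snd e2).1.mul (hasDerivAt_fst_snd e3).2).add ((hasDerivAt_fst_snd e2).2.mul (hasDerivAt_fst_snd e3).1))
  have R := ((hasDerivAt_comp_curve eg.dy.dy e1).mul (hasDerivAt_fst_snd e2).2).mul (hasDerivAt_fst_snd e3).2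
  have S := (hasDerivAt_comp_curve eg.dx e1).mul (hasDerivAt_fst_snd e4).1
  have T := (hasDerivAt_comp_curve eg.dy e1).mul (hasDerivAt_fst_snd e4).2
  have c1 : ∀ {h : Plane → ℝ}, SmoothGermAt h (γ t) →
      dy (dx (dx h)) =ᶠ[𝓝 (γ t)] dx (dx (dy h)) := fun eh => by
    filter_upwards [dy_dx_eventuallyEq eh.dx, dx_congr (dy_dx_eventuallyEq eh)] with q h1 h2
    rw [h1, h2]
  have c2 : dy (dx (dx (dx g))) (γ t) = dx (dx (dx (dy g))) (γ t) := by
    rw [dy_dx_eq eg.dx.dx, (dx_congr (c1 eg)).eq_of_nhds]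
  refine (((((((A.add B).add C).add D).add
    (((P.add Q).add R).const_mul 3)).add S).add T)).congr_deriv ?_
  simp only [Pi.pow_apply, Pi.mul_apply, Pi.add_apply, Nat.cast_ofNat, Nat.add_one_sub_one,
    pow_one]
  rw [c2, (c1 eg.dy).eq_of_nhds, (c1 eg).eq_of_nhds, dy_dx_eq eg.dy.dy, dy_dx_eq eg.dy,
    dy_dx_eq eg]
  ring

/-! ### Inflections and vertices read off a parametrisation -/

/-- The determinant of two plane vectors. -/
def cross (v w : Plane) : ℝ := v.1 * w.2 - v.2 * w.1

/-- The Euclidean inner product of two plane vectors. -/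
def dotp (v w : Plane) : ℝ := v.1 * w.1 + v.2 * w.2

/-- The numerator of the derivative of the curvature of a parametrised curve, in terms of its first
three derivatives. -/
def vertNum (v₁ v₂ v₃ : Plane) : ℝ :=
  dotp v₁ v₁ * cross v₁ v₃ - 3 * (cross v₁ v₂ * dotp v₁ v₂)

/-- The velocity is a nonzero multiple λ of (g_y, -g_x). Eliminating higher derivatives with the jet
relations gives `cross` = -λ³ i_g and `vertNum` = -λ⁶ v_g, so zeros correspond. -/
theorem mark_iff_of_curve (hg : SmoothGermAt g (γ u)) (h0 : ∀ᶠ t in 𝓝 u, g (γ t) = 0)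
    (h1 : ∀ᶠ t in 𝓝 u, HasDerivAt γ (γ₁ t) t) (h2 : ∀ᶠ t in 𝓝 u, HasDerivAt γ₁ (γ₂ t) t)
    (h3 : ∀ᶠ t in 𝓝 u, HasDerivAt γ₂ (γ₃ t) t) (hγ : γ₁ u ≠ 0)
    (hd : fderiv ℝ g (γ u) ≠ 0) :
    (IsInflection g (γ u) ↔ cross (γ₁ u) (γ₂ u) = 0) ∧
    (IsVertex g (γ u) ↔ vertNum (γ₁ u) (γ₂ u) (γ₃ u) = 0) ∧
    ¬ IsSingularPoint g (γ u) := by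
  have j1 := (jet_one hg h0 h1).self_of_nhds
  have j2 := (jet_two hg h0 h1 h2).self_of_nhds
  have j3 := (jet_three hg h0 h1 h2 h3).self_of_nhds
  have hz := h0.self_of_nhds
  have hn : ¬ (dx g (γ u) = 0 ∧ dy g (γ u) = 0) := by
    rintro ⟨a, b⟩
    apply hd
    ext <;> simp [fderiv_apply_eq_dx_dy, a, b]
  unfold IsInflection IsVertex IsSingularPoint
  simp only [hz, true_and]
  refine ⟨?_, ?_, hn⟩
  · unfold inflFun cross
    have hγ' : ¬ ((γ₁ u).1 = 0 ∧ (γ₁ u).2 = 0) := fun h => hγ (Prod.ext h.1 h.2)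
    generalize (γ₁ u).1 = x1 at *
    generalize (γ₁ u).2 = y1 at *
    generalize (γ₂ u).1 = x2 at *
    generalize (γ₂ u).2 = y2 at *
    generalize (γ₃ u).1 = x3 at *
    generalize (γ₃ u).2 = y3 at *
    generalize dx g (γ u) = gx at *
    generalize dy g (γ u) = gy at *
    generalize dx (dx g) (γ u) = gxx at *
    generalize dx (dy g) (γ u) = gxy at *
    generalize dy (dy g) (γ u) = gyy at *
    generalize dx (dx (dx g)) (γ u) = gxxx at *
    generalize dx (dx (dy g)) (γ u) = gxxy at *
    generalize dx (dy (dy g)) (γ u) = gxyy at *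
    generalize dy (dy (dy g)) (γ u) = gyyy at *
    have hn2 : gx ^ 2 + gy ^ 2 ≠ 0 := by
      intro h
      exact hn ⟨by nlinarith [sq_nonneg gx, sq_nonneg gy], by nlinarith [sq_nonneg gx, sq_nonneg gy]⟩
    -- λ is the component of the velocity along (g_y, -g_x); the first jet relation says that there
    -- is no other component.
    obtain ⟨l, rfl, rfl⟩ : ∃ l, x1 = l * gy ∧ y1 = -(l * gx) := by
      refine ⟨(x1 * gy - y1 * gx) / (gx ^ 2 + gy ^ 2), ?_, ?_⟩
      · field_simp; linear_combination gx * j1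
      · field_simp; linear_combination gy * j1
    have hl : l ≠ 0 := by rintro rfl; simp at hγ'
    have key : l * gy * y2 - -(l * gx) * x2 =
        -l ^ 3 * (gxx * gy ^ 2 - 2 * gxy * gx * gy + gyy * gx ^ 2) := by
      linear_combination l * j2
    rw [key]; simp [hl]
  · unfold vertFun vertNum cross dotp
    dsimp only
    have hγ' : ¬ ((γ₁ u).1 = 0 ∧ (γ₁ u).2 = 0) := fun h => hγ (Prod.ext h.1 h.2)
    generalize (γ₁ u).1 = x1 at *
    generalize (γ₁ u).2 = y1 at *
    generalize (γ₂ u).1 = x2 at *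
    generalize (γ₂ u).2 = y2 at *
    generalize (γ₃ u).1 = x3 at *
    generalize (γ₃ u).2 = y3 at *
    generalize dx g (γ u) = gx at *
    generalize dy g (γ u) = gy at *
    generalize dx (dx g) (γ u) = gxx at *
    generalize dx (dy g) (γ u) = gxy at *
    generalize dy (dy g) (γ u) = gyy at *
    generalize dx (dx (dx g)) (γ u) = gxxx at *
    generalize dx (dx (dy g)) (γ u) = gxxy at *
    generalize dx (dy (dy g)) (γ u) = gxyy at *
    generalize dy (dy (dy g)) (γ u) = gyyy at *
    have hn2 : gx ^ 2 + gy ^ 2 ≠ 0 := by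
      intro h
      exact hn ⟨by nlinarith [sq_nonneg gx, sq_nonneg gy], by nlinarith [sq_nonneg gx, sq_nonneg gy]⟩
    obtain ⟨l, rfl, rfl⟩ : ∃ l, x1 = l * gy ∧ y1 = -(l * gx) := by
      refine ⟨(x1 * gy - y1 * gx) / (gx ^ 2 + gy ^ 2), ?_, ?_⟩
      · field_simp; linear_combination gx * j1
      · field_simp; linear_combination gy * j1
    have hl : l ≠ 0 := by rintro rfl; simp at hγ'
    have key : (l * gy * (l * gy) + -(l * gx) * -(l * gx)) * (l * gy * y3 - -(l * gx) * x3) -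
            3 * ((l * gy * y2 - -(l * gx) * x2) * (l * gy * x2 + -(l * gx) * y2)) =
          -l ^ 6 * ((gx ^ 2 + gy ^ 2) *
      (-gx ^ 3 * gyyy + 3 * gx ^ 2 * gy * gxyy - 3 * gx * gy ^ 2 * gxxy + gy ^ 3 * gxxx)
    + 3 * gx * gy * (gyy - gxx) * (gx ^ 2 * gyy + gxx * gy ^ 2)
    + 6 * gx * gy * gxy ^ 2 * (gy ^ 2 - gx ^ 2)
    + 3 * gxy * (gx ^ 4 * gyy + 3 * gx ^ 2 * gy ^ 2 * (gxx - gyy) - gxx * gy ^ 4)) := by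
      linear_combination (l ^ 3 * (gx ^ 2 + gy ^ 2)) * j3
        - (3 * l ^ 2 * (gy * x2 - gx * y2) + 3 * l ^ 4 * ((gxx * gy - gxy * gx) * gx + (gxy * gy - gyy * gx) * gy)) * j2
    rw [key]; simp [hl]

end Jets

/-! ## Jets of the branches of the curve at the singular point -/

theorem partials_zero_eq_taylorCoeff (g : Plane → ℝ) :
    (dx g 0 = taylorCoeff g 1 0 ∧ dy g 0 = taylorCoeff g 0 1) ∧
    (dx (dx g) 0 = 2 * taylorCoeff g 2 0 ∧ dx (dy g) 0 = taylorCoeff g 1 1 ∧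
      dy (dy g) 0 = 2 * taylorCoeff g 0 2) ∧
    (dx (dx (dx g)) 0 = 6 * taylorCoeff g 3 0 ∧ dx (dx (dy g)) 0 = 2 * taylorCoeff g 2 1 ∧
      dx (dy (dy g)) 0 = 2 * taylorCoeff g 1 2 ∧ dy (dy (dy g)) 0 = 6 * taylorCoeff g 0 3) ∧
    (dx (dx (dx (dx g))) 0 = 24 * taylorCoeff g 4 0 ∧
      dx (dx (dx (dy g))) 0 = 6 * taylorCoeff g 3 1 ∧
      dx (dx (dy (dy g))) 0 = 4 * taylorCoeff g 2 2 ∧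
      dx (dy (dy (dy g))) 0 = 6 * taylorCoeff g 1 3 ∧
      dy (dy (dy (dy g))) 0 = 24 * taylorCoeff g 0 4) := by
  simp only [taylorCoeff, Function.iterate_succ, Function.iterate_zero, Function.comp_apply, id,
    Nat.factorial]
  norm_num
  refine ⟨?_, ?_, ?_⟩ <;> ring_nf <;> simp

section Branch

variable {g : Plane → ℝ} {α : ℝ → Plane}

/-- The third and fourth derivatives of g∘α = 0 at the singular point: as dg vanishes there, they
constrain α'' and α''', one order lower than usual. -/
theorem branch_jets (hg : SmoothGermAt g 0) (h10 : taylorCoeff g 1 0 = 0)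
    (h01 : taylorCoeff g 0 1 = 0) (h20 : taylorCoeff g 2 0 = 0) (h11 : taylorCoeff g 1 1 = 1)
    (hα : SmoothGermAt α 0) (hα0 : α 0 = 0) (h0 : ∀ᶠ t in 𝓝 0, g (α t) = 0) (x₁ y₁ : ℝ)
    (hx : deriv α 0 = (x₁, y₁)) :
    ∃ x₂ y₂ x₃ y₃ : ℝ, deriv (deriv α) 0 = (x₂, y₂) ∧ deriv (deriv (deriv α)) 0 = (x₃, y₃) ∧
      6 * (taylorCoeff g 3 0 * x₁ ^ 3 + taylorCoeff g 2 1 * x₁ ^ 2 * y₁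
        + taylorCoeff g 1 2 * x₁ * y₁ ^ 2 + taylorCoeff g 0 3 * y₁ ^ 3)
        + 3 * (x₁ * y₂ + y₁ * x₂ + 2 * taylorCoeff g 0 2 * y₁ * y₂) = 0 ∧
      24 * (taylorCoeff g 4 0 * x₁ ^ 4 + taylorCoeff g 3 1 * x₁ ^ 3 * y₁
        + taylorCoeff g 2 2 * x₁ ^ 2 * y₁ ^ 2 + taylorCoeff g 1 3 * x₁ * y₁ ^ 3
        + taylorCoeff g 0 4 * y₁ ^ 4)
        + 12 * (3 * taylorCoeff g 3 0 * x₁ ^ 2 * x₂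
          + taylorCoeff g 2 1 * (2 * x₁ * y₁ * x₂ + x₁ ^ 2 * y₂)
          + taylorCoeff g 1 2 * (2 * x₁ * y₁ * y₂ + y₁ ^ 2 * x₂)
          + 3 * taylorCoeff g 0 3 * y₁ ^ 2 * y₂)
        + 4 * (x₁ * y₃ + y₁ * x₃ + 2 * taylorCoeff g 0 2 * y₁ * y₃)
        + 3 * (2 * x₂ * y₂ + 2 * taylorCoeff g 0 2 * y₂ ^ 2) = 0 := by
  have hg' : SmoothGermAt g (α 0) := by rwa [hα0]
  have d : ∀ {β : ℝ → Plane}, SmoothGermAt β 0 → ∀ᶠ t in 𝓝 0, HasDerivAt β (deriv β t) t :=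
    fun hβ => by filter_upwards [hβ.eventually] with t ht using ht.differentiableAt.hasDerivAt
  have d1 := d hα
  have d2 := d hα.smooth_deriv
  have d3 := d hα.smooth_deriv.smooth_deriv
  have d4 := d hα.smooth_deriv.smooth_deriv.smooth_deriv
  have j3 := (jet_three hg' h0 d1 d2 d3).self_of_nhds
  have j4 := (jet_four hg' h0 d1 d2 d3 d4).self_of_nhds
  obtain ⟨⟨t10, t01⟩, ⟨t20, t11, t02⟩, ⟨t30, t21, t12, t03⟩, t40, t31, t22, t13, t04⟩ :=
    partials_zero_eq_taylorCoeff g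
  rw [hα0, hx] at j3 j4
  simp only [t10, t01, t20, t11, t02, t30, t21, t12, t03, t40, t31, t22, t13, t04, h10, h01, h20,
    h11] at j3 j4
  refine ⟨(deriv (deriv α) 0).1, (deriv (deriv α) 0).2, (deriv (deriv (deriv α)) 0).1,
    (deriv (deriv (deriv α)) 0).2, rfl, rfl, ?_, ?_⟩
  · linear_combination j3
  · linear_combination j4

theorem first_branch (hg : SmoothGermAt g 0) (h10 : taylorCoeff g 1 0 = 0)
    (h01 : taylorCoeff g 0 1 = 0) (h20 : taylorCoeff g 2 0 = 0) (h11 : taylorCoeff g 1 1 = 1)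
    (hα : SmoothGermAt α 0) (hα0 : α 0 = 0) (h0 : ∀ᶠ t in 𝓝 0, g (α t) = 0)
    (hx : deriv α 0 = (1, 0)) :
    cross (deriv α 0) (deriv (deriv α) 0) = -2 * eta1 g ∧
    vertNum (deriv α 0) (deriv (deriv α) 0) (deriv (deriv (deriv α)) 0) = -6 * eta3 g := by
  obtain ⟨x₂, y₂, x₃, y₃, e2, e3, h3, h4⟩ := branch_jets hg h10 h01 h20 h11 hα hα0 h0 1 0 hx
  rw [hx, e2, e3]
  have hy : y₂ = -2 * taylorCoeff g 3 0 := by linear_combination h3 / 3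
  subst hy
  simp only [cross, vertNum, dotp, eta1, eta3]
  constructor
  · ring
  · linear_combination h4 / 4

/-- The direction (-a₂₂ζ, ζ) annihilates the factor x + a₂₂y of the quadratic part. The scale ζ is
kept free since the chart does not normalise this branch; the exponents 3 and 6 are the weights of
the two invariants under reparametrisation. -/
theorem second_branch (hg : SmoothGermAt g 0) (h10 : taylorCoeff g 1 0 = 0)
    (h01 : taylorCoeff g 0 1 = 0) (h20 : taylorCoeff g 2 0 = 0) (h11 : taylorCoeff g 1 1 = 1)
    (hα : SmoothGermAt α 0) (hα0 : α 0 = 0) (h0 : ∀ᶠ t in 𝓝 0, g (α t) = 0) {ζ : ℝ} (hζ : ζ ≠ 0)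
    (hx : deriv α 0 = (-taylorCoeff g 0 2 * ζ, ζ)) :
    cross (deriv α 0) (deriv (deriv α) 0) = -2 * ζ ^ 3 * eta2 g ∧
    vertNum (deriv α 0) (deriv (deriv α) 0) (deriv (deriv (deriv α)) 0) =
      6 * ζ ^ 6 * eta4 g := by
  obtain ⟨x₂, y₂, x₃, y₃, e2, e3, h3, h4⟩ := branch_jets hg h10 h01 h20 h11 hα hα0 h0 _ _ hx
  rw [hx, e2, e3]
  -- Only x₂ + a₂₂y₂ is determined by the branch; y₂ depends on the parametrisation and drops out of
  -- both invariants.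
  have hy : x₂ = -taylorCoeff g 0 2 * y₂ + 2 * ζ ^ 2 * eta2 g := by
    apply mul_left_cancel₀ hζ
    unfold eta2
    linear_combination h3 / 3
  subst hy
  simp only [cross, vertNum, dotp, eta2, eta4] at *
  constructor
  · ring
  · linear_combination (-(1 + taylorCoeff g 0 2 ^ 2) * ζ ^ 2 / 4) * h4

end Branch

/-! ## Local inverses -/

/-- The inverse function theorem at 0, plus smoothness of the inverse at all nearby points:
invertible derivatives form an open set, so M remains a local diffeomorphism near 0. -/
theorem SmoothGermAt.exists_inverse {E : Type*} [NormedAddCommGroup E] [NormedSpace ℝ E]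
    [CompleteSpace E] {M : E → E} (hM : SmoothGermAt M 0) (h0 : M 0 = 0) (L : E ≃L[ℝ] E)
    (hL : HasFDerivAt M (L : E →L[ℝ] E) 0) :
    ∃ N : E → E, SmoothGermAt N 0 ∧ N 0 = 0 ∧ (∀ᶠ z in 𝓝 0, M (N z) = z) ∧
      (∀ᶠ w in 𝓝 0, N (M w) = w) ∧ HasFDerivAt N (L.symm : E →L[ℝ] E) 0 := by
  let e := hM.contDiffAt.toOpenPartialHomeomorph M hL (by simp)
  have he : ∀ x, e x = M x := fun x => rfl
  have hs : (0 : E) ∈ e.source := hM.contDiffAt.mem_toOpenPartialHomeomorph_source hL (by simp)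
  have ht : (0 : E) ∈ e.target := by
    have := e.map_source hs
    rwa [he, h0] at this
  have hsymm : e.symm 0 = 0 := by
    have := e.left_inv hs
    rwa [he, h0] at this
  have hcont : ContinuousAt e.symm 0 := e.continuousAt_symm ht
  refine ⟨e.symm, ?_, hsymm, ?_, ?_, ?_⟩
  · have h1 : ∀ᶠ w in 𝓝 (0 : E), ∃ L' : E ≃L[ℝ] E, (L' : E →L[ℝ] E) = fderiv ℝ M w := by
      have hc : ContinuousAt (fderiv ℝ M) 0 := hM.smooth_fderiv.continuousAt
      have hn : range ((↑) : (E ≃L[ℝ] E) → E →L[ℝ] E) ∈ 𝓝 (fderiv ℝ M 0) := by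
        rw [hL.fderiv]; exact ContinuousLinearEquiv.nhds L
      exact hc hn
    have h2 : ∀ᶠ z in 𝓝 (0 : E), SmoothGermAt M (e.symm z) ∧
        ∃ L' : E ≃L[ℝ] E, (L' : E →L[ℝ] E) = fderiv ℝ M (e.symm z) := by
      have h3 := hM.eventually.and h1
      rw [← hsymm] at h3
      exact hcont.eventually h3
    filter_upwards [h2, e.open_target.mem_nhds ht] with z ⟨hz, L', hL'⟩ hzt
    refine e.contDiffAt_symm (f₀' := L') hzt ?_ ?_
    · rw [hL']; exact hz.hasFDerivAt
    · exact hz.contDiffAt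
  · filter_upwards [e.open_target.mem_nhds ht] with z hz using e.right_inv hz
  · filter_upwards [e.open_source.mem_nhds hs] with z hz using e.left_inv hz
  · exact e.hasFDerivAt_symm ht (by rw [hsymm]; exact hL)

/-! ## Factorisation of the singularity -/

theorem SmoothGermAt.exists_eq_smul_self {G : Type} [NormedAddCommGroup G] [NormedSpace ℝ G]
    [CompleteSpace G] {φ : ℝ → G} (hφ : SmoothGermAt φ 0) (h0 : φ 0 = 0) :
    ∃ ψ : ℝ → G, SmoothGermAt ψ 0 ∧ (∀ᶠ t in 𝓝 0, φ t = t • ψ t) ∧ ψ 0 = deriv φ 0 := by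
  have h1 : SmoothGermAt (fun z : ℝ × ℝ => φ z.2) 0 := hφ.comp_of_eq (smoothGermAt_snd 0) rfl
  obtain ⟨k, hk, he, hv⟩ := h1.exists_eq_smul (Eventually.of_forall fun _ => h0)
  have hc : Tendsto (fun t : ℝ => ((0 : ℝ), t)) (𝓝 0) (𝓝 0) :=
    (Continuous.prodMk_right (0 : ℝ)).tendsto' 0 0 rfl
  refine ⟨fun t => k (0, t), ?_, ?_, ?_⟩
  · exact hk.comp_of_eq ((smoothGermAt_const 0 0).prodMk (contDiff_id.smoothGermAt 0)) rfl
  · filter_upwards [hc.eventually he] with t ht using ht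
  · show k 0 = _
    rw [hv]
    have h2 : HasFDerivAt (fun z : ℝ × ℝ => φ z.2)
        ((fderiv ℝ φ 0).comp (ContinuousLinearMap.snd ℝ ℝ ℝ)) 0 :=
      HasFDerivAt.comp (g := φ) (0 : ℝ × ℝ) hφ.hasFDerivAt hasFDerivAt_snd
    rw [h2.fderiv]; simp

/-- Used to identify the values at 0 of the coefficients that Hadamard's lemma produces. -/
theorem second_derivative_along_line {g : Plane → ℝ} {k : ℝ → ℝ} (hg : SmoothGermAt g 0)
    (hk : SmoothGermAt k 0) (a b : ℝ) (h : ∀ᶠ t in 𝓝 (0 : ℝ), g (t * a, t * b) = t ^ 2 * k t) :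
    dx (dx g) 0 * a ^ 2 + 2 * dx (dy g) 0 * a * b + dy (dy g) 0 * b ^ 2 = 2 * k 0 := by
  let γ : ℝ → Plane := fun t => (t * a, t * b)
  have hγ : ∀ t, HasDerivAt γ (a, b) t := fun t =>
    (hasDerivAt_mul_const a).prodMk (hasDerivAt_mul_const b)
  have hγ0 : γ 0 = 0 := by simp [γ]
  have hg' : SmoothGermAt g (γ 0) := by rwa [hγ0]
  have e1 : ∀ᶠ t in 𝓝 (0 : ℝ), dx g (γ t) * a + dy g (γ t) * b = 2 * t * k t + t ^ 2 * deriv k t := by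
    filter_upwards [(hγ 0).continuousAt.eventually hg'.eventually, hk.eventually,
      h.eventually_nhds] with t h1 h2 h3
    have d1 := hasDerivAt_comp_curve h1 (hγ t)
    have d2 := ((hasDerivAt_id t).pow 2).mul h2.differentiableAt.hasDerivAt
    have := (d1.congr_of_eventuallyEq (h3.mono fun s hs => hs.symm)).unique d2
    simpa using this
  have d1 := ((hasDerivAt_comp_curve hg'.dx (hγ 0)).mul_const a).add
    ((hasDerivAt_comp_curve hg'.dy (hγ 0)).mul_const b)
  have d2 := (((hasDerivAt_id (0 : ℝ)).const_mul 2).mul hk.differentiableAt.hasDerivAt).add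
    (((hasDerivAt_id (0 : ℝ)).pow 2).mul hk.smooth_deriv.differentiableAt.hasDerivAt)
  have := (d1.congr_of_eventuallyEq (e1.mono fun s hs => hs.symm)).unique d2
  rw [hγ0, dy_dx_eq hg] at this
  simp at this
  linear_combination this

/-- Hadamard's lemma twice in y gives g = g(x, 0) + y k(x, 0) + y² C; the one-variable version then
divides g(x, 0) by x² and k(x, 0) by x. So A and B depend on x alone. -/
theorem exists_quadratic_form {g : Plane → ℝ} (hg : SmoothGermAt g 0) (h00 : g 0 = 0)
    (h10 : dx g 0 = 0) (h01 : dy g 0 = 0) :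
    ∃ A B C : Plane → ℝ, SmoothGermAt A 0 ∧ SmoothGermAt B 0 ∧ SmoothGermAt C 0 ∧
      (∀ᶠ p in 𝓝 (0 : Plane), g p = A p * p.1 ^ 2 + B p * p.1 * p.2 + C p * p.2 ^ 2) ∧
      2 * A 0 = dx (dx g) 0 ∧ B 0 = dx (dy g) 0 ∧ 2 * C 0 = dy (dy g) 0 := by
  have sx : SmoothGermAt (fun p : Plane => (p.1, (0 : ℝ))) 0 :=
    (smoothGermAt_fst 0).prodMk (smoothGermAt_const 0 0)
  have tx : Tendsto (fun p : Plane => p.1) (𝓝 0) (𝓝 0) := continuous_fst.tendsto' 0 0 rfl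
  have sr : SmoothGermAt (fun t : ℝ => (t, (0 : ℝ))) 0 :=
    (contDiff_id.smoothGermAt 0).prodMk (smoothGermAt_const 0 0)
  obtain ⟨k, hk, ek, vk⟩ := (hg.sub (hg.comp_of_eq sx rfl)).exists_eq_smul (by simp)
  obtain ⟨C, hC, eC, -⟩ := (hk.sub (hk.comp_of_eq sx rfl)).exists_eq_smul (by simp)
  have hk0 : k 0 = 0 := by
    rw [vk]
    have h2 : HasFDerivAt (fun p : Plane => g (p.1, 0)) ((fderiv ℝ g 0).comp
        ((ContinuousLinearMap.fst ℝ ℝ ℝ).prod 0)) 0 :=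
      HasFDerivAt.comp (g := g) (f := fun p : Plane => (p.1, (0 : ℝ))) (0 : Plane) hg.hasFDerivAt
        (hasFDerivAt_fst.prodMk (hasFDerivAt_const 0 0))
    rw [HasFDerivAt.fderiv (f := fun y : Plane => g y - g (y.1, 0)) (hg.hasFDerivAt.sub h2)]
    have hz : fderiv ℝ g 0 ((0 : ℝ), (0 : ℝ)) = 0 := map_zero _
    simpa [dy, hz] using h01
  obtain ⟨b, hb, eb, -⟩ := (hk.comp_of_eq sr rfl).exists_eq_smul_self hk0
  obtain ⟨a₀, ha₀, ea₀, va₀⟩ := (hg.comp_of_eq sr rfl).exists_eq_smul_self h00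
  have ha0 : a₀ 0 = 0 := by
    rw [va₀]
    have h2 : HasDerivAt (fun t : ℝ => (t, (0 : ℝ))) (1, 0) 0 :=
      (hasDerivAt_id 0).prodMk (hasDerivAt_const 0 0)
    have := (hasDerivAt_comp_curve (γ := fun t : ℝ => (t, (0 : ℝ))) (u := 0) hg h2).deriv
    rw [this]
    show dx g 0 * 1 + dy g 0 * 0 = 0
    rw [h10]; ring
  obtain ⟨a, ha, ea, -⟩ := ha₀.exists_eq_smul_self ha0
  have key : ∀ᶠ p in 𝓝 (0 : Plane),
      g p = a p.1 * p.1 ^ 2 + b p.1 * p.1 * p.2 + C p * p.2 ^ 2 := by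
    filter_upwards [ek, eC, tx.eventually eb, tx.eventually ea₀, tx.eventually ea]
      with p e1 e2 e3 e4 e5
    simp only [smul_eq_mul] at e1 e2 e3 e4 e5
    linear_combination e1 + p.2 * e2 + p.2 * e3 + e4 + p.1 * e5
  have hA : SmoothGermAt (fun p : Plane => a p.1) 0 := ha.comp_of_eq (smoothGermAt_fst 0) rfl
  have hB : SmoothGermAt (fun p : Plane => b p.1) 0 := hb.comp_of_eq (smoothGermAt_fst 0) rfl
  -- Comparison of second derivatives on every line through 0; the directions (1, 0), (0, 1) and (1,
  -- 1) then separate the three coefficients.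
  have line : ∀ v w : ℝ, dx (dx g) 0 * v ^ 2 + 2 * dx (dy g) 0 * v * w + dy (dy g) 0 * w ^ 2 =
      2 * (a 0 * v ^ 2 + b 0 * v * w + C 0 * w ^ 2) := by
    intro v w
    have sl : SmoothGermAt (fun t : ℝ => ((t * v, t * w) : Plane)) 0 :=
      ContDiff.smoothGermAt (by fun_prop) 0
    have z0 : (((0 : ℝ) * v, (0 : ℝ) * w) : Plane) = 0 := by simp
    have := second_derivative_along_line hg (((((hA.comp_of_eq sl z0).mul
      (smoothGermAt_const (v ^ 2) 0)).add ((hB.comp_of_eq sl z0).mul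
      (smoothGermAt_const (v * w) 0)))).add ((hC.comp_of_eq sl z0).mul
      (smoothGermAt_const (w ^ 2) 0))) v w ?_
    · rw [this, z0]; show 2 * (a 0 * _ + b 0 * _ + C 0 * _) = _; ring
    · have tl : Tendsto (fun t : ℝ => ((t * v, t * w) : Plane)) (𝓝 0) (𝓝 0) := by
        have := sl.continuousAt.tendsto
        simp only [z0] at this
        exact this
      filter_upwards [tl.eventually key] with t ht
      rw [ht]; ring
  refine ⟨_, _, C, hA, hB, hC, key, ?_, ?_, ?_⟩
  · linear_combination -line 1 0
  · show b 0 = _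
    linear_combination (-line 1 1 + line 1 0 + line 0 1) / 2
  · linear_combination -line 0 1

/-- The form A x² + B xy + C y² factors as (x + m y)(A x + n y), where n is a root of n² - Bn + AC =
0 and m = C/n. The discriminant is 1 at the origin, so its square root is smooth, and the plus sign
yields n(0) = 1. -/
theorem exists_factorisation {g : Plane → ℝ} (hg : SmoothGermAt g 0)
    (h00 : taylorCoeff g 0 0 = 0) (h10 : taylorCoeff g 1 0 = 0) (h01 : taylorCoeff g 0 1 = 0)
    (h20 : taylorCoeff g 2 0 = 0) (h11 : taylorCoeff g 1 1 = 1) :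
    ∃ u v : Plane → ℝ, SmoothGermAt u 0 ∧ SmoothGermAt v 0 ∧ u 0 = 0 ∧ v 0 = 0 ∧
      (∀ᶠ p in 𝓝 (0 : Plane), g p = u p * v p) ∧
      HasFDerivAt u (ContinuousLinearMap.fst ℝ ℝ ℝ
        + taylorCoeff g 0 2 • ContinuousLinearMap.snd ℝ ℝ ℝ) 0 ∧
      HasFDerivAt v (ContinuousLinearMap.snd ℝ ℝ ℝ) 0 := by
  obtain ⟨⟨t10, t01⟩, ⟨t20, t11, t02⟩, -⟩ := partials_zero_eq_taylorCoeff g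
  obtain ⟨A, B, C, hA, hB, hC, e, vA, vB, vC⟩ := exists_quadratic_form hg
    (by simpa [taylorCoeff] using h00) (t10.trans h10) (t01.trans h01)
  have A0 : A 0 = 0 := by rw [t20, h20] at vA; linarith
  have B0 : B 0 = 1 := by rw [vB, t11, h11]
  have C0 : C 0 = taylorCoeff g 0 2 := by rw [t02] at vC; linarith
  have hD : SmoothGermAt (fun p => B p * B p - 4 * (A p * C p)) 0 :=
    (hB.mul hB).sub ((smoothGermAt_const 4 0).mul (hA.mul hC))
  have D0 : B 0 * B 0 - 4 * (A 0 * C 0) = 1 := by rw [A0, B0]; ring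
  let n : Plane → ℝ := fun p => (B p + Real.sqrt (B p * B p - 4 * (A p * C p))) / 2
  have hn : SmoothGermAt n 0 :=
    (hB.add (hD.sqrt (by rw [D0]; exact one_ne_zero))).div (smoothGermAt_const 2 0) two_ne_zero
  have n0 : n 0 = 1 := by simp only [n]; rw [D0, B0]; norm_num
  have n0' : n 0 ≠ 0 := by rw [n0]; exact one_ne_zero
  let m : Plane → ℝ := fun p => C p / n p
  have hm : SmoothGermAt m 0 := hC.div hn n0'
  have m0 : m 0 = taylorCoeff g 0 2 := by simp only [m]; rw [n0, C0, div_one]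
  have sx := smoothGermAt_fst (E := ℝ) (F := ℝ) 0
  have sy := smoothGermAt_snd (E := ℝ) (F := ℝ) 0
  refine ⟨fun p => p.1 + m p * p.2, fun p => A p * p.1 + n p * p.2, sx.add (hm.mul sy),
    (hA.mul sx).add (hn.mul sy), by simp, by simp, ?_, ?_, ?_⟩
  · filter_upwards [e, hn.continuousAt.eventually_ne n0',
      hD.continuousAt.eventually (lt_mem_nhds (show (0 : ℝ) < B 0 * B 0 - 4 * (A 0 * C 0) by rw [D0]; exact one_pos))]
      with p e1 e2 e3
    have h1 : m p * n p = C p := div_mul_cancel₀ _ e2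
    have h2 : n p + m p * A p = B p := by
      apply mul_right_cancel₀ e2
      have h3 : n p * n p - B p * n p + A p * C p = 0 := by
        have := Real.mul_self_sqrt e3.le
        simp only [n]
        linear_combination this / 4
      linear_combination h3 + A p * h1
    rw [e1]
    linear_combination (-p.2 ^ 2) * h1 - p.1 * p.2 * h2
  · have := (hasFDerivAt_fst (𝕜 := ℝ) (p := (0 : Plane))).add
      (hm.hasFDerivAt.mul (hasFDerivAt_snd (𝕜 := ℝ) (p := (0 : Plane))))
    refine this.congr_fderiv ?_
    rw [m0]; simp
  · have := (hA.hasFDerivAt.mul (hasFDerivAt_fst (𝕜 := ℝ) (p := (0 : Plane)))).add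
      (hn.hasFDerivAt.mul (hasFDerivAt_snd (𝕜 := ℝ) (p := (0 : Plane))))
    refine this.congr_fderiv ?_
    rw [n0, A0]; simp

/-! ## The hyperbolic chart -/

theorem exists_chart {F : Plane × ℝ → ℝ} {g : Plane → ℝ} (hF : SmoothGermAt F 0)
    (hg : SmoothGermAt g 0) (hFg : ∀ᶠ p in 𝓝 (0 : Plane), F (p, 0) = g p)
    (h00 : taylorCoeff g 0 0 = 0) (h10 : taylorCoeff g 1 0 = 0) (h01 : taylorCoeff g 0 1 = 0)
    (h20 : taylorCoeff g 2 0 = 0) (h11 : taylorCoeff g 1 1 = 1) {κ : ℝ}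
    (hκ : fderiv ℝ F 0 (0, 1) = κ) (hκ0 : κ ≠ 0) :
    ∃ (Φ : ℝ × ℝ → Plane) (c : Plane → ℝ), SmoothGermAt Φ 0 ∧ Φ 0 = 0 ∧ SmoothGermAt c 0 ∧
      (∀ᶠ z in 𝓝 0, c (Φ z) = z.1) ∧ fderiv ℝ Φ 0 (1, 0) = (1, 0) ∧
      fderiv ℝ Φ 0 (0, 1) = (-taylorCoeff g 0 2 * (-κ), -κ) ∧
      (∀ᶠ z in 𝓝 (0 : ℝ × ℝ), F (Φ z, z.1 * z.2) = 0) ∧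
      (∀ᶠ z in 𝓝 (0 : ℝ × ℝ), z.1 * z.2 ≠ 0 →
        fderiv ℝ (fun p => F (p, z.1 * z.2)) (Φ z) ≠ 0) ∧
      ∀ N ∈ 𝓝 (0 : ℝ × ℝ), ∀ᶠ w in 𝓝 (0 : Plane × ℝ), F w = 0 →
        ∃ z ∈ N, z.1 * z.2 = w.2 ∧ Φ z = w.1 := by
  obtain ⟨u, v, hu, hv, u0, v0, huv, du, dv⟩ := exists_factorisation hg h00 h10 h01 h20 h11
  have s0 : SmoothGermAt (fun w : Plane × ℝ => (w.1, (0 : ℝ))) 0 :=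
    (smoothGermAt_fst 0).prodMk (smoothGermAt_const 0 0)
  obtain ⟨k, hk, ek, vk⟩ := (hF.sub (hF.comp_of_eq s0 rfl)).exists_eq_smul (by simp)
  have hkκ : k 0 = κ := by
    rw [vk]
    have h2 : HasFDerivAt (fun w : Plane × ℝ => F (w.1, 0)) ((fderiv ℝ F 0).comp
        ((ContinuousLinearMap.fst ℝ Plane ℝ).prod 0)) 0 :=
      HasFDerivAt.comp (g := F) (f := fun w : Plane × ℝ => (w.1, (0 : ℝ))) (0 : Plane × ℝ)
        hF.hasFDerivAt (hasFDerivAt_fst.prodMk (hasFDerivAt_const 0 0))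
    rw [HasFDerivAt.fderiv (f := fun w : Plane × ℝ => F w - F (w.1, 0)) (hF.hasFDerivAt.sub h2)]
    have hz : fderiv ℝ F 0 ((0 : Plane), (0 : ℝ)) = 0 := map_zero _
    simp [hκ, hz]
  have hk0 : k 0 ≠ 0 := by rwa [hkκ]
  have t1 : Tendsto (fun w : Plane × ℝ => w.1) (𝓝 0) (𝓝 0) := continuous_fst.tendsto' 0 0 rfl
  have su : SmoothGermAt (fun w : Plane × ℝ => u w.1) 0 := hu.comp_of_eq (smoothGermAt_fst 0) rfl
  have sv : SmoothGermAt (fun w : Plane × ℝ => v w.1) 0 := hv.comp_of_eq (smoothGermAt_fst 0) rfl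
  -- From F = uv + s k one gets F = k (s - U V) with U = u and V = -v/k, so F = 0 exactly where the
  -- coordinates (U, V, s) satisfy UV = s.
  let M : Plane × ℝ → Plane × ℝ := fun w => ((u w.1, -v w.1 / k w), w.2)
  have hM : SmoothGermAt M 0 := (su.prodMk (sv.neg.div hk hk0)).prodMk (smoothGermAt_snd 0)
  have M0 : M 0 = 0 := by simp [M, u0, v0]
  have hFM : ∀ᶠ w in 𝓝 (0 : Plane × ℝ), F w = k w * (w.2 - (M w).1.1 * (M w).1.2) := by
    filter_upwards [ek, t1.eventually huv, t1.eventually hFg, hk.continuousAt.eventually_ne hk0]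
      with w e1 e2 e3 e4
    simp only [smul_eq_mul] at e1
    simp only [M]
    field_simp
    linear_combination e1 + e2 + e3
  let a := taylorCoeff g 0 2
  let fx : Plane × ℝ →L[ℝ] ℝ := (ContinuousLinearMap.fst ℝ ℝ ℝ).comp (ContinuousLinearMap.fst ℝ _ _)
  let fy : Plane × ℝ →L[ℝ] ℝ := (ContinuousLinearMap.snd ℝ ℝ ℝ).comp (ContinuousLinearMap.fst ℝ _ _)
  let fs : Plane × ℝ →L[ℝ] ℝ := ContinuousLinearMap.snd ℝ _ _
  let L : (Plane × ℝ) ≃L[ℝ] (Plane × ℝ) := ContinuousLinearEquiv.equivOfInverse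
    (((fx + a • fy).prod (-(κ⁻¹ • fy))).prod fs)
    (((fx + (a * κ) • fy).prod (-(κ • fy))).prod fs)
    (fun w => by
      ext <;> simp [fx, fy, fs]
      · field_simp; ring
      · field_simp)
    (fun w => by
      ext <;> simp [fx, fy, fs]
      · ring
      · field_simp)
  have hL : HasFDerivAt M (L : Plane × ℝ →L[ℝ] Plane × ℝ) 0 := by
    have d1 : HasFDerivAt (fun w : Plane × ℝ => u w.1) (fx + a • fy) 0 :=
      HasFDerivAt.comp (g := u) (f := fun w : Plane × ℝ => w.1) (0 : Plane × ℝ) du hasFDerivAt_fst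
    have d2 : HasFDerivAt (fun w : Plane × ℝ => v w.1) fy 0 :=
      HasFDerivAt.comp (g := v) (f := fun w : Plane × ℝ => w.1) (0 : Plane × ℝ) dv hasFDerivAt_fst
    have d3 : HasFDerivAt (fun w : Plane × ℝ => -v w.1 / k w) (-(κ⁻¹ • fy)) 0 := by
      have := d2.neg.mul ((hasDerivAt_inv hk0).comp_hasFDerivAt (0 : Plane × ℝ) hk.hasFDerivAt)
      refine (this.congr_fderiv ?_).congr_of_eventuallyEq ?_
      · ext <;> simp [v0, hkκ]
      · exact Eventually.of_forall fun w => by simp [div_eq_mul_inv]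
    exact (d1.prodMk d3).prodMk hasFDerivAt_snd
  obtain ⟨N, hN, N0, hMN, hNM, hN'⟩ := hM.exists_inverse M0 L hL
  -- J is the graph of s = UV. The chart is the inverse of M along this graph, projected to the
  -- plane.
  let J : ℝ × ℝ → Plane × ℝ := fun z => (z, z.1 * z.2)
  have hJ : SmoothGermAt J 0 := ContDiff.smoothGermAt (by fun_prop) 0
  have J0 : J 0 = 0 := by simp [J]
  have tJ : Tendsto J (𝓝 0) (𝓝 0) := by
    have := hJ.continuousAt.tendsto; rwa [J0] at this
  have hNJ : SmoothGermAt (fun z => N (J z)) 0 := hN.comp_of_eq hJ J0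
  have tN : Tendsto N (𝓝 0) (𝓝 0) := by
    have := hN.continuousAt.tendsto; rwa [N0] at this
  have eJ : ∀ᶠ z in 𝓝 (0 : ℝ × ℝ), M (N (J z)) = J z := tJ.eventually hMN
  have hΦ' : HasFDerivAt (fun z => (N (J z)).1) ((ContinuousLinearMap.fst ℝ Plane ℝ).comp
      ((L.symm : Plane × ℝ →L[ℝ] Plane × ℝ).comp ((ContinuousLinearMap.id ℝ _).prod 0))) 0 := by
    have d1 : HasFDerivAt J ((ContinuousLinearMap.id ℝ _).prod 0) 0 := by
      have := (hasFDerivAt_fst (𝕜 := ℝ) (p := (0 : ℝ × ℝ))).mul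
        (hasFDerivAt_snd (𝕜 := ℝ) (p := (0 : ℝ × ℝ)))
      exact (hasFDerivAt_id (𝕜 := ℝ) (0 : ℝ × ℝ)).prodMk (this.congr_fderiv (by simp))
    have d2 : HasFDerivAt N (L.symm : Plane × ℝ →L[ℝ] Plane × ℝ) (J 0) := by rw [J0]; exact hN'
    exact (d2.comp (0 : ℝ × ℝ) d1).fst
  refine ⟨fun z => (N (J z)).1, u, hNJ.fst, by simp [J0, N0], hu, ?_, ?_, ?_, ?_, ?_, ?_⟩
  · filter_upwards [eJ] with z hz
    exact congrArg (fun w => w.1.1) hz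
  · rw [hΦ'.fderiv]
    show (L.symm (((1 : ℝ), (0 : ℝ)), (0 : ℝ))).1 = _
    simp [L, fx, fy]
  · rw [hΦ'.fderiv]
    show (L.symm (((0 : ℝ), (1 : ℝ)), (0 : ℝ))).1 = _
    simp [L, fx, fy, a]
  · filter_upwards [eJ, tJ.eventually (tN.eventually hFM)] with z e1 e2
    have h2 : (N (J z)).2 = z.1 * z.2 := congrArg (fun w => w.2) e1
    have h3 : ((N (J z)).1, z.1 * z.2) = N (J z) := by rw [← h2]
    rw [h3, e2, e1, h2]
    simp [J]
  · have hkN : SmoothGermAt (fun w => k (N w)) 0 := hk.comp_of_eq hN N0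
    have hkN0 : k (N 0) ≠ 0 := by rwa [N0]
    filter_upwards [tJ.eventually hMN.eventually_nhds,
      tJ.eventually (tN.eventually hFM).eventually_nhds, tJ.eventually hN.eventually,
      tJ.eventually hkN.eventually, tJ.eventually (hkN.continuousAt.eventually_ne hkN0),
      tJ.eventually (tN.eventually hF.eventually)] with z e1 e2 e3 e4 e5 e6 hz hd
    have h2 : ∀ᶠ w in 𝓝 (J z), (N w).2 = w.2 := e1.mono fun w hw => congrArg (fun w => w.2) hw
    -- Move U while V and s stay fixed. Along this path F = k (s - tV), with derivative -kV ≠ 0 at t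
    -- = U; hence the gradient of F_s cannot vanish off the axes.
    let ℓ : ℝ → Plane × ℝ := fun t => ((t, z.2), z.1 * z.2)
    have hℓ : HasDerivAt ℓ ((1, 0), 0) z.1 :=
      ((hasDerivAt_id z.1).prodMk (hasDerivAt_const _ _)).prodMk (hasDerivAt_const _ _)
    have hℓz : ℓ z.1 = J z := rfl
    have dN : HasDerivAt (fun t => (N (ℓ t)).1) (fderiv ℝ N (J z) ((1, 0), 0)).1 z.1 :=
      (ContinuousLinearMap.fst ℝ Plane ℝ).hasFDerivAt.comp_hasDerivAt z.1
        (e3.hasFDerivAt.comp_hasDerivAt z.1 hℓ)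
    have hNz : ((N (J z)).1, z.1 * z.2) = N (J z) := by
      have := h2.self_of_nhds
      exact Prod.ext rfl this.symm
    have hFd : DifferentiableAt ℝ (fun p => F (p, z.1 * z.2)) (N (J z)).1 := by
      have h3 : DifferentiableAt ℝ F ((N (J z)).1, z.1 * z.2) := by
        rw [hNz]; exact e6.differentiableAt
      exact h3.comp (N (J z)).1 (differentiableAt_id.prodMk (differentiableAt_const _))
    have d1 : HasDerivAt (fun t => F ((N (ℓ t)).1, z.1 * z.2)) 0 z.1 := by
      have := hFd.hasFDerivAt
      rw [hd] at this
      exact (HasFDerivAt.comp_hasDerivAt (f := fun t => (N (ℓ t)).1) z.1 this dN).congr_deriv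
        (by simp)
    have d2 : HasDerivAt (fun t => k (N (ℓ t)) * (z.1 * z.2 - t * z.2)) (k (N (J z)) * -z.2) z.1 := by
      have d3 := e4.hasFDerivAt.comp_hasDerivAt z.1 hℓ
      have d4 : HasDerivAt (fun t : ℝ => z.1 * z.2 - t * z.2) (-z.2) z.1 := by
        simpa using (hasDerivAt_mul_const z.2 (x := z.1)).const_sub (z.1 * z.2)
      refine (d3.mul d4).congr_deriv ?_
      simp [hℓz]
    have heq : (fun t => F ((N (ℓ t)).1, z.1 * z.2)) =ᶠ[𝓝 z.1]
        fun t => k (N (ℓ t)) * (z.1 * z.2 - t * z.2) := by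
      have ht : Tendsto ℓ (𝓝 z.1) (𝓝 (J z)) := hℓ.continuousAt
      filter_upwards [ht.eventually e1, ht.eventually e2, ht.eventually h2] with t f1 f2 f3
      have h4 : ((N (ℓ t)).1, z.1 * z.2) = N (ℓ t) := Prod.ext rfl f3.symm
      rw [h4, f2, f1, f3]
    have := (d2.congr_of_eventuallyEq heq).unique d1
    rcases mul_eq_zero.1 this with h | h
    · exact e5 h
    · exact hz (by rw [neg_eq_zero.1 h, mul_zero])
  · intro S hS
    have tM : Tendsto (fun w => (M w).1) (𝓝 0) (𝓝 0) := by
      have := hM.fst.continuousAt.tendsto; rwa [M0] at this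
    filter_upwards [hFM, hNM, hk.continuousAt.eventually_ne hk0, tM.eventually_mem hS]
      with w e1 e2 e3 e4 hw
    rw [e1] at hw
    -- A zero of F is hit by its own coordinates (U, V), so no piece of the curve near the origin
    -- escapes the chart.
    have h5 := (mul_eq_zero.1 hw).resolve_left e3
    have h6 : (M w).1.1 * (M w).1.2 = w.2 := by linarith
    refine ⟨(M w).1, e4, h6, ?_⟩
    have h7 : J (M w).1 = M w := Prod.ext rfl h6
    simp only [h7, e2]

/-! ## The Euler field of the hyperbolas `u v = const` -/

/-- The derivative of `h` along the vector field `u ∂/∂u - v ∂/∂v`. -/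
def eul (h : ℝ × ℝ → Plane) (z : ℝ × ℝ) : Plane := fderiv ℝ h z (z.1, -z.2)

/-- The parametrised branch `(q eˣ, q e⁻ˣ)` of a hyperbola. -/
def hyp (q x : ℝ) : ℝ × ℝ := (q * Real.exp x, q * Real.exp (-x))

theorem hyp_neg (q x : ℝ) : hyp q (-x) = (hyp q x).swap := by simp [hyp]

theorem hyp_mul (q x : ℝ) : (hyp q x).1 * (hyp q x).2 = q ^ 2 := by
  have : Real.exp x * Real.exp (-x) = 1 := by rw [← Real.exp_add]; simp
  simp only [hyp]; linear_combination q ^ 2 * this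

theorem hasDerivAt_hyp (q x : ℝ) : HasDerivAt (hyp q) ((hyp q x).1, -(hyp q x).2) x := by
  have h1 := (Real.hasDerivAt_exp x).const_mul q
  have h2 := ((hasDerivAt_neg x).exp).const_mul q
  exact (h1.prodMk h2).congr_deriv (by simp [hyp])

theorem contDiff_hyp : ContDiff ℝ ∞ fun p : ℝ × ℝ => hyp p.1 p.2 := by
  unfold hyp; fun_prop

theorem SmoothGermAt.eul {h : ℝ × ℝ → Plane} {z : ℝ × ℝ} (hh : SmoothGermAt h z) :
    SmoothGermAt (eul h) z :=
  hh.smooth_fderiv_apply (ContDiff.smoothGermAt (by fun_prop) z)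

theorem hasDerivAt_comp_hyp {h : ℝ × ℝ → Plane} {q x : ℝ} (hh : SmoothGermAt h (hyp q x)) :
    HasDerivAt (fun t => h (hyp q t)) (eul h (hyp q x)) x :=
  hh.hasFDerivAt.comp_hasDerivAt x (hasDerivAt_hyp q x)

theorem eul_zero (h : ℝ × ℝ → Plane) : eul h 0 = 0 := by
  have : ((0 : ℝ), -(0 : ℝ)) = 0 := by simp
  simp only [eul, Prod.fst_zero, Prod.snd_zero, this, map_zero]

theorem eul_congr {h k : ℝ × ℝ → Plane} {z : ℝ × ℝ} (e : h =ᶠ[𝓝 z] k) :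
    eul h =ᶠ[𝓝 z] eul k := by
  filter_upwards [e.fderiv (𝕜 := ℝ)] with y hy
  simp [eul, hy]

/-- Exchanging the coordinates reverses the Euler field, so odd iterates change sign and even ones
do not. -/
theorem eul_comp_swap {h : ℝ × ℝ → Plane} {z : ℝ × ℝ} (hh : SmoothGermAt h z.swap) :
    eul (fun y => h y.swap) z = -eul h z.swap := by
  have := hh.hasFDerivAt.comp z (ContinuousLinearEquiv.prodComm ℝ ℝ ℝ).hasFDerivAt
  have e : fderiv ℝ (fun y : ℝ × ℝ => h y.swap) z = _ := this.fderiv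
  simp only [eul, e]
  rw [← map_neg]
  simp

/-- `P` and `Q` represent the germ `h` as `u P(u) + v Q(u, v)`. -/
structure Splits (h : ℝ × ℝ → Plane) (P : ℝ → Plane) (Q : ℝ × ℝ → Plane) : Prop where
  left : SmoothGermAt P 0
  right : SmoothGermAt Q 0
  eq : ∀ᶠ z in 𝓝 (0 : ℝ × ℝ), h z = z.1 • P z.1 + z.2 • Q z

/-- E(u P(u)) = u (P + u P') and E(v Q) = v (EQ - Q). Since EQ vanishes at 0, iterating keeps P(0)
and alternates the sign of Q(0). -/
theorem Splits.eul {h : ℝ × ℝ → Plane} {P : ℝ → Plane} {Q : ℝ × ℝ → Plane} (s : Splits h P Q) :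
    Splits (eul h) (fun t => P t + t • deriv P t) (fun z => PlaneCurve.eul Q z - Q z) := by
  refine ⟨s.left.add ((contDiff_id.smoothGermAt 0).smul s.left.smooth_deriv),
    s.right.eul.sub s.right, ?_⟩
  have t1 : Tendsto (fun z : ℝ × ℝ => z.1) (𝓝 0) (𝓝 0) := continuous_fst.tendsto' 0 0 rfl
  filter_upwards [eul_congr s.eq, t1.eventually s.left.eventually, s.right.eventually]
    with z e1 e2 e3
  rw [e1]
  have d1 : HasFDerivAt (fun z : ℝ × ℝ => P z.1)
      ((fderiv ℝ P z.1).comp (ContinuousLinearMap.fst ℝ ℝ ℝ)) z :=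
    HasFDerivAt.comp (g := P) z e2.hasFDerivAt hasFDerivAt_fst
  have := (hasFDerivAt_fst (𝕜 := ℝ) (p := z)).smul d1 |>.add
    ((hasFDerivAt_snd (𝕜 := ℝ) (p := z)).smul e3.hasFDerivAt)
  have e : fderiv ℝ (fun z : ℝ × ℝ => z.1 • P z.1 + z.2 • Q z) z = _ := this.fderiv
  have e4 : fderiv ℝ P z.1 z.1 = z.1 • deriv P z.1 := by
    rw [← fderiv_apply_one_eq_deriv, ← map_smul, smul_eq_mul, mul_one]
  simp only [PlaneCurve.eul, e]
  simp only [_root_.add_apply, _root_.smul_apply,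
    ContinuousLinearMap.comp_apply, ContinuousLinearMap.smulRight_apply,
    ContinuousLinearMap.coe_fst', ContinuousLinearMap.coe_snd', e4]
  module

/-- P is the Hadamard quotient of h on the u-axis. As h(t, 0) = t P(t), the expression P + t P' is
the velocity of that branch, which links iterates of E to the jets of the branch. -/
theorem exists_splits {h : ℝ × ℝ → Plane} (hh : SmoothGermAt h 0) (h0 : h 0 = 0) :
    ∃ P Q, Splits h P Q ∧ P 0 = fderiv ℝ h 0 (1, 0) ∧ Q 0 = fderiv ℝ h 0 (0, 1) ∧
      ∀ᶠ t in 𝓝 (0 : ℝ), P t + t • deriv P t = deriv (fun t => h (t, 0)) t := by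
  have sr : SmoothGermAt (fun t : ℝ => (t, (0 : ℝ))) 0 :=
    (contDiff_id.smoothGermAt 0).prodMk (smoothGermAt_const 0 0)
  have hx : SmoothGermAt (fun t : ℝ => h (t, 0)) 0 := hh.comp_of_eq sr rfl
  have sx : SmoothGermAt (fun p : ℝ × ℝ => h (p.1, 0)) 0 := hx.comp_of_eq (smoothGermAt_fst 0) rfl
  have t1 : Tendsto (fun p : ℝ × ℝ => p.1) (𝓝 0) (𝓝 0) := continuous_fst.tendsto' 0 0 rfl
  obtain ⟨Q, hQ, eQ, vQ⟩ := (hh.sub sx).exists_eq_smul (by simp)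
  obtain ⟨P, hP, eP, vP⟩ := hx.exists_eq_smul_self h0
  refine ⟨P, Q, ⟨hP, hQ, ?_⟩, ?_, ?_, ?_⟩
  · filter_upwards [eQ, t1.eventually eP] with z e1 e2
    rw [← e1, ← e2]; abel
  · rw [vP]
    have h2 : HasDerivAt (fun t : ℝ => (t, (0 : ℝ))) (1, 0) 0 :=
      (hasDerivAt_id 0).prodMk (hasDerivAt_const 0 0)
    exact (HasFDerivAt.comp_hasDerivAt (f := fun t : ℝ => (t, (0 : ℝ))) (0 : ℝ)
      (by exact hh.hasFDerivAt) h2).deriv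
  · rw [vQ]
    have h2 : HasFDerivAt (fun p : ℝ × ℝ => h (p.1, 0)) ((fderiv ℝ h 0).comp
        ((ContinuousLinearMap.fst ℝ ℝ ℝ).prod 0)) 0 :=
      HasFDerivAt.comp (g := h) (f := fun p : ℝ × ℝ => (p.1, (0 : ℝ))) (0 : ℝ × ℝ) hh.hasFDerivAt
        (hasFDerivAt_fst.prodMk (hasFDerivAt_const 0 0))
    rw [HasFDerivAt.fderiv (f := fun y : ℝ × ℝ => h y - h (y.1, 0)) (hh.hasFDerivAt.sub h2)]
    have hz : fderiv ℝ h 0 ((0 : ℝ), (0 : ℝ)) = 0 := map_zero _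
    simp [hz]
  · filter_upwards [eP.eventually_nhds, hP.eventually] with t e1 e2
    have := ((hasDerivAt_id t).smul e2.differentiableAt.hasDerivAt).congr_of_eventuallyEq e1
    rw [this.deriv]
    simp [add_comm]

/-! ## Inflections and vertices in the hyperbolic chart -/

/-- The inflections of the curves `u v = const` in the chart `Ψ` are the zeros of this function. -/
def inflNumAt (Ψ : ℝ × ℝ → Plane) (z : ℝ × ℝ) : ℝ := cross (eul Ψ z) (eul (eul Ψ) z)

/-- The vertices of the curves `u v = const` in the chart `Ψ` are the zeros of this function. -/
def vertNumAt (Ψ : ℝ × ℝ → Plane) (z : ℝ × ℝ) : ℝ :=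
  vertNum (eul Ψ z) (eul (eul Ψ) z) (eul (eul (eul Ψ)) z)

theorem cross_swap (v w : Plane) : cross w v = -cross v w := by simp only [cross]; ring

theorem dotp_self_pos {v : Plane} (hv : v ≠ 0) : 0 < dotp v v := by
  have : v.1 ≠ 0 ∨ v.2 ≠ 0 := by
    by_contra! h; exact hv (Prod.ext h.1 h.2)
  simp only [dotp]
  rcases this with h | h
  · nlinarith [mul_self_pos.2 h, mul_self_nonneg v.2]
  · nlinarith [mul_self_pos.2 h, mul_self_nonneg v.1]

theorem SmoothGermAt.cross {E : Type*} [NormedAddCommGroup E] [NormedSpace ℝ E] {f g : E → Plane}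
    {x : E} (hf : SmoothGermAt f x) (hg : SmoothGermAt g x) :
    SmoothGermAt (fun y => cross (f y) (g y)) x :=
  (hf.fst.mul hg.snd).sub (hf.snd.mul hg.fst)

theorem SmoothGermAt.dotp {E : Type*} [NormedAddCommGroup E] [NormedSpace ℝ E] {f g : E → Plane}
    {x : E} (hf : SmoothGermAt f x) (hg : SmoothGermAt g x) :
    SmoothGermAt (fun y => dotp (f y) (g y)) x :=
  (hf.fst.mul hg.fst).add (hf.snd.mul hg.snd)

theorem SmoothGermAt.vertNum {E : Type*} [NormedAddCommGroup E] [NormedSpace ℝ E]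
    {f g h : E → Plane} {x : E} (hf : SmoothGermAt f x) (hg : SmoothGermAt g x)
    (hh : SmoothGermAt h x) : SmoothGermAt (fun y => vertNum (f y) (g y) (h y)) x :=
  ((hf.dotp hf).mul (hf.cross hh)).sub
    ((smoothGermAt_const 3 x).mul ((hf.cross hg).mul (hf.dotp hg)))

/-- With v = u r every vector is divisible by u. The terms without r come from reparametrising the
branch by log u, which multiplies `cross` by u³ and, in the next lemma, `vertNum` by u⁶; the
remaining terms carry a factor r but fewer powers of u. -/
theorem cross_blowUp (p p' Q₁ Q₂ : Plane) (u r : ℝ) :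
    cross (u • p + (u * r) • Q₁) (u • (p + u • p') + (u * r) • Q₂) =
      u ^ 2 * (u * cross p p' +
        r * (cross p Q₂ + cross Q₁ (p + u • p') + r * cross Q₁ Q₂)) := by
  simp only [cross, Prod.fst_add, Prod.snd_add, Prod.smul_fst, Prod.smul_snd, smul_eq_mul]
  ring

theorem vertNum_blowUp (p p' p'' Q₁ Q₂ Q₃ : Plane) (u r : ℝ) :
    vertNum (u • p + (u * r) • Q₁) (u • (p + u • p') + (u * r) • Q₂)
      (u • (p + u • p' + u • (p' + (p' + u • p''))) + (u * r) • Q₃) =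
      u ^ 4 * (u ^ 2 * vertNum p p' p'' + r * (
        (2 * dotp p Q₁ + r * dotp Q₁ Q₁) *
          cross (p + r • Q₁) (p + u • p' + u • (p' + (p' + u • p'')) + r • Q₃)
        + dotp p p * (cross p Q₃ + cross Q₁ (p + u • p' + u • (p' + (p' + u • p'')))
          + r * cross Q₁ Q₃)
        - 3 * ((cross p Q₂ + cross Q₁ (p + u • p') + r * cross Q₁ Q₂) *
            dotp (p + r • Q₁) (p + u • p' + r • Q₂)
          + u * cross p p' * (dotp p Q₂ + dotp Q₁ (p + u • p') + r * dotp Q₁ Q₂)))) := by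
  simp only [vertNum, cross, dotp, Prod.fst_add, Prod.snd_add, Prod.smul_fst, Prod.smul_snd,
    smul_eq_mul]
  ring

/-- In coordinates (u, r) with v = u r, the two functions become monomials times u A_I + r B_I and
u² A_V + r B_V. A_I and A_V are the invariants of the branch, while B_I(0) and B_V(0) come from the
linear part of the chart and are nonzero when it is invertible. -/
theorem blowUp {Ψ : ℝ × ℝ → Plane} (hΨ : SmoothGermAt Ψ 0) (h0 : Ψ 0 = 0) :
    ∃ (AI AV : ℝ → ℝ) (BI BV : ℝ × ℝ → ℝ),
      SmoothGermAt AI 0 ∧ SmoothGermAt AV 0 ∧ SmoothGermAt BI 0 ∧ SmoothGermAt BV 0 ∧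
      AI 0 = cross (deriv (fun t => Ψ (t, 0)) 0) (deriv (deriv (fun t => Ψ (t, 0))) 0) ∧
      AV 0 = vertNum (deriv (fun t => Ψ (t, 0)) 0) (deriv (deriv (fun t => Ψ (t, 0))) 0)
        (deriv (deriv (deriv (fun t => Ψ (t, 0)))) 0) ∧
      BI 0 = 2 * cross (fderiv ℝ Ψ 0 (1, 0)) (fderiv ℝ Ψ 0 (0, 1)) ∧
      BV 0 = -6 * cross (fderiv ℝ Ψ 0 (1, 0)) (fderiv ℝ Ψ 0 (0, 1)) *
        dotp (fderiv ℝ Ψ 0 (1, 0)) (fderiv ℝ Ψ 0 (1, 0)) ∧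
      ∀ᶠ z in 𝓝 (0 : ℝ × ℝ),
        inflNumAt Ψ (z.1, z.1 * z.2) = z.1 ^ 2 * (z.1 * AI z.1 + z.2 * BI z) ∧
        vertNumAt Ψ (z.1, z.1 * z.2) = z.1 ^ 4 * (z.1 ^ 2 * AV z.1 + z.2 * BV z) := by
  obtain ⟨P₀, Q₀, S₀, vP, vQ, ed⟩ := exists_splits hΨ h0
  obtain ⟨P₁, hP₁⟩ : ∃ P₁, P₁ = fun t => P₀ t + t • deriv P₀ t := ⟨_, rfl⟩
  obtain ⟨Q₁, hQ₁⟩ : ∃ Q₁, Q₁ = fun z => eul Q₀ z - Q₀ z := ⟨_, rfl⟩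
  obtain ⟨Q₂, hQ₂⟩ : ∃ Q₂, Q₂ = fun z => eul Q₁ z - Q₁ z := ⟨_, rfl⟩
  obtain ⟨Q₃, hQ₃⟩ : ∃ Q₃, Q₃ = fun z => eul Q₂ z - Q₂ z := ⟨_, rfl⟩
  have S₁ : Splits (eul Ψ) P₁ Q₁ := by rw [hP₁, hQ₁]; exact S₀.eul
  have S₂ : Splits (eul (eul Ψ)) (fun t => P₁ t + t • deriv P₁ t) Q₂ := by rw [hQ₂]; exact S₁.eul
  have S₃ : Splits (eul (eul (eul Ψ))) (fun t => P₁ t + t • deriv P₁ t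
      + t • deriv (fun t => P₁ t + t • deriv P₁ t) t) Q₃ := by rw [hQ₃]; exact S₂.eul
  have hP : SmoothGermAt P₁ 0 := S₁.left
  have hP' := hP.smooth_deriv
  have hP'' := hP'.smooth_deriv
  have eP : P₁ =ᶠ[𝓝 0] deriv (fun t => Ψ (t, 0)) := by rw [hP₁]; exact ed
  have eP' := eP.deriv
  have ed₂ : ∀ᶠ t in 𝓝 (0 : ℝ), deriv (fun t => P₁ t + t • deriv P₁ t) t =
      deriv P₁ t + (deriv P₁ t + t • deriv (deriv P₁) t) := by
    filter_upwards [hP.eventually, hP'.eventually] with t e1 e2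
    have := e1.differentiableAt.hasDerivAt.add
      ((hasDerivAt_id t).smul e2.differentiableAt.hasDerivAt)
    refine (HasDerivAt.deriv (f := fun t => P₁ t + t • deriv P₁ t) this).trans ?_
    simp [add_comm]
  -- The Euler field vanishes at 0, so each application of Qᵢ₊₁ = E Qᵢ - Qᵢ only flips the sign
  -- there.
  have v1 : Q₁ 0 = -Q₀ 0 := by simp [hQ₁, eul_zero]
  have v2 : Q₂ 0 = Q₀ 0 := by simp [hQ₂, eul_zero, v1]
  have v3 : Q₃ 0 = -Q₀ 0 := by simp [hQ₃, eul_zero, v2]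
  have v1' : Q₁ (0, 0) = -Q₀ 0 := v1
  have v2' : Q₂ (0, 0) = Q₀ 0 := v2
  have v3' : Q₃ (0, 0) = -Q₀ 0 := v3
  have vP₁ : P₁ 0 = fderiv ℝ Ψ 0 (1, 0) := by simp [hP₁, vP]
  have tb : SmoothGermAt (fun z : ℝ × ℝ => (z.1, z.1 * z.2)) 0 :=
    ContDiff.smoothGermAt (by fun_prop) 0
  have tb0 : ((0 : ℝ × ℝ).1, (0 : ℝ × ℝ).1 * (0 : ℝ × ℝ).2) = 0 := by simp
  have tB : Tendsto (fun z : ℝ × ℝ => (z.1, z.1 * z.2)) (𝓝 0) (𝓝 0) := by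
    have := tb.continuousAt.tendsto; rwa [tb0] at this
  have t1 : Tendsto (fun z : ℝ × ℝ => z.1) (𝓝 0) (𝓝 0) := continuous_fst.tendsto' 0 0 rfl
  have su := smoothGermAt_fst (0 : ℝ × ℝ)
  have sr := smoothGermAt_snd (0 : ℝ × ℝ)
  have sp : SmoothGermAt (fun z : ℝ × ℝ => P₁ z.1) 0 := hP.comp_of_eq su rfl
  have sp' : SmoothGermAt (fun z : ℝ × ℝ => deriv P₁ z.1) 0 := hP'.comp_of_eq su rfl
  have sp'' : SmoothGermAt (fun z : ℝ × ℝ => deriv (deriv P₁) z.1) 0 := hP''.comp_of_eq su rfl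
  have sQ₁ : SmoothGermAt (fun z : ℝ × ℝ => Q₁ (z.1, z.1 * z.2)) 0 := S₁.right.comp_of_eq tb tb0
  have sQ₂ : SmoothGermAt (fun z : ℝ × ℝ => Q₂ (z.1, z.1 * z.2)) 0 := S₂.right.comp_of_eq tb tb0
  have sQ₃ : SmoothGermAt (fun z : ℝ × ℝ => Q₃ (z.1, z.1 * z.2)) 0 := S₃.right.comp_of_eq tb tb0
  have sp₂ := sp.add (su.smul sp')
  have sp₃ := sp₂.add (su.smul (sp'.add (sp'.add (su.smul sp''))))
  have sq := ((sp.cross sQ₂).add (sQ₁.cross sp₂)).add (sr.mul (sQ₁.cross sQ₂))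
  refine ⟨fun t => cross (P₁ t) (deriv P₁ t),
    fun t => vertNum (P₁ t) (deriv P₁ t) (deriv (deriv P₁) t), _, _,
    hP.cross hP', hP.vertNum hP' hP'', sq,
    ((((smoothGermAt_const 2 0).mul (sp.dotp sQ₁)).add (sr.mul (sQ₁.dotp sQ₁))).mul
      ((sp.add (sr.smul sQ₁)).cross (sp₃.add (sr.smul sQ₃)))).add
    ((sp.dotp sp).mul (((sp.cross sQ₃).add (sQ₁.cross sp₃)).add (sr.mul (sQ₁.cross sQ₃)))) |>.sub
    ((smoothGermAt_const 3 0).mul ((sq.mul ((sp.add (sr.smul sQ₁)).dotp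
      (sp₂.add (sr.smul sQ₂)))).add ((su.mul (sp.cross sp')).mul
      (((sp.dotp sQ₂).add (sQ₁.dotp sp₂)).add (sr.mul (sQ₁.dotp sQ₂)))))),
    ?_, ?_, ?_, ?_, ?_⟩
  · simp only [eP.eq_of_nhds, eP'.eq_of_nhds]
  · simp only [eP.eq_of_nhds, eP'.eq_of_nhds, eP'.deriv.eq_of_nhds]
  · simp only [Prod.fst_zero, Prod.snd_zero, zero_smul, add_zero, zero_mul, v1', v2', vQ, vP₁]
    simp only [cross, Prod.fst_neg, Prod.snd_neg]; ring
  · simp only [Prod.fst_zero, Prod.snd_zero, zero_smul, add_zero, zero_mul, v1', v2', v3', vQ, vP₁]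
    simp only [cross, dotp, Prod.fst_neg, Prod.snd_neg]; ring
  · filter_upwards [tB.eventually S₁.eq, tB.eventually S₂.eq, tB.eventually S₃.eq,
      t1.eventually ed₂] with z e1 e2 e3 e4
    rw [inflNumAt, vertNumAt, e1, e2, e3]
    rw [e4]
    exact ⟨cross_blowUp _ _ _ _ _ _, vertNum_blowUp _ _ _ _ _ _ _ _⟩

/-! ## The zones near the branches -/

/-- Put u = q eˣ and r = e^(-2x), so u² r = q². If g(0) > 0, both terms of the equation are
nonnegative and the second is positive. If g(0) < 0, then u^(k+2) g decreases strictly in x and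
crosses -q² once: near x = L it has order q^(k+2), small against q², and at u = ρ'/2 it is bounded
away from 0. The final two-sided bound |g(0)| u^(k+2) ≍ q² is what later orders roots with different
k. -/
theorem outer_zone {g : ℝ × ℝ → ℝ} (hg : SmoothGermAt g 0) (g0 : g 0 ≠ 0) {k : ℕ} (hk : 1 ≤ k) :
    ∃ ρ₀ > 0, ∃ L₀ : ℝ, ∀ ρ : ℝ, 0 < ρ → ρ ≤ ρ₀ → ∀ L ≥ L₀,
      (0 < g 0 → ∀ q > 0, ∀ x > L, q * Real.exp x < ρ →
        (q * Real.exp x) ^ (k + 2) * g (q * Real.exp x, Real.exp (-2 * x)) + q ^ 2 ≠ 0) ∧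
      (g 0 < 0 → ∀ ρ' > 0, ρ' ≤ ρ → ∀ᶠ q in 𝓝[>] (0 : ℝ), ∃ x₀ > L, q * Real.exp x₀ < ρ' ∧
        (∀ x > L, q * Real.exp x < ρ →
          ((q * Real.exp x) ^ (k + 2) * g (q * Real.exp x, Real.exp (-2 * x)) + q ^ 2 = 0 ↔
            x = x₀)) ∧
        q ^ 2 ≤ 2 * |g 0| * (q * Real.exp x₀) ^ (k + 2) ∧
        |g 0| * (q * Real.exp x₀) ^ (k + 2) ≤ 2 * q ^ 2) := by
  have ha : 0 < |g 0| := abs_pos.2 g0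
  have hY : ContinuousAt (fun z : ℝ × ℝ => fderiv ℝ g z (z.1, -2 * z.2)) 0 :=
    (hg.smooth_fderiv_apply (ContDiff.smoothGermAt (by fun_prop) 0)).continuousAt
  have hY0 : fderiv ℝ g 0 ((0 : ℝ × ℝ).1, -2 * (0 : ℝ × ℝ).2) = 0 := by
    have : ((0 : ℝ × ℝ).1, -2 * (0 : ℝ × ℝ).2) = 0 := by simp
    rw [this, map_zero]
  have E : ∀ᶠ z in 𝓝 (0 : ℝ × ℝ), SmoothGermAt g z ∧ |g z - g 0| < |g 0| / 2 ∧
      |fderiv ℝ g z (z.1, -2 * z.2)| < |g 0| := by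
    refine hg.eventually.and (Eventually.and ?_ ?_)
    · have : ContinuousAt (fun z => |g z - g 0|) 0 :=
        (hg.continuousAt.sub continuousAt_const).abs
      exact this.eventually (gt_mem_nhds (by simpa using half_pos ha))
    · exact hY.abs.eventually (gt_mem_nhds (by simpa only [hY0, abs_zero] using ha))
  obtain ⟨η, hη, hb⟩ := Metric.eventually_nhds_iff_ball.1 E
  -- x > -(log η)/2 means e^(-2x) < η, so (u, r) stays in the ball on which g is controlled.
  refine ⟨η, hη, -Real.log η / 2, fun ρ hρ hρη L hL => ?_⟩
  have box : ∀ q > 0, ∀ x > L, q * Real.exp x < ρ →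
      (q * Real.exp x, Real.exp (-2 * x)) ∈ Metric.ball (0 : ℝ × ℝ) η := by
    intro q hq x hx hqx
    rw [mem_ball_zero_iff, Prod.norm_def]
    refine max_lt ?_ ?_
    · rw [Real.norm_of_nonneg (by positivity)]; linarith
    · rw [Real.norm_of_nonneg (by positivity), ← Real.lt_log_iff_exp_lt hη]; linarith
  have bd : ∀ q > 0, ∀ x > L, q * Real.exp x < ρ →
      |g (q * Real.exp x, Real.exp (-2 * x)) - g 0| < |g 0| / 2 :=
    fun q hq x hx hqx => (hb _ (box q hq x hx hqx)).2.1
  constructor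
  · intro hpos q hq x hx hqx
    have h1 := abs_lt.1 (bd q hq x hx hqx)
    rw [abs_of_pos hpos] at h1
    have h2 : 0 < g (q * Real.exp x, Real.exp (-2 * x)) := by linarith
    positivity
  · intro hneg ρ' hρ' hρρ
    rw [abs_of_neg hneg] at bd ha
    let T : ℝ → ℝ → ℝ := fun q x =>
      (q * Real.exp x) ^ (k + 2) * g (q * Real.exp x, Real.exp (-2 * x))
    have hT : ∀ q > 0, ∀ x > L, q * Real.exp x < ρ →
        ∃ T', HasDerivAt (T q) T' x ∧ T' < 0 := by
      intro q hq x hx hqx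
      obtain ⟨hs, -, hy⟩ := hb _ (box q hq x hx hqx)
      have h1 := abs_lt.1 (bd q hq x hx hqx)
      have d1 : HasDerivAt (fun x => q * Real.exp x) (q * Real.exp x) x :=
        (Real.hasDerivAt_exp x).const_mul q
      have d2 : HasDerivAt (fun x => Real.exp (-2 * x)) (-2 * Real.exp (-2 * x)) x := by
        have := ((hasDerivAt_id x).const_mul (-2)).exp
        simpa [mul_comm] using this
      have d3 := hs.hasFDerivAt.comp_hasDerivAt x (d1.prodMk d2)
      refine ⟨_, (d1.pow (k + 2)).mul d3, ?_⟩
      set u := q * Real.exp x with hu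
      have hu0 : 0 < u := by positivity
      rw [abs_of_neg hneg] at hy
      have hy := abs_lt.1 hy
      simp only [Pi.pow_apply, ← hu] at hy ⊢
      have e : ((k + 2 : ℕ) : ℝ) * u ^ (k + 2 - 1) * u = ((k : ℝ) + 2) * u ^ (k + 2) := by
        rw [show k + 2 - 1 = k + 1 by omega]; push_cast; ring
      rw [e]
      have hk' : (1 : ℝ) ≤ k := by exact_mod_cast hk
      -- Here (k + 2) g < -(3/2)|g(0)|, while the derivative of g along u∂_u - 2r∂_r is below |g(0)|
      -- in absolute value, because that field vanishes at the origin.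
      have : ((k : ℝ) + 2) * g (u, Real.exp (-2 * x)) +
          fderiv ℝ g (u, Real.exp (-2 * x)) (u, -2 * Real.exp (-2 * x)) < 0 := by
        nlinarith
      have hup : 0 < u ^ (k + 2) := by positivity
      nlinarith
    have c1 : ∀ᶠ q in 𝓝 (0 : ℝ), q * Real.exp (L + 1) < ρ' / 2 :=
      (by fun_prop : Continuous fun q : ℝ => q * Real.exp (L + 1)).continuousAt.eventually
        (gt_mem_nhds (by simpa using hρ'))
    have c2 : ∀ᶠ q in 𝓝 (0 : ℝ), q ^ k * (Real.exp (L + 1) ^ (k + 2) * (3 / 2 * -g 0)) < 1 :=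
      (by fun_prop : Continuous fun q : ℝ => q ^ k * (Real.exp (L + 1) ^ (k + 2) *
        (3 / 2 * -g 0))).continuousAt.eventually (gt_mem_nhds (by
          simp only [zero_pow (show k ≠ 0 by omega), zero_mul, zero_lt_one]))
    have c3 : ∀ᶠ q in 𝓝 (0 : ℝ), q ^ 2 < (ρ' / 2) ^ (k + 2) * (-g 0 / 2) :=
      (by fun_prop : Continuous fun q : ℝ => q ^ 2).continuousAt.eventually
        (gt_mem_nhds (by simp only [ne_eq, OfNat.ofNat_ne_zero, not_false_eq_true, zero_pow]
                         positivity))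
    filter_upwards [self_mem_nhdsWithin, nhdsWithin_le_nhds c1, nhdsWithin_le_nhds c2,
      nhdsWithin_le_nhds c3] with q hq e1 e2 e3
    have hq : 0 < q := hq
    obtain ⟨x₂, hx₂⟩ : ∃ x₂, q * Real.exp x₂ = ρ' / 2 :=
      ⟨Real.log (ρ' / 2 / q), by rw [Real.exp_log (by positivity)]; field_simp⟩
    have mono : ∀ {x y}, x < y → q * Real.exp x < q * Real.exp y := fun h =>
      mul_lt_mul_of_pos_left (Real.exp_lt_exp.2 h) hq
    have hx12 : L + 1 < x₂ := by
      rw [← hx₂] at e1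
      exact Real.exp_lt_exp.1 (lt_of_mul_lt_mul_left e1 hq.le)
    have inD : ∀ x, x ≤ x₂ → q * Real.exp x < ρ := fun x hx => by
      have : q * Real.exp x ≤ q * Real.exp x₂ := by gcongr
      linarith
    have hanti : StrictAntiOn (T q) {x | L < x ∧ q * Real.exp x < ρ} := by
      have hconv : Convex ℝ {x | L < x ∧ q * Real.exp x < ρ} := by
        refine OrdConnected.convex ⟨fun x hx y hy z hz => ⟨hx.1.trans_le hz.1, ?_⟩⟩
        exact lt_of_le_of_lt (by gcongr; exact hz.2) hy.2
      refine strictAntiOn_of_deriv_neg hconv (fun x hx => ?_) (fun x hx => ?_)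
      · obtain ⟨T', h1, -⟩ := hT q hq x hx.1 hx.2
        exact h1.continuousAt.continuousWithinAt
      · have hx := interior_subset hx
        obtain ⟨T', h1, h2⟩ := hT q hq x hx.1 hx.2
        rwa [h1.deriv]
    have hcont : ContinuousOn (T q) (Icc (L + 1) x₂) := fun x hx => by
      obtain ⟨T', h1, -⟩ := hT q hq x (by linarith [hx.1]) (inD x hx.2)
      exact h1.continuousAt.continuousWithinAt
    have hl : -q ^ 2 < T q (L + 1) := by
      have h1 := abs_lt.1 (bd q hq (L + 1) (by linarith) (inD _ hx12.le))
      have h2 : 0 < (q * Real.exp (L + 1)) ^ (k + 2) := by positivity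
      have h3 : (q * Real.exp (L + 1)) ^ (k + 2) * (3 / 2 * -g 0) =
          q ^ 2 * (q ^ k * (Real.exp (L + 1) ^ (k + 2) * (3 / 2 * -g 0))) := by
        rw [mul_pow, pow_add]; ring
      have h4 : 0 < q ^ 2 := by positivity
      simp only [T]
      nlinarith
    have hr : T q x₂ < -q ^ 2 := by
      have h1 := abs_lt.1 (bd q hq x₂ (by linarith) (inD _ le_rfl))
      have h2 : 0 < (ρ' / 2) ^ (k + 2) := by positivity
      simp only [T, hx₂] at h1 ⊢
      nlinarith
    obtain ⟨x₀, hx₀, hTx⟩ := intermediate_value_Ioo' hx12.le hcont ⟨hr, hl⟩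
    have hx₀L : L < x₀ := by linarith [hx₀.1]
    have h1 := abs_lt.1 (bd q hq x₀ hx₀L (inD _ hx₀.2.le))
    have hup : 0 < (q * Real.exp x₀) ^ (k + 2) := by positivity
    have hTx' : (q * Real.exp x₀) ^ (k + 2) * g (q * Real.exp x₀, Real.exp (-2 * x₀)) = -q ^ 2 :=
      hTx
    refine ⟨x₀, hx₀L, ?_, fun x hx hqx => ⟨fun h => ?_, ?_⟩, ?_, ?_⟩
    · have := mono hx₀.2; linarith
    · refine hanti.injOn ⟨hx, hqx⟩ ⟨hx₀L, inD _ hx₀.2.le⟩ ?_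
      rw [hTx]; simp only [T]; linarith
    · rintro rfl; rw [hTx']; ring
    · rw [abs_of_neg hneg]; nlinarith
    · rw [abs_of_neg hneg]; nlinarith

/-! ### Marks on one half of an arc -/

/-- The word read along half of an arc, from the middle to the end. -/
def halfWord (s t : ℝ) : List Mark :=
  (if s < 0 then [Mark.i] else []) ++ (if 0 < t then [Mark.v] else [])

/-- Apply `outer_zone` with k = 1 to A_I/B_I and with k = 2 to A_V/B_V. At the origin these
quotients have the signs of a d and of -c d, whence an inflection iff a d < 0 and a vertex iff c d >
0. -/
theorem half_arc {Ψ : ℝ × ℝ → Plane} (hΨ : SmoothGermAt Ψ 0) (h0 : Ψ 0 = 0) {a c d : ℝ}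
    (hd : cross (fderiv ℝ Ψ 0 (1, 0)) (fderiv ℝ Ψ 0 (0, 1)) = d) (hd0 : d ≠ 0)
    (ha : cross (deriv (fun t => Ψ (t, 0)) 0) (deriv (deriv (fun t => Ψ (t, 0))) 0) = a)
    (ha0 : a ≠ 0)
    (hc : vertNum (deriv (fun t => Ψ (t, 0)) 0) (deriv (deriv (fun t => Ψ (t, 0))) 0)
        (deriv (deriv (deriv (fun t => Ψ (t, 0)))) 0) = c) (hc0 : c ≠ 0) :
    ∃ ρ₀ > 0, ∃ L₀ : ℝ, ∀ ρ : ℝ, 0 < ρ → ρ ≤ ρ₀ → ∀ L ≥ L₀, ∀ ρ' > 0, ρ' ≤ ρ →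
      ∀ᶠ q in 𝓝[>] (0 : ℝ), ∃ l : List (ℝ × Mark), l.map Prod.snd = halfWord (a * d) (c * d) ∧
        l.Pairwise (fun e e' => e.1 < e'.1) ∧ (∀ e ∈ l, L < e.1 ∧ q * Real.exp e.1 < ρ') ∧
        ∀ x > L, q * Real.exp x < ρ → (inflNumAt Ψ (hyp q x) = 0 ↔ (x, Mark.i) ∈ l) ∧
          (vertNumAt Ψ (hyp q x) = 0 ↔ (x, Mark.v) ∈ l) := by
  obtain ⟨AI, AV, BI, BV, sAI, sAV, sBI, sBV, vAI, vAV, vBI, vBV, ev⟩ := blowUp hΨ h0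
  rw [ha] at vAI
  rw [hc] at vAV
  rw [hd] at vBI vBV
  have hp : fderiv ℝ Ψ 0 (1, 0) ≠ 0 := by
    intro h; rw [h] at hd; apply hd0; rw [← hd]; simp [cross]
  have hA := dotp_self_pos hp
  set A := dotp (fderiv ℝ Ψ 0 (1, 0)) (fderiv ℝ Ψ 0 (1, 0))
  have hBI0 : BI 0 ≠ 0 := by rw [vBI]; positivity
  have hBV0 : BV 0 ≠ 0 := by
    rw [vBV]; exact mul_ne_zero (mul_ne_zero (by norm_num) hd0) hA.ne'
  have sAI' : SmoothGermAt (fun z : ℝ × ℝ => AI z.1) 0 := sAI.comp_of_eq (smoothGermAt_fst 0) rfl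
  have sAV' : SmoothGermAt (fun z : ℝ × ℝ => AV z.1) 0 := sAV.comp_of_eq (smoothGermAt_fst 0) rfl
  have sgI := sAI'.div sBI hBI0
  have sgV := sAV'.div sBV hBV0
  set gI : ℝ × ℝ → ℝ := fun z => AI z.1 / BI z with hgI
  set gV : ℝ × ℝ → ℝ := fun z => AV z.1 / BV z with hgV
  have gI0 : gI 0 = (a * d) * (2 * d ^ 2)⁻¹ := by
    simp only [hgI, Prod.fst_zero, vAI, vBI]; field_simp
  have gV0 : gV 0 = -((c * d) * (6 * A * d ^ 2)⁻¹) := by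
    simp only [hgV, Prod.fst_zero, vAV, vBV]; field_simp
  have gI0' : gI 0 ≠ 0 := by rw [gI0]; positivity
  have gV0' : gV 0 ≠ 0 := by rw [gV0]; exact neg_ne_zero.2 (by positivity)
  obtain ⟨ρ₁, hρ₁, L₁, z₁⟩ := outer_zone sgI gI0' (k := 1) le_rfl
  obtain ⟨ρ₂, hρ₂, L₂, z₂⟩ := outer_zone sgV gV0' (k := 2) (by norm_num)
  obtain ⟨η, hη, hb⟩ := Metric.eventually_nhds_iff_ball.1
    (ev.and ((sBI.continuousAt.eventually_ne hBI0).and (sBV.continuousAt.eventually_ne hBV0)))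
  have aI : 0 < |gI 0| := abs_pos.2 gI0'
  have aV : 0 < |gV 0| := abs_pos.2 gV0'
  -- The last bound orders the marks. If the vertex root u₂ were at most the inflection root u₁,
  -- then |g_I(0)| u₁³ ≤ 2q² ≤ 4|g_V(0)| u₂⁴ ≤ 4|g_V(0)| u₁⁴, forcing u₁ ≥ |g_I(0)|/(4|g_V(0)|).
  refine ⟨min (min ρ₁ ρ₂) (min η (|gI 0| / (4 * |gV 0|))), by positivity,
    max (max L₁ L₂) (-Real.log η / 2), fun ρ hρ hρ0 L hL ρ' hρ' hρρ => ?_⟩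
  simp only [le_min_iff] at hρ0
  simp only [ge_iff_le, max_le_iff] at hL
  obtain ⟨⟨r1, r2⟩, r3, r4⟩ := hρ0
  obtain ⟨⟨l1, l2⟩, l3⟩ := hL
  have eqs : ∀ q > 0, ∀ x > L, q * Real.exp x < ρ →
      (inflNumAt Ψ (hyp q x) = 0 ↔
        (q * Real.exp x) ^ (1 + 2) * gI (q * Real.exp x, Real.exp (-2 * x)) + q ^ 2 = 0) ∧
      (vertNumAt Ψ (hyp q x) = 0 ↔
        (q * Real.exp x) ^ (2 + 2) * gV (q * Real.exp x, Real.exp (-2 * x)) + q ^ 2 = 0) := by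
    intro q hq x hx hqx
    have hm : (q * Real.exp x, Real.exp (-2 * x)) ∈ Metric.ball (0 : ℝ × ℝ) η := by
      rw [mem_ball_zero_iff, Prod.norm_def]
      refine max_lt ?_ ?_
      · rw [Real.norm_of_nonneg (by positivity)]; linarith
      · rw [Real.norm_of_nonneg (by positivity), ← Real.lt_log_iff_exp_lt hη]; linarith
    obtain ⟨⟨e1, e2⟩, n1, n2⟩ := hb _ hm
    have hx2 : Real.exp x * Real.exp (-2 * x) = Real.exp (-x) := by
      rw [← Real.exp_add]; ring_nf
    have hh : hyp q x = (q * Real.exp x, q * Real.exp x * Real.exp (-2 * x)) := by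
      rw [mul_assoc, hx2]; rfl
    have hr : (q * Real.exp x) ^ 2 * Real.exp (-2 * x) = q ^ 2 := by
      have : Real.exp x * Real.exp (-x) = 1 := by rw [← Real.exp_add]; simp
      linear_combination q ^ 2 * Real.exp x * hx2 + q ^ 2 * this
    rw [hh, e1, e2, ← hr]
    simp only [hgI, hgV]
    have hu : q * Real.exp x ≠ 0 := by positivity
    generalize q * Real.exp x = u at *
    generalize Real.exp (-2 * x) = r at *
    constructor
    · rw [show u ^ (1 + 2) * (AI u / BI (u, r)) + u ^ 2 * r =
        (u ^ 2 * (u * AI u + r * BI (u, r))) / BI (u, r) by field_simp; ring]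
      simp [n1]
    · rw [show u ^ (2 + 2) * (AV u / BV (u, r)) + u ^ 2 * r =
        (u ^ 4 * (u ^ 2 * AV u + r * BV (u, r))) / BV (u, r) / u ^ 2 by field_simp; ring]
      simp [n2, hu]
  obtain ⟨pI, nI⟩ := z₁ ρ hρ r1 L l1
  obtain ⟨pV, nV⟩ := z₂ ρ hρ r2 L l2
  have hq0 : ∀ᶠ q in 𝓝[>] (0 : ℝ), 0 < q := self_mem_nhdsWithin
  have sI : ∀ {s : ℝ}, s = a * d → (s < 0 → gI 0 < 0) ∧ (¬ s < 0 → 0 < gI 0) := by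
    rintro s rfl
    have : 0 < (2 * d ^ 2)⁻¹ := by positivity
    have had : a * d ≠ 0 := mul_ne_zero ha0 hd0
    rw [gI0]
    exact ⟨fun h => mul_neg_of_neg_of_pos h this,
      fun h => mul_pos (lt_of_le_of_ne (not_lt.1 h) had.symm) this⟩
  have sV : (0 < c * d → gV 0 < 0) ∧ (¬ 0 < c * d → 0 < gV 0) := by
    have : 0 < (6 * A * d ^ 2)⁻¹ := by positivity
    have hcd : c * d ≠ 0 := mul_ne_zero hc0 hd0
    rw [gV0]
    exact ⟨fun h => neg_neg_of_pos (mul_pos h this),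
      fun h => neg_pos.2 (mul_neg_of_neg_of_pos (lt_of_le_of_ne (not_lt.1 h) hcd) this)⟩
  by_cases hs : a * d < 0 <;> by_cases ht : 0 < c * d
  · filter_upwards [hq0, nI ((sI rfl).1 hs) ρ' hρ' hρρ, nV (sV.1 ht) ρ' hρ' hρρ]
      with q hq ⟨x₁, b1, b2, b3, b4, b5⟩ ⟨x₂, c1, c2, c3, c4, c5⟩
    have hlt : x₁ < x₂ := by
      by_contra! hle
      have hu : q * Real.exp x₂ ≤ q * Real.exp x₁ := by gcongr
      have hu2 : 0 < q * Real.exp x₂ := by positivity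
      have hu1 : 0 < q * Real.exp x₁ := by positivity
      have h1 : |gI 0| * (q * Real.exp x₁) ^ (1 + 2) ≤
          4 * |gV 0| * (q * Real.exp x₁) ^ (2 + 2) := by
        have : (q * Real.exp x₂) ^ (2 + 2) ≤ (q * Real.exp x₁) ^ (2 + 2) := by gcongr
        nlinarith
      have h2 : q * Real.exp x₁ < |gI 0| / (4 * |gV 0|) := by linarith
      rw [lt_div_iff₀ (by positivity)] at h2
      have h3 : 0 < (q * Real.exp x₁) ^ 3 := by positivity
      have h4 : (q * Real.exp x₁) ^ (2 + 2) = (q * Real.exp x₁) ^ 3 * (q * Real.exp x₁) := by ring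
      rw [h4] at h1
      norm_num at h1
      nlinarith
    refine ⟨[(x₁, .i), (x₂, .v)], by simp [halfWord, hs, ht], by simp [hlt], ?_, ?_⟩
    · simp only [List.mem_cons, List.not_mem_nil, or_false]
      rintro e (rfl | rfl)
      exacts [⟨b1, b2⟩, ⟨c1, c2⟩]
    · intro x hx hqx
      rw [(eqs q hq x hx hqx).1, (eqs q hq x hx hqx).2, b3 x hx hqx, c3 x hx hqx]
      simp
  · filter_upwards [hq0, nI ((sI rfl).1 hs) ρ' hρ' hρρ] with q hq ⟨x₁, b1, b2, b3, b4, b5⟩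
    refine ⟨[(x₁, .i)], by simp [halfWord, hs, ht], by simp, by simpa using ⟨b1, b2⟩, ?_⟩
    intro x hx hqx
    rw [(eqs q hq x hx hqx).1, (eqs q hq x hx hqx).2, b3 x hx hqx]
    exact ⟨by simp, iff_of_false (pV (sV.2 ht) q hq x hx hqx) (by simp)⟩
  · filter_upwards [hq0, nV (sV.1 ht) ρ' hρ' hρρ] with q hq ⟨x₂, c1, c2, c3, c4, c5⟩
    refine ⟨[(x₂, .v)], by simp [halfWord, hs, ht], by simp, by simpa using ⟨c1, c2⟩, ?_⟩
    intro x hx hqx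
    rw [(eqs q hq x hx hqx).1, (eqs q hq x hx hqx).2, c3 x hx hqx]
    exact ⟨iff_of_false (pI ((sI rfl).2 hs) q hq x hx hqx) (by simp), by simp⟩
  · filter_upwards [hq0] with q hq
    refine ⟨[], by simp [halfWord, hs, ht], by simp, by simp, ?_⟩
    intro x hx hqx
    rw [(eqs q hq x hx hqx).1, (eqs q hq x hx hqx).2]
    exact ⟨iff_of_false (pI ((sI rfl).2 hs) q hq x hx hqx) (by simp),
      iff_of_false (pV (sV.2 ht) q hq x hx hqx) (by simp)⟩

/-! ## The zone around the middle of an arc -/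

/-- Positivity of the x-derivative on the compact segment over q = 0 persists for small q, giving
monotonicity; the signs at the ends persist as well. -/
theorem eventually_exists_unique_zero {G : ℝ × ℝ → ℝ} {a b : ℝ} (hab : a ≤ b)
    (hG : ∀ x, SmoothGermAt G (0, x)) (hd : ∀ x, 0 < fderiv ℝ G (0, x) (0, 1))
    (ha : G (0, a) < 0) (hb : 0 < G (0, b)) :
    ∀ᶠ q in 𝓝 (0 : ℝ), ∃ x₀ ∈ Ioo a b, ∀ x ∈ Icc a b, G (q, x) = 0 ↔ x = x₀ := by
  have h1 : ∀ᶠ q in 𝓝 (0 : ℝ), ∀ x ∈ Icc a b,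
      SmoothGermAt G (q, x) ∧ 0 < fderiv ℝ G (q, x) (0, 1) := by
    refine isCompact_Icc.eventually_forall_of_forall_eventually fun x _ => ?_
    refine (hG x).eventually.and ?_
    have := ((hG x).smooth_fderiv_apply (smoothGermAt_const ((0 : ℝ), (1 : ℝ)) _)).continuousAt
    exact this.eventually (lt_mem_nhds (hd x))
  have hc : ∀ x, Tendsto (fun q : ℝ => G (q, x)) (𝓝 0) (𝓝 (G (0, x))) := fun x =>
    (hG x).continuousAt.tendsto.comp ((Continuous.prodMk_left x).tendsto' _ _ rfl)
  filter_upwards [h1, (hc a).eventually (gt_mem_nhds ha), (hc b).eventually (lt_mem_nhds hb)]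
    with q e1 e2 e3
  have hder : ∀ x ∈ Icc a b, HasDerivAt (fun x => G (q, x)) (fderiv ℝ G (q, x) (0, 1)) x :=
    fun x hx => (e1 x hx).1.hasFDerivAt.comp_hasDerivAt x
      ((hasDerivAt_const x q).prodMk (hasDerivAt_id x))
  have hcont : ContinuousOn (fun x => G (q, x)) (Icc a b) :=
    fun x hx => (hder x hx).continuousAt.continuousWithinAt
  have hmono : StrictMonoOn (fun x => G (q, x)) (Icc a b) := by
    refine strictMonoOn_of_deriv_pos (convex_Icc a b) hcont fun x hx => ?_
    have hx := interior_subset hx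
    rw [(hder x hx).deriv]
    exact (e1 x hx).2
  obtain ⟨x₀, hx₀, hz⟩ := intermediate_value_Ioo hab hcont ⟨e2, e3⟩
  refine ⟨x₀, hx₀, fun x hx => ⟨fun h => ?_, ?_⟩⟩
  · exact hmono.injOn hx (Ioo_subset_Icc_self hx₀) (h.trans hz.symm)
  · rintro rfl; exact hz

/-- Divided by q, the arc extends smoothly to q = 0 as eˣ p + e⁻ˣ b. There the inflection function
is the constant 2d and the vertex function is -6d(|p|² e^(2x) - |b|² e^(-2x)), which has one simple
zero. -/
theorem middle_zone {Ψ : ℝ × ℝ → Plane} (hΨ : SmoothGermAt Ψ 0) (h0 : Ψ 0 = 0)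
    (hd : cross (fderiv ℝ Ψ 0 (1, 0)) (fderiv ℝ Ψ 0 (0, 1)) ≠ 0) :
    ∃ L₀ : ℝ, ∀ L ≥ L₀, ∀ᶠ q in 𝓝[>] (0 : ℝ), ∃ x₀ ∈ Ioo (-L) L, ∀ x ∈ Icc (-L) L,
      inflNumAt Ψ (hyp q x) ≠ 0 ∧ (vertNumAt Ψ (hyp q x) = 0 ↔ x = x₀) := by
  obtain ⟨P₀, Q₀, S₀, vP, vQ, -⟩ := exists_splits hΨ h0
  obtain ⟨P₁, hP₁⟩ : ∃ P₁, P₁ = fun t => P₀ t + t • deriv P₀ t := ⟨_, rfl⟩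
  obtain ⟨P₂, hP₂⟩ : ∃ P₂, P₂ = fun t => P₁ t + t • deriv P₁ t := ⟨_, rfl⟩
  obtain ⟨P₃, hP₃⟩ : ∃ P₃, P₃ = fun t => P₂ t + t • deriv P₂ t := ⟨_, rfl⟩
  obtain ⟨Q₁, hQ₁⟩ : ∃ Q₁, Q₁ = fun z => eul Q₀ z - Q₀ z := ⟨_, rfl⟩
  obtain ⟨Q₂, hQ₂⟩ : ∃ Q₂, Q₂ = fun z => eul Q₁ z - Q₁ z := ⟨_, rfl⟩
  obtain ⟨Q₃, hQ₃⟩ : ∃ Q₃, Q₃ = fun z => eul Q₂ z - Q₂ z := ⟨_, rfl⟩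
  have S₁ : Splits (eul Ψ) P₁ Q₁ := by rw [hP₁, hQ₁]; exact S₀.eul
  have S₂ : Splits (eul (eul Ψ)) P₂ Q₂ := by rw [hP₂, hQ₂]; exact S₁.eul
  have S₃ : Splits (eul (eul (eul Ψ))) P₃ Q₃ := by rw [hP₃, hQ₃]; exact S₂.eul
  set p := fderiv ℝ Ψ 0 (1, 0)
  set b := fderiv ℝ Ψ 0 (0, 1)
  set d := cross p b with hdef
  have v1 : P₁ 0 = p ∧ Q₁ 0 = -b := by simp [hQ₁, hP₁, eul_zero, vP, vQ]
  have v2 : P₂ 0 = p ∧ Q₂ 0 = b := by simp [hQ₂, hP₂, eul_zero, v1]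
  have v3 : P₃ 0 = p ∧ Q₃ 0 = -b := by simp [hQ₃, hP₃, eul_zero, v2]
  have hyp0 : ∀ x, hyp 0 x = 0 := fun x => by simp [hyp]
  -- W is u P(u) + v Q(u, v) on the hyperbola divided by q; in this form it makes sense and is
  -- smooth also at q = 0.
  let W : (ℝ → Plane) → (ℝ × ℝ → Plane) → ℝ × ℝ → Plane := fun P Q z =>
    Real.exp z.2 • P (z.1 * Real.exp z.2) + Real.exp (-z.2) • Q (hyp z.1 z.2)
  have sW : ∀ {P Q} (x : ℝ), SmoothGermAt P 0 → SmoothGermAt Q 0 → SmoothGermAt (W P Q) (0, x) := by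
    intro P Q x hP hQ
    have s1 : SmoothGermAt (fun z : ℝ × ℝ => Real.exp z.2) (0, x) :=
      ContDiff.smoothGermAt (by fun_prop) _
    have s2 : SmoothGermAt (fun z : ℝ × ℝ => Real.exp (-z.2)) (0, x) :=
      ContDiff.smoothGermAt (by fun_prop) _
    have s3 : SmoothGermAt (fun z : ℝ × ℝ => z.1 * Real.exp z.2) (0, x) :=
      ContDiff.smoothGermAt (by fun_prop) _
    exact (s1.smul (hP.comp_of_eq s3 (by simp))).add
      (s2.smul (hQ.comp_of_eq (contDiff_hyp.smoothGermAt _) (hyp0 x)))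
  have W0 : ∀ P Q x, W P Q (0, x) = Real.exp x • P 0 + Real.exp (-x) • Q 0 := fun P Q x => by
    simp [W, hyp0]
  let GI : ℝ × ℝ → ℝ := fun z => cross (W P₁ Q₁ z) (W P₂ Q₂ z)
  let GV : ℝ × ℝ → ℝ := fun z => vertNum (W P₁ Q₁ z) (W P₂ Q₂ z) (W P₃ Q₃ z)
  have sGI : ∀ x, SmoothGermAt GI (0, x) := fun x =>
    (sW x S₁.left S₁.right).cross (sW x S₂.left S₂.right)
  have sGV : ∀ x, SmoothGermAt GV (0, x) := fun x =>
    (sW x S₁.left S₁.right).vertNum (sW x S₂.left S₂.right) (sW x S₃.left S₃.right)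
  have hexp : ∀ x : ℝ, Real.exp x * Real.exp (-x) = 1 := fun x => by
    rw [← Real.exp_add]; simp
  have GI0 : ∀ x, GI (0, x) = 2 * d := by
    intro x
    simp only [GI, W0, v1, v2]
    simp only [hdef, cross, Prod.fst_add, Prod.snd_add, Prod.smul_fst, Prod.smul_snd, smul_eq_mul,
      Prod.fst_neg, Prod.snd_neg]
    linear_combination 2 * (p.1 * b.2 - p.2 * b.1) * hexp x
  have GV0 : ∀ x, GV (0, x) =
      -6 * d * (dotp p p * Real.exp x ^ 2 - dotp b b * Real.exp (-x) ^ 2) := by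
    intro x
    simp only [GV, W0, v1, v2, v3]
    simp only [hdef, vertNum, cross, dotp, Prod.fst_add, Prod.snd_add, Prod.smul_fst,
      Prod.smul_snd, smul_eq_mul, Prod.fst_neg, Prod.snd_neg]
    linear_combination (-6 * (p.1 * b.2 - p.2 * b.1) * ((p.1 ^ 2 + p.2 ^ 2) * Real.exp x ^ 2
      - (b.1 ^ 2 + b.2 ^ 2) * Real.exp (-x) ^ 2)) * hexp x
  have hp : 0 < dotp p p := dotp_self_pos fun h => hd (by rw [hdef, h]; simp [cross])
  have hb : 0 < dotp b b := dotp_self_pos fun h => hd (by rw [hdef, h]; simp [cross])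
  have hdd : 0 < d ^ 2 := by positivity
  -- The factor -d makes the vertex function increasing in x whatever the sign of d.
  have sH : ∀ x, SmoothGermAt (fun z => -d * GV z) (0, x) := fun x =>
    (smoothGermAt_const (-d) _).mul (sGV x)
  have hH : ∀ x, 0 < fderiv ℝ (fun z => -d * GV z) (0, x) (0, 1) := by
    intro x
    have h1 : HasDerivAt (fun t : ℝ => -d * GV (0, t))
        (fderiv ℝ (fun z => -d * GV z) (0, x) (0, 1)) x :=
      (sH x).hasFDerivAt.comp_hasDerivAt x ((hasDerivAt_const x (0 : ℝ)).prodMk (hasDerivAt_id x))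
    have h2 : HasDerivAt (fun t : ℝ => -d * GV (0, t)) (-d * (-6 * d * (dotp p p *
        (2 * Real.exp x ^ 2) + dotp b b * (2 * Real.exp (-x) ^ 2)))) x := by
      simp only [GV0]
      have e1 := ((Real.hasDerivAt_exp x).fun_pow 2).const_mul (dotp p p)
      have e2 := (((hasDerivAt_neg x).exp).fun_pow 2).const_mul (dotp b b)
      refine (((e1.sub e2).const_mul (-6 * d)).const_mul (-d)).congr_deriv ?_
      push_cast; ring
    rw [h1.unique h2]
    have : 0 < 6 * d ^ 2 * (dotp p p * (2 * Real.exp x ^ 2) + dotp b b * (2 * Real.exp (-x) ^ 2)) := by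
      positivity
    linarith
  have hlim : ∀ᶠ L in atTop, 0 < L ∧ dotp b b < dotp p p * Real.exp L ∧
      dotp p p < dotp b b * Real.exp L := by
    refine (eventually_gt_atTop 0).and (Eventually.and ?_ ?_)
    · exact (Real.tendsto_exp_atTop.const_mul_atTop hp).eventually_gt_atTop _
    · exact (Real.tendsto_exp_atTop.const_mul_atTop hb).eventually_gt_atTop _
  obtain ⟨L₀, hL₀⟩ := eventually_atTop.1 hlim
  refine ⟨L₀, fun L hL => ?_⟩
  obtain ⟨l0, l1, l2⟩ := hL₀ L hL
  have hE : 1 < Real.exp L := Real.one_lt_exp_iff.2 l0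
  have hE' : Real.exp (-L) < 1 := by
    rw [← Real.exp_zero]; exact Real.exp_lt_exp.2 (by linarith)
  have hE'' : 0 < Real.exp (-L) := Real.exp_pos _
  have ends : ∀ {A B : ℝ}, 0 < A → 0 < B → B < A * Real.exp L →
      B * Real.exp (-L) ^ 2 < A * Real.exp L ^ 2 := by
    intro A B hA hB h
    have h0 : Real.exp (-L) ^ 2 < 1 := by nlinarith
    have h1 : B * Real.exp (-L) ^ 2 < B := by nlinarith
    have h2 : A * Real.exp L < A * Real.exp L ^ 2 := by nlinarith [mul_pos hA (Real.exp_pos L)]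
    linarith
  have z1 := eventually_exists_unique_zero (a := -L) (b := L) (by linarith) sH hH
    (by
      simp only [GV0, neg_neg]
      have := mul_pos hdd (sub_pos.2 (ends hb hp l2))
      nlinarith)
    (by
      simp only [GV0]
      have := mul_pos hdd (sub_pos.2 (ends hp hb l1))
      nlinarith)
  have z2 : ∀ᶠ q in 𝓝 (0 : ℝ), ∀ x ∈ Icc (-L) L, GI (q, x) ≠ 0 ∧
      inflNumAt Ψ (hyp q x) = q ^ 2 * GI (q, x) ∧ vertNumAt Ψ (hyp q x) = q ^ 4 * GV (q, x) := by
    refine isCompact_Icc.eventually_forall_of_forall_eventually fun x _ => ?_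
    have ht : Tendsto (fun z : ℝ × ℝ => hyp z.1 z.2) (𝓝 (0, x)) (𝓝 0) :=
      contDiff_hyp.continuous.tendsto' _ _ (hyp0 x)
    have hne : GI (0, x) ≠ 0 := by rw [GI0]; positivity
    filter_upwards [(sGI x).continuousAt.eventually_ne hne, ht.eventually S₁.eq,
      ht.eventually S₂.eq, ht.eventually S₃.eq] with z n1 e1 e2 e3
    refine ⟨n1, ?_⟩
    have key : ∀ P Q, (hyp z.1 z.2).1 • P (hyp z.1 z.2).1 + (hyp z.1 z.2).2 • Q (hyp z.1 z.2) =
        z.1 • W P Q z := fun P Q => by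
      simp only [W, smul_add, smul_smul]; rfl
    rw [inflNumAt, vertNumAt, e1, e2, e3, key, key, key]
    simp only [GI, GV]
    constructor
    · simp only [cross, Prod.smul_fst, Prod.smul_snd, smul_eq_mul]; ring
    · simp only [vertNum, dotp, cross, Prod.smul_fst, Prod.smul_snd, smul_eq_mul]; ring
  filter_upwards [self_mem_nhdsWithin, nhdsWithin_le_nhds z1, nhdsWithin_le_nhds z2]
    with q hq ⟨x₀, hx₀, e1⟩ e2
  have hq : 0 < q := hq
  refine ⟨x₀, hx₀, fun x hx => ?_⟩
  obtain ⟨n, f1, f2⟩ := e2 x hx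
  rw [f1, f2]
  refine ⟨by positivity, ?_⟩
  rw [← e1 x hx]
  have hd0 : -d ≠ 0 := neg_ne_zero.2 hd
  simp [hq.ne', hd]

/-! ## The word of an arc -/

theorem eul_neg (h : ℝ × ℝ → Plane) : eul (fun z => -h z) = fun z => -eul h z := by
  funext z; simp [eul, fderiv_fun_neg]

/-- In `inflNumAt` exactly one of the two vectors is an odd iterate of E, so the sign flips; in
`vertNumAt` the signs cancel. Zero sets agree in both cases, so the other end of an arc reduces to
`half_arc`. -/
theorem numAt_comp_swap {Ψ : ℝ × ℝ → Plane} (hΨ : SmoothGermAt Ψ 0) :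
    ∀ᶠ z in 𝓝 (0 : ℝ × ℝ), inflNumAt (fun y => Ψ y.swap) z = -inflNumAt Ψ z.swap ∧
      vertNumAt (fun y => Ψ y.swap) z = vertNumAt Ψ z.swap := by
  have ts : Tendsto (Prod.swap : ℝ × ℝ → ℝ × ℝ) (𝓝 0) (𝓝 0) :=
    continuous_swap.tendsto' _ _ rfl
  have e1 : eul (fun y => Ψ y.swap) =ᶠ[𝓝 0] fun z => -eul Ψ z.swap := by
    filter_upwards [ts.eventually hΨ.eventually] with z hz using eul_comp_swap hz
  have e2 : eul (eul (fun y => Ψ y.swap)) =ᶠ[𝓝 0] fun z => eul (eul Ψ) z.swap := by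
    refine (eul_congr e1).trans ?_
    rw [eul_neg (fun z => eul Ψ z.swap)]
    filter_upwards [ts.eventually hΨ.eul.eventually] with z hz
    rw [eul_comp_swap hz, neg_neg]
  have e3 : eul (eul (eul (fun y => Ψ y.swap))) =ᶠ[𝓝 0] fun z => -eul (eul (eul Ψ)) z.swap := by
    refine (eul_congr e2).trans ?_
    filter_upwards [ts.eventually hΨ.eul.eul.eventually] with z hz using eul_comp_swap hz
  filter_upwards [e1, e2, e3] with z h1 h2 h3
  simp only [inflNumAt, vertNumAt, h1, h2, h3, cross, vertNum, dotp, Prod.fst_neg, Prod.snd_neg]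
  constructor <;> ring

/-- The list `l` of parameters and letters describes the inflections and the vertices of the arc
`x ↦ Ψ (q eˣ, q e⁻ˣ)` in the box of size `ρ`; they all lie in the box of size `ρ'`. -/
structure ListsMarks (Ψ : ℝ × ℝ → Plane) (q ρ ρ' : ℝ) (l : List (ℝ × Mark)) : Prop where
  sorted : l.Pairwise fun e e' => e.1 < e'.1
  small : ∀ e ∈ l, (hyp q e.1).1 < ρ' ∧ (hyp q e.1).2 < ρ'
  infl : ∀ x, (hyp q x).1 < ρ → (hyp q x).2 < ρ → (inflNumAt Ψ (hyp q x) = 0 ↔ (x, Mark.i) ∈ l)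
  vert : ∀ x, (hyp q x).1 < ρ → (hyp q x).2 < ρ → (vertNumAt Ψ (hyp q x) = 0 ↔ (x, Mark.v) ∈ l)

/-- The half x > L, the middle, and the half x < -L seen through the swapped chart are concatenated.
All marks land in the ρ'-box, while the description is valid in the larger ρ-box. -/
theorem arc_word {Ψ : ℝ × ℝ → Plane} (hΨ : SmoothGermAt Ψ 0) (h0 : Ψ 0 = 0) {a c a' c' d : ℝ}
    (hd : cross (fderiv ℝ Ψ 0 (1, 0)) (fderiv ℝ Ψ 0 (0, 1)) = d) (hd0 : d ≠ 0)
    (ha : cross (deriv (fun t => Ψ (t, 0)) 0) (deriv (deriv (fun t => Ψ (t, 0))) 0) = a)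
    (ha0 : a ≠ 0)
    (hc : vertNum (deriv (fun t => Ψ (t, 0)) 0) (deriv (deriv (fun t => Ψ (t, 0))) 0)
        (deriv (deriv (deriv (fun t => Ψ (t, 0)))) 0) = c) (hc0 : c ≠ 0)
    (ha' : cross (deriv (fun t => Ψ (0, t)) 0) (deriv (deriv (fun t => Ψ (0, t))) 0) = a')
    (ha'0 : a' ≠ 0)
    (hc' : vertNum (deriv (fun t => Ψ (0, t)) 0) (deriv (deriv (fun t => Ψ (0, t))) 0)
        (deriv (deriv (deriv (fun t => Ψ (0, t)))) 0) = c') (hc'0 : c' ≠ 0) :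
    ∃ ρ₀ > 0, ∀ ρ : ℝ, 0 < ρ → ρ ≤ ρ₀ → ∀ ρ' > 0, ρ' ≤ ρ → ∀ᶠ q in 𝓝[>] (0 : ℝ),
      ∃ l : List (ℝ × Mark), l.map Prod.snd =
        (halfWord (a' * -d) (c' * -d)).reverse ++ [Mark.v] ++ halfWord (a * d) (c * d) ∧
        ListsMarks Ψ q ρ ρ' l := by
  have hs : SmoothGermAt (fun y => Ψ (Prod.swap y)) 0 :=
    hΨ.comp_of_eq (f := Prod.swap) ((smoothGermAt_snd 0).prodMk (smoothGermAt_fst 0)) rfl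
  have hfs : ∀ v, fderiv ℝ (fun y => Ψ (Prod.swap y)) 0 v = fderiv ℝ Ψ 0 v.swap := by
    intro v
    have hΨ' : HasFDerivAt Ψ (fderiv ℝ Ψ 0) ((ContinuousLinearEquiv.prodComm ℝ ℝ ℝ) (0 : ℝ × ℝ)) :=
      hΨ.hasFDerivAt
    have := hΨ'.comp 0 (ContinuousLinearEquiv.prodComm ℝ ℝ ℝ).hasFDerivAt
    have e : fderiv ℝ (fun y => Ψ (Prod.swap y)) 0 = _ := this.fderiv
    rw [e]; rfl
  obtain ⟨ρ₁, hρ₁, L₁, H₁⟩ := half_arc hΨ h0 hd hd0 ha ha0 hc hc0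
  -- Swapping the coordinates reverses orientation, so d becomes -d at this end.
  obtain ⟨ρ₂, hρ₂, L₂, H₂⟩ := half_arc (d := -d) hs h0
    (by rw [hfs, hfs]; simp only [Prod.swap_prod_mk]; rw [cross_swap, hd]) (neg_ne_zero.2 hd0)
    ha' ha'0 hc' hc'0
  obtain ⟨L₃, H₃⟩ := middle_zone hΨ h0 (hd ▸ hd0)
  obtain ⟨η, hη, hb⟩ := Metric.eventually_nhds_iff_ball.1 (numAt_comp_swap hΨ)
  refine ⟨min (min ρ₁ ρ₂) η, by positivity, fun ρ hρ hρ0 ρ' hρ' hρρ => ?_⟩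
  simp only [le_min_iff] at hρ0
  obtain ⟨⟨r1, r2⟩, r3⟩ := hρ0
  obtain ⟨L, hL0, hL1, hL2, hL3⟩ : ∃ L, 0 < L ∧ L₁ ≤ L ∧ L₂ ≤ L ∧ L₃ ≤ L :=
    ⟨max (max L₁ L₂) (max L₃ 1), by simp⟩
  have hsm : ∀ᶠ q in 𝓝[>] (0 : ℝ), q * Real.exp L < ρ' := by
    refine nhdsWithin_le_nhds ?_
    have : Tendsto (fun q : ℝ => q * Real.exp L) (𝓝 0) (𝓝 0) :=
      Continuous.tendsto' (by fun_prop) _ _ (by simp)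
    exact this.eventually (gt_mem_nhds hρ')
  filter_upwards [self_mem_nhdsWithin, hsm, H₁ ρ hρ r1 L hL1 ρ' hρ' hρρ,
    H₂ ρ hρ r2 L hL2 ρ' hρ' hρρ, H₃ L hL3] with q hq hqL ⟨lu, wu, pu, bu, iu⟩ ⟨lv, wv, pv, bv, iv⟩
    ⟨x₀, hx₀, i₀⟩
  have hq : 0 < q := hq
  have hlt : ∀ x < L, q * Real.exp x < ρ' := fun x hx =>
    lt_trans (by gcongr) hqL
  set lv' : List (ℝ × Mark) := (lv.map fun e => (-e.1, e.2)).reverse with hlv'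
  have mlv : ∀ x m, (x, m) ∈ lv' ↔ (-x, m) ∈ lv := by
    intro x m
    simp only [hlv', List.mem_reverse, List.mem_map, Prod.mk.injEq, Prod.exists]
    constructor
    · rintro ⟨y, n, h, rfl, rfl⟩; simpa using h
    · exact fun h => ⟨-x, m, h, by simp, rfl⟩
  have sv : ∀ e ∈ lv', e.1 < -L ∧ q * Real.exp (-e.1) < ρ' := by
    rintro ⟨x, m⟩ he
    have := bv _ ((mlv x m).1 he)
    exact ⟨by linarith [this.1], this.2⟩
  have mem : ∀ x m, (x, m) ∈ lv' ++ [(x₀, Mark.v)] ++ lu ↔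
      (x, m) ∈ lv' ∨ (x = x₀ ∧ m = Mark.v) ∨ (x, m) ∈ lu := by
    intro x m; simp
  have key : ∀ x, (hyp q x).1 < ρ → (hyp q x).2 < ρ →
      (inflNumAt Ψ (hyp q x) = 0 ↔ (x, Mark.i) ∈ lv' ++ [(x₀, Mark.v)] ++ lu) ∧
      (vertNumAt Ψ (hyp q x) = 0 ↔ (x, Mark.v) ∈ lv' ++ [(x₀, Mark.v)] ++ lu) := by
    intro x h1 h2
    rw [mem, mem]
    rcases lt_or_ge L x with hx | hx
    · have n1 : ∀ m, (x, m) ∉ lv' := fun m h => by have := (sv _ h).1; dsimp only at this; linarith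
      have n2 : x ≠ x₀ := by linarith [hx₀.2]
      simpa [n1, n2] using iu x hx h1
    · have n3 : ∀ m, (x, m) ∉ lu := fun m h => by have := (bu _ h).1; dsimp only at this; linarith
      rcases lt_or_ge x (-L) with hx' | hx'
      · have n2 : x ≠ x₀ := by linarith [hx₀.1]
        have hm : hyp q (-x) ∈ Metric.ball (0 : ℝ × ℝ) η := by
          rw [mem_ball_zero_iff, Prod.norm_def, hyp_neg]
          refine max_lt ?_ ?_
          · rw [Real.norm_of_nonneg (by simp only [hyp, Prod.fst_swap]; positivity)]
            exact h2.trans_le r3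
          · rw [Real.norm_of_nonneg (by simp only [hyp, Prod.snd_swap]; positivity)]
            exact h1.trans_le r3
        obtain ⟨f1, f2⟩ := hb _ hm
        have := iv (-x) (by linarith) h2
        rw [f1, f2, hyp_neg, Prod.swap_swap, neg_eq_zero, ← mlv, ← mlv] at this
        simpa [n2, n3] using this
      · have n1 : ∀ m, (x, m) ∉ lv' := fun m h => by
          have := (sv _ h).1; dsimp only at this; linarith
        obtain ⟨g1, g2⟩ := i₀ x ⟨hx', hx⟩
        simp [n1, n3, g1, g2]
  refine ⟨lv' ++ [(x₀, .v)] ++ lu, ?_, ?_, ?_, fun x h1 h2 => (key x h1 h2).1,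
    fun x h1 h2 => (key x h1 h2).2⟩
  · have : lv'.map Prod.snd = (lv.map Prod.snd).reverse := by
      simp [hlv', List.map_reverse, Function.comp_def]
    rw [List.map_append, List.map_append, this, wu, wv]; rfl
  · rw [List.append_assoc, List.pairwise_append, List.singleton_append, List.pairwise_cons]
    refine ⟨?_, ⟨fun e he => hx₀.2.trans (bu e he).1, pu⟩, ?_⟩
    · rw [hlv', List.pairwise_reverse, List.pairwise_map]
      exact pv.imp fun h => neg_lt_neg h
    · intro e he e' he'
      have h1 := (sv e he).1
      rcases List.mem_cons.1 he' with rfl | he'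
      · exact h1.trans hx₀.1
      · linarith [(bu e' he').1]
  · rintro ⟨x, m⟩ he
    rw [mem] at he
    simp only [hyp]
    rcases he with he | ⟨rfl, -⟩ | he
    · have := sv _ he; dsimp only at this
      exact ⟨hlt _ (by linarith), this.2⟩
    · exact ⟨hlt _ hx₀.2, hlt _ (by linarith [hx₀.1])⟩
    · have := bu _ he; dsimp only at this
      exact ⟨this.2, hlt _ (by linarith)⟩

/-! ## The part of an arc inside a disc -/

theorem isOpen_setOf_hyp_lt (q ρ : ℝ) : IsOpen {x | (hyp q x).1 < ρ ∧ (hyp q x).2 < ρ} := by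
  have h1 : Continuous fun x => (hyp q x).1 := by unfold hyp; fun_prop
  have h2 : Continuous fun x => (hyp q x).2 := by unfold hyp; fun_prop
  exact (isOpen_lt h1 continuous_const).inter (isOpen_lt h2 continuous_const)

theorem hyp_mem_ball {q x η : ℝ} (hq : 0 < q) (h1 : (hyp q x).1 < η) (h2 : (hyp q x).2 < η) :
    hyp q x ∈ Metric.ball (0 : ℝ × ℝ) η := by
  rw [mem_ball_zero_iff, Prod.norm_def]
  refine max_lt ?_ ?_
  · rwa [Real.norm_of_nonneg (by simp only [hyp]; positivity)]
  · rwa [Real.norm_of_nonneg (by simp only [hyp]; positivity)]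

/-- The second x-derivative of |Ψ|² is 2(|EΨ|² + Ψ · E²Ψ), a quadratic form in u, v with smooth
coefficients. At the origin the bracket equals 2|p|² u² + 2|b|² v², so nearby it is at least m(u² -
uv + v²) with m = min(|p|², |b|²). -/
theorem convexOn_normSq_hyp {Ψ : ℝ × ℝ → Plane} (hΨ : SmoothGermAt Ψ 0) (h0 : Ψ 0 = 0)
    (hd : cross (fderiv ℝ Ψ 0 (1, 0)) (fderiv ℝ Ψ 0 (0, 1)) ≠ 0) :
    ∃ ρ₀ > 0, ∀ ρ ≤ ρ₀, ∀ q > 0,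
      ConvexOn ℝ {x | (hyp q x).1 < ρ ∧ (hyp q x).2 < ρ}
        fun x => dotp (Ψ (hyp q x)) (Ψ (hyp q x)) := by
  obtain ⟨P₀, Q₀, S₀, vP, vQ, -⟩ := exists_splits hΨ h0
  obtain ⟨P₁, hP₁⟩ : ∃ P₁, P₁ = fun t => P₀ t + t • deriv P₀ t := ⟨_, rfl⟩
  obtain ⟨P₂, hP₂⟩ : ∃ P₂, P₂ = fun t => P₁ t + t • deriv P₁ t := ⟨_, rfl⟩
  obtain ⟨Q₁, hQ₁⟩ : ∃ Q₁, Q₁ = fun z => eul Q₀ z - Q₀ z := ⟨_, rfl⟩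
  obtain ⟨Q₂, hQ₂⟩ : ∃ Q₂, Q₂ = fun z => eul Q₁ z - Q₁ z := ⟨_, rfl⟩
  have S₁ : Splits (eul Ψ) P₁ Q₁ := by rw [hP₁, hQ₁]; exact S₀.eul
  have S₂ : Splits (eul (eul Ψ)) P₂ Q₂ := by rw [hP₂, hQ₂]; exact S₁.eul
  set p := fderiv ℝ Ψ 0 (1, 0)
  set b := fderiv ℝ Ψ 0 (0, 1)
  have v1 : P₁ 0 = p ∧ Q₁ 0 = -b := by simp [hQ₁, hP₁, eul_zero, vP, vQ]
  have v2 : P₂ 0 = p ∧ Q₂ 0 = b := by simp [hQ₂, hP₂, eul_zero, v1]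
  have hp : 0 < dotp p p := dotp_self_pos fun h => hd (by rw [h]; simp [cross])
  have hb : 0 < dotp b b := dotp_self_pos fun h => hd (by rw [h]; simp [cross])
  have lift : ∀ {P : ℝ → Plane}, SmoothGermAt P 0 → SmoothGermAt (fun z : ℝ × ℝ => P z.1) 0 :=
    fun hP => hP.comp_of_eq (smoothGermAt_fst 0) rfl
  set m := min (dotp p p) (dotp b b)
  have hm : 0 < m := lt_min hp hb
  have c11 := (((lift S₁.left).dotp (lift S₁.left)).add
    ((lift S₀.left).dotp (lift S₂.left))).continuousAt
  have c22 := ((S₁.right.dotp S₁.right).add (S₀.right.dotp S₂.right)).continuousAt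
  have c12 := (((smoothGermAt_const (2 : ℝ) _).mul ((lift S₁.left).dotp S₁.right)).add
    (((lift S₀.left).dotp S₂.right).add (S₀.right.dotp (lift S₂.left)))).continuousAt
  have e11 := c11.eventually (lt_mem_nhds (a := m) (by
    simp only [Prod.fst_zero, vP, v1, v2]; linarith [min_le_left (dotp p p) (dotp b b)]))
  have e22 := c22.eventually (lt_mem_nhds (a := m) (by
    simp only [vQ, v1, v2, dotp, Prod.fst_neg, Prod.snd_neg]
    have := min_le_right (dotp p p) (dotp b b)
    simp only [dotp] at this hb
    simp only [m, dotp]; linarith))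
  -- The mixed coefficient cancels at the origin because E has eigenvalues 1 and -1 on the two
  -- directions.
  have z12 : 2 * dotp p (-b) + (dotp p b + dotp b p) = 0 := by
    simp only [dotp, Prod.fst_neg, Prod.snd_neg]; ring
  have e12 := c12.eventually (lt_mem_nhds (a := -m) (by
    simp only [Prod.fst_zero, vP, vQ, v1, v2, z12]; linarith))
  obtain ⟨η, hη, H⟩ := Metric.eventually_nhds_iff_ball.1 (((e11.and e22).and e12).and
    ((hΨ.eventually.and hΨ.eul.eventually).and ((S₀.eq.and S₁.eq).and S₂.eq)))
  refine ⟨η, hη, fun ρ hρ q hq => ?_⟩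
  have hball : ∀ x, (hyp q x).1 < ρ ∧ (hyp q x).2 < ρ → hyp q x ∈ Metric.ball (0 : ℝ × ℝ) η := by
    exact fun x h => hyp_mem_ball hq (h.1.trans_le hρ) (h.2.trans_le hρ)
  have hconv : Convex ℝ {x | (hyp q x).1 < ρ ∧ (hyp q x).2 < ρ} := by
    have c1 : ConvexOn ℝ univ fun x => (hyp q x).1 := convexOn_exp.smul hq.le
    have c2 : ConvexOn ℝ univ fun x => (hyp q x).2 :=
      (convexOn_exp.comp_linearMap (-LinearMap.id)).smul hq.le
    have := (c1.convex_lt ρ).inter (c2.convex_lt ρ)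
    simp only [mem_univ, true_and] at this
    exact this
  have hopen := isOpen_setOf_hyp_lt q ρ
  have hdot : ∀ {f g : ℝ → Plane} {f' g' : Plane} {x : ℝ}, HasDerivAt f f' x → HasDerivAt g g' x →
      HasDerivAt (fun x => dotp (f x) (g x)) (dotp f' (g x) + dotp (f x) g') x := by
    intro f g f' g' x hf hg
    obtain ⟨f1, f2⟩ := hasDerivAt_fst_snd hf
    obtain ⟨g1, g2⟩ := hasDerivAt_fst_snd hg
    refine ((f1.mul g1).add (f2.mul g2)).congr_deriv ?_
    simp only [dotp]; ring
  have d1 : ∀ x ∈ {x | (hyp q x).1 < ρ ∧ (hyp q x).2 < ρ},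
      HasDerivAt (fun x => dotp (Ψ (hyp q x)) (Ψ (hyp q x)))
        (2 * dotp (Ψ (hyp q x)) (eul Ψ (hyp q x))) x := by
    intro x hx
    have hx' := hasDerivAt_comp_hyp (H _ (hball x hx)).2.1.1
    refine (hdot hx' hx').congr_deriv ?_
    simp only [dotp]; ring
  have d2 : ∀ x ∈ {x | (hyp q x).1 < ρ ∧ (hyp q x).2 < ρ},
      HasDerivAt (deriv fun x => dotp (Ψ (hyp q x)) (Ψ (hyp q x)))
        (2 * (dotp (eul Ψ (hyp q x)) (eul Ψ (hyp q x)) +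
          dotp (Ψ (hyp q x)) (eul (eul Ψ) (hyp q x)))) x := by
    intro x hx
    have h1 := hasDerivAt_comp_hyp (H _ (hball x hx)).2.1.1
    have h2 := hasDerivAt_comp_hyp (H _ (hball x hx)).2.1.2
    refine ((hdot h1 h2).const_mul 2).congr_of_eventuallyEq ?_
    filter_upwards [hopen.mem_nhds hx] with y hy using (d1 y hy).deriv
  refine convexOn_of_deriv2_nonneg' hconv (fun x hx => (d1 x hx).differentiableAt.differentiableWithinAt)
    (fun x hx => (d2 x hx).differentiableAt.differentiableWithinAt) fun x hx => ?_
  show 0 ≤ deriv (deriv fun x => dotp (Ψ (hyp q x)) (Ψ (hyp q x))) x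
  rw [(d2 x hx).deriv]
  obtain ⟨⟨⟨f11, f22⟩, f12⟩, -, ⟨g0, g1⟩, g2⟩ := H _ (hball x hx)
  have hu : 0 < (hyp q x).1 := by simp only [hyp]; positivity
  have hv : 0 < (hyp q x).2 := by simp only [hyp]; positivity
  rw [g0, g1, g2]
  generalize hyp q x = z at *
  have expand : dotp (z.1 • P₁ z.1 + z.2 • Q₁ z) (z.1 • P₁ z.1 + z.2 • Q₁ z) +
      dotp (z.1 • P₀ z.1 + z.2 • Q₀ z) (z.1 • P₂ z.1 + z.2 • Q₂ z) =
      z.1 ^ 2 * (dotp (P₁ z.1) (P₁ z.1) + dotp (P₀ z.1) (P₂ z.1)) +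
      z.1 * z.2 * (2 * dotp (P₁ z.1) (Q₁ z) + (dotp (P₀ z.1) (Q₂ z) + dotp (Q₀ z) (P₂ z.1))) +
      z.2 ^ 2 * (dotp (Q₁ z) (Q₁ z) + dotp (Q₀ z) (Q₂ z)) := by
    simp only [dotp, Prod.fst_add, Prod.snd_add, Prod.smul_fst, Prod.smul_snd, smul_eq_mul]
    ring
  rw [expand]
  have i1 := mul_le_mul_of_nonneg_left f11.le (sq_nonneg z.1)
  have i2 := mul_le_mul_of_nonneg_left f22.le (sq_nonneg z.2)
  have i3 := mul_le_mul_of_nonneg_left f12.le (mul_pos hu hv).le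
  have i4 : 0 ≤ m * (z.1 ^ 2 - z.1 * z.2 + z.2 ^ 2) :=
    mul_nonneg hm.le (by nlinarith [sq_nonneg (z.1 - z.2), sq_nonneg z.1, sq_nonneg z.2])
  linarith

theorem exists_eq_Ioo {s : Set ℝ} (ho : IsOpen s) (hc : Convex ℝ s) (hb : BddBelow s)
    (ha : BddAbove s) (hn : s.Nonempty) : ∃ a b, a < b ∧ s = Ioo a b := by
  have hconn : IsConnected s := ⟨hn, hc.isPreconnected⟩
  have h1 : s = Ioo (sInf s) (sSup s) := by
    refine Subset.antisymm (fun x hx => ⟨?_, ?_⟩) (hconn.Ioo_csInf_csSup_subset hb ha)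
    · obtain ⟨y, hy, hys⟩ := mem_nhdsLT_iff_exists_Ioo_subset.1
        (nhdsWithin_le_nhds (ho.mem_nhds hx) : s ∈ 𝓝[<] x)
      obtain ⟨z, hz⟩ := exists_between (mem_Iio.1 hy)
      exact (csInf_le hb (hys hz)).trans_lt hz.2
    · obtain ⟨y, hy, hys⟩ := mem_nhdsGT_iff_exists_Ioo_subset.1
        (nhdsWithin_le_nhds (ho.mem_nhds hx) : s ∈ 𝓝[>] x)
      obtain ⟨z, hz⟩ := exists_between (mem_Ioi.1 hy)
      exact hz.1.trans_le (le_csSup ha (hys hz))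
  obtain ⟨x, hx⟩ := hn
  rw [h1] at hx
  exact ⟨_, _, hx.1.trans hx.2, h1⟩

/-- A sublevel set of a convex function is an interval, so the arc meets the disc in one piece, with
no return after leaving. -/
theorem arc_domain {Ψ : ℝ × ℝ → Plane} (hΨ : SmoothGermAt Ψ 0) (h0 : Ψ 0 = 0)
    (hd : cross (fderiv ℝ Ψ 0 (1, 0)) (fderiv ℝ Ψ 0 (0, 1)) ≠ 0) :
    ∃ ρ₀ > 0, ∀ ρ ≤ ρ₀, ∀ q > 0, ∀ R x₀ : ℝ, (hyp q x₀).1 < ρ → (hyp q x₀).2 < ρ →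
      dotp (Ψ (hyp q x₀)) (Ψ (hyp q x₀)) < R → ∃ a b, a < b ∧
        {x | (hyp q x).1 < ρ ∧ (hyp q x).2 < ρ ∧ dotp (Ψ (hyp q x)) (Ψ (hyp q x)) < R} =
          Ioo a b := by
  obtain ⟨ρ₁, hρ₁, H⟩ := convexOn_normSq_hyp hΨ h0 hd
  obtain ⟨η, hη, hb⟩ := Metric.eventually_nhds_iff_ball.1 hΨ.eventually
  refine ⟨min ρ₁ η, by positivity, fun ρ hρ q hq R x₀ h1 h2 h3 => ?_⟩
  simp only [le_min_iff] at hρ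
  have hset : {x | (hyp q x).1 < ρ ∧ (hyp q x).2 < ρ ∧ dotp (Ψ (hyp q x)) (Ψ (hyp q x)) < R} =
      {x ∈ {x | (hyp q x).1 < ρ ∧ (hyp q x).2 < ρ} | dotp (Ψ (hyp q x)) (Ψ (hyp q x)) < R} := by
    ext x; simp [and_assoc]
  refine exists_eq_Ioo ?_ (hset ▸ (H ρ hρ.1 q hq).convex_lt R) ?_ ?_ ⟨x₀, h1, h2, h3⟩
  · have hopen := isOpen_setOf_hyp_lt q ρ
    rw [hset]
    refine ContinuousOn.isOpen_inter_preimage (t := Iio R) (fun x hx => ?_) hopen isOpen_Iio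
    have hm := hyp_mem_ball hq (hx.1.trans_le hρ.2) (hx.2.trans_le hρ.2)
    have hg : ContinuousAt (fun x => Ψ (hyp q x)) x :=
      (hasDerivAt_comp_hyp (hb _ hm)).continuousAt
    exact ((hg.fst.mul hg.fst).add (hg.snd.mul hg.snd)).continuousWithinAt
  · refine ⟨-Real.log (ρ / q), fun x hx => ?_⟩
    have h : q * Real.exp (-x) < ρ := hx.2.1
    have hρ0 : 0 < ρ := lt_trans (by positivity) h
    have : -x < Real.log (ρ / q) := by
      rw [Real.lt_log_iff_exp_lt (by positivity), lt_div_iff₀ hq]; linarith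
    linarith
  · refine ⟨Real.log (ρ / q), fun x hx => ?_⟩
    have h : q * Real.exp x < ρ := hx.1
    have hρ0 : 0 < ρ := lt_trans (by positivity) h
    have : x < Real.log (ρ / q) := by
      rw [Real.lt_log_iff_exp_lt (by positivity), lt_div_iff₀ hq]; linarith
    linarith

/-! ## Diffeomorphisms of the line -/

/-- A smooth diffeomorphism of the line that preserves the order. -/
structure LineDiffeo where
  /-- The underlying order isomorphism. -/
  iso : ℝ ≃o ℝ
  smooth : ContDiff ℝ ∞ iso
  smooth_symm : ContDiff ℝ ∞ iso.symm

/-- Add to the identity a nonnegative multiple of the flat function exp(-1/(x - a)), extended by 0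
for x ≤ a. It is monotone, so the derivative is at least 1 and the inverse is smooth. -/
theorem exists_lineDiffeo_move_right {a b c : ℝ} (hab : a < b) (hbc : b ≤ c) :
    ∃ e : LineDiffeo, (∀ x ≤ a, e.iso x = x) ∧ e.iso b = c := by
  have hb : 0 < expNegInvGlue (b - a) := expNegInvGlue.pos_of_pos (sub_pos.2 hab)
  set k := (c - b) / expNegInvGlue (b - a)
  have hk : 0 ≤ k := div_nonneg (sub_nonneg.2 hbc) hb.le
  set h : ℝ → ℝ := fun x => x + k * expNegInvGlue (x - a) with hh
  have hsm : ContDiff ℝ ∞ h :=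
    contDiff_id.add (contDiff_const.mul (expNegInvGlue.contDiff.comp (contDiff_id.sub contDiff_const)))
  have hmono : Monotone fun x => k * expNegInvGlue (x - a) := fun x y hxy =>
    mul_le_mul_of_nonneg_left (expNegInvGlue.monotone (by linarith)) hk
  have hstrict : StrictMono h := strictMono_id.add_monotone hmono
  have hfix : ∀ x ≤ a, h x = x := fun x hx => by
    simp [hh, expNegInvGlue.zero_of_nonpos (sub_nonpos.2 hx)]
  have hge : ∀ x, x ≤ h x := fun x =>
    le_add_of_nonneg_right (mul_nonneg hk (expNegInvGlue.nonneg _))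
  have hsurj : Function.Surjective h := by
    refine hsm.continuous.surjective (tendsto_atTop_mono hge tendsto_id) ?_
    refine tendsto_id.congr' ?_
    filter_upwards [eventually_le_atBot a] with x hx using (hfix x hx).symm
  let e := hstrict.orderIsoOfSurjective h hsurj
  have he : ∀ x, e x = h x := fun x => rfl
  have hdiff : ∀ x, HasDerivAt h (1 + deriv (fun x => k * expNegInvGlue (x - a)) x) x := fun x => by
    refine (hasDerivAt_id x).add (DifferentiableAt.hasDerivAt ?_)
    exact ((contDiff_const.mul (expNegInvGlue.contDiff.comp
      (contDiff_id.sub contDiff_const))).differentiable (n := 1) (by simp)) x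
  have hpos : ∀ x, 1 + deriv (fun x => k * expNegInvGlue (x - a)) x ≠ 0 := fun x => by
    have := hmono.deriv_nonneg (x := x)
    positivity
  refine ⟨⟨e, hsm, e.toHomeomorph.contDiff_symm_deriv hpos hdiff hsm⟩, hfix, ?_⟩
  show b + k * expNegInvGlue (b - a) = c
  simp only [k]; field_simp; ring

theorem exists_lineDiffeo_move {a b c : ℝ} (hab : a < b) (hac : a < c) :
    ∃ e : LineDiffeo, (∀ x ≤ a, e.iso x = x) ∧ e.iso b = c := by
  rcases le_total b c with h | h
  · exact exists_lineDiffeo_move_right hab h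
  · obtain ⟨e, e1, e2⟩ := exists_lineDiffeo_move_right hac h
    refine ⟨⟨e.iso.symm, e.smooth_symm, e.smooth⟩, fun x hx => ?_, ?_⟩
    · exact (e.iso.symm_apply_eq).2 (e1 x hx).symm
    · exact (e.iso.symm_apply_eq).2 e2.symm

/-- Points are moved into place from left to right. Each later diffeomorphism fixes everything up to
the last point placed, so earlier matches survive. -/
theorem exists_lineDiffeo_map_of_lt (ys : List ℝ) : ∀ (xs : List ℝ) (a : ℝ),
    xs.length = ys.length → xs.Pairwise (· < ·) → ys.Pairwise (· < ·) → (∀ x ∈ xs, a < x) →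
    (∀ y ∈ ys, a < y) → ∃ e : LineDiffeo, (∀ x ≤ a, e.iso x = x) ∧ xs.map e.iso = ys := by
  induction ys with
  | nil =>
    intro xs a hl _ _ _ _
    have : xs = [] := List.length_eq_zero_iff.1 hl
    exact ⟨⟨OrderIso.refl ℝ, contDiff_id, contDiff_id⟩, fun x _ => rfl, by simp [this]⟩
  | cons y ys ih =>
    intro xs a hl hx hy hax hay
    obtain _ | ⟨x, xs⟩ := xs
    · simp at hl
    rw [List.pairwise_cons] at hx hy
    obtain ⟨e, e1, e2⟩ := exists_lineDiffeo_move (hax x (by simp)) (hay y (by simp))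
    obtain ⟨e', e1', e2'⟩ := ih (xs.map e.iso) y (by simpa using hl)
      (hx.2.map _ fun _ _ h => e.iso.strictMono h) hy.2
      (by
        intro z hz
        obtain ⟨w, hw, rfl⟩ := List.mem_map.1 hz
        rw [← e2]; exact e.iso.strictMono (hx.1 w hw)) hy.1
    refine ⟨⟨e.iso.trans e'.iso, e'.smooth.comp e.smooth, e.smooth_symm.comp e'.smooth_symm⟩,
      fun z hz => ?_, ?_⟩
    · show e'.iso (e.iso z) = z
      rw [e1 z hz, e1' z (hz.trans (hay y (by simp)).le)]
    · show e'.iso (e.iso x) :: xs.map (e.iso.trans e'.iso) = y :: ys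
      rw [e2, e1' y le_rfl, ← e2', List.map_map]
      rfl

theorem exists_lineDiffeo_map {xs ys : List ℝ} (hl : xs.length = ys.length)
    (hx : xs.Pairwise (· < ·)) (hy : ys.Pairwise (· < ·)) :
    ∃ e : LineDiffeo, xs.map e.iso = ys := by
  obtain ⟨a, ha⟩ : ∃ a : ℝ, ∀ z ∈ xs ++ ys, a < z := by
    obtain ⟨a, ha⟩ := ((xs ++ ys).toFinset : Set ℝ).toFinite.bddBelow
    exact ⟨a - 1, fun z hz => by linarith [ha (show z ∈ _ by simpa using hz)]⟩
  obtain ⟨e, -, he⟩ := exists_lineDiffeo_map_of_lt ys xs a hl hx hy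
    (fun x h => ha x (by simp [h])) (fun y h => ha y (by simp [h]))
  exact ⟨e, he⟩

/-- An order preserving diffeomorphism from the line to an open interval, and its inverse. -/
theorem exists_line_diffeo_Ioo {a b : ℝ} (hab : a < b) : ∃ θ l : ℝ → ℝ,
    ContDiff ℝ ∞ θ ∧ StrictMono θ ∧ (∀ x, θ x ∈ Ioo a b) ∧ ContDiffOn ℝ ∞ l (Ioo a b) ∧
    (∀ x, l (θ x) = x) ∧ ∀ y ∈ Ioo a b, θ (l y) = y := by
  have hp : ∀ x : ℝ, 0 < 1 + Real.exp x := fun x => by positivity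
  -- A logistic function; its inverse is log((y - a)/(b - y)).
  set θ : ℝ → ℝ := fun x => (a + b * Real.exp x) / (1 + Real.exp x) with hθ
  have h1 : ∀ x, θ x - a = (b - a) * Real.exp x / (1 + Real.exp x) := fun x => by
    have := (hp x).ne'
    simp only [hθ]; field_simp; ring
  have h2 : ∀ x, b - θ x = (b - a) / (1 + Real.exp x) := fun x => by
    have := (hp x).ne'
    simp only [hθ]; field_simp; ring
  have hba : 0 < b - a := sub_pos.2 hab
  have hmem : ∀ x, θ x ∈ Ioo a b := fun x =>
    ⟨sub_pos.1 (by rw [h1]; positivity), sub_pos.1 (by rw [h2]; positivity)⟩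
  refine ⟨θ, fun y => Real.log (y - a) - Real.log (b - y), ?_, ?_, hmem, ?_, ?_, ?_⟩
  · exact ContDiff.div (by fun_prop) (by fun_prop) fun x => (hp x).ne'
  · intro x y hxy
    have : b - θ y < b - θ x := by
      rw [h2, h2]
      have := Real.exp_lt_exp.2 hxy
      exact div_lt_div_of_pos_left hba (hp x) (by linarith)
    linarith
  · refine ContDiffOn.sub (ContDiffOn.log (by fun_prop) ?_) (ContDiffOn.log (by fun_prop) ?_)
    · exact fun y hy => (sub_pos.2 hy.1).ne'
    · exact fun y hy => (sub_pos.2 hy.2).ne'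
  · intro x
    beta_reduce
    rw [← Real.log_div (sub_pos.2 (hmem x).1).ne' (sub_pos.2 (hmem x).2).ne', h1, h2]
    have := (hp x).ne'
    rw [show (b - a) * Real.exp x / (1 + Real.exp x) / ((b - a) / (1 + Real.exp x)) = Real.exp x by
      field_simp, Real.log_exp]
  · intro y hy
    have i1 : 0 < y - a := sub_pos.2 hy.1
    have i2 : 0 < b - y := sub_pos.2 hy.2
    beta_reduce
    rw [← Real.log_div i1.ne' i2.ne']
    simp only [hθ]
    rw [Real.exp_log (by positivity)]
    have : 1 + (y - a) / (b - y) = (b - a) / (b - y) := by field_simp; ring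
    rw [this]
    field_simp; ring

/-! ## Curves that consist of two marked arcs -/

/-- The part of the curve `K` in the open set `U` is an embedded regular arc `γ` without singular
points, with inverse `c`, whose inflections and vertices are listed by `l`. -/
structure MarkedArc (g : Plane → ℝ) (K U : Set Plane) (γ : ℝ → Plane) (c : Plane → ℝ)
    (l : List (ℝ × Mark)) : Prop where
  isOpen : IsOpen U
  smooth : ContDiff ℝ ∞ γ
  smooth_inv : ContDiffOn ℝ ∞ c U
  range_eq : range γ = K ∩ U
  left_inv : ∀ x, c (γ x) = x
  sorted : l.Pairwise fun e e' => e.1 < e'.1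
  infl : ∀ x, IsInflection g (γ x) ↔ (x, Mark.i) ∈ l
  vert : ∀ x, IsVertex g (γ x) ↔ (x, Mark.v) ∈ l
  nonsing : ∀ x, ¬IsSingularPoint g (γ x)

namespace MarkedArc

variable {g : Plane → ℝ} {K U : Set Plane} {γ : ℝ → Plane} {c : Plane → ℝ} {l : List (ℝ × Mark)}

theorem mem (h : MarkedArc g K U γ c l) (x : ℝ) : γ x ∈ K ∩ U := h.range_eq ▸ mem_range_self x

theorem right_inv (h : MarkedArc g K U γ c l) {p : Plane} (hp : p ∈ K ∩ U) : γ (c p) = p := by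
  rw [← h.range_eq] at hp
  obtain ⟨x, rfl⟩ := hp
  rw [h.left_inv]

theorem deriv_ne_zero (h : MarkedArc g K U γ c l) (x : ℝ) : deriv γ x ≠ 0 := by
  intro h0
  have h1 : HasDerivAt γ 0 x := h0 ▸ ((h.smooth.differentiable (by simp)) x).hasDerivAt
  have h2 : DifferentiableAt ℝ c (γ x) :=
    ((h.smooth_inv.contDiffAt (h.isOpen.mem_nhds (h.mem x).2)).differentiableAt (by simp))
  have h3 := h2.hasFDerivAt.comp_hasDerivAt x h1
  have h4 : c ∘ γ = id := funext h.left_inv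
  rw [h4] at h3
  simpa using h3.unique (hasDerivAt_id x)

theorem reverse (h : MarkedArc g K U γ c l) :
    MarkedArc g K U (fun x => γ (-x)) (fun p => -c p) (l.map fun e => (-e.1, e.2)).reverse := by
  have hm : ∀ x m, (x, m) ∈ (l.map fun e => (-e.1, e.2)).reverse ↔ (-x, m) ∈ l := by
    intro x m
    simp only [List.mem_reverse, List.mem_map, Prod.mk.injEq, Prod.exists]
    constructor
    · rintro ⟨y, n, h, rfl, rfl⟩; simpa using h
    · exact fun h => ⟨-x, m, h, by simp, rfl⟩
  refine ⟨h.isOpen, h.smooth.comp contDiff_neg, h.smooth_inv.neg, ?_, fun x => ?_, ?_,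
    fun x => ?_, fun x => ?_, fun x => h.nonsing _⟩
  · rw [← h.range_eq]
    exact neg_surjective.range_comp γ
  · rw [h.left_inv, neg_neg]
  · rw [List.pairwise_reverse, List.pairwise_map]
    exact h.sorted.imp fun h => neg_lt_neg h
  · rw [hm]; exact h.infl _
  · rw [hm]; exact h.vert _

theorem hasWord (h : MarkedArc g K U γ c l) : HasWord g (K ∩ U) (l.map Prod.snd) := by
  obtain ⟨θ, L, h1, h2, h3, h4, h5, h6⟩ := exists_line_diffeo_Ioo (zero_lt_one (α := ℝ))
  have hlen : (l.map Prod.snd).length = l.length := List.length_map _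
  have hγL : ContDiffOn ℝ ∞ (γ ∘ L) (Ioo 0 1) := h.smooth.comp_contDiffOn h4
  have hin : ∀ m, ∀ u ∈ Ioo (0 : ℝ) 1, (L u, m) ∈ l ↔
      ∃ j : Fin (l.map Prod.snd).length, θ (l.get (j.cast hlen)).1 = u ∧
        (l.map Prod.snd).get j = m := by
    intro m u hu
    rw [List.mem_iff_get]
    constructor
    · rintro ⟨j, hj⟩
      refine ⟨j.cast hlen.symm, ?_, ?_⟩
      · simp only [Fin.cast_cast, Fin.cast_eq_self, hj, h6 u hu]
      · have : (l.get j).2 = m := by rw [hj]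
        simpa using this
    · rintro ⟨j, hj, hm⟩
      refine ⟨j.cast hlen, Prod.ext ?_ ?_⟩
      · rw [← hj, h5]
      · simpa using hm
  refine ⟨γ ∘ L, fun j => θ (l.get (j.cast hlen)).1, hγL, fun u hu => ?_, fun u hu v hv huv => ?_,
    ?_, fun i j hij => ?_, fun j => h3 _, fun u hu => ⟨?_, ?_⟩⟩
  · intro h0
    have hd : DifferentiableAt ℝ (γ ∘ L) u :=
      (hγL.contDiffAt (isOpen_Ioo.mem_nhds hu)).differentiableAt (by simp)
    have d1 : HasDerivAt (γ ∘ L) 0 (θ (L u)) := by rw [h6 u hu, ← h0]; exact hd.hasDerivAt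
    have d2 : DifferentiableAt ℝ θ (L u) := (h1.differentiable (by simp)) _
    have d3 := d1.scomp (L u) d2.hasDerivAt
    have e : (γ ∘ L) ∘ θ = γ := funext fun x => by simp [h5]
    rw [e] at d3
    exact h.deriv_ne_zero _ (by simpa using d3.deriv)
  · have := congrArg c huv
    simp only [Function.comp_apply, h.left_inv] at this
    rw [← h6 u hu, ← h6 v hv, this]
  · rw [← h.range_eq]
    ext p
    constructor
    · rintro ⟨u, -, rfl⟩; exact mem_range_self _
    · rintro ⟨x, rfl⟩; exact ⟨θ x, h3 x, by simp [h5]⟩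
  · refine h2 ?_
    exact List.pairwise_iff_get.1 h.sorted _ _ (by simpa using hij)
  · rw [← hin _ u hu]; exact h.infl _
  · rw [← hin _ u hu]; exact h.vert _

end MarkedArc

/-- The curve `g = 0` in the disc of radius `ε` consists of two marked arcs with the words `w₁`
and `w₂`. -/
def HasArcs (g : Plane → ℝ) (ε : ℝ) (w₁ w₂ : List Mark) : Prop :=
  ∃ U₁ U₂ : Set Plane, Disjoint U₁ U₂ ∧ curve g ε ⊆ U₁ ∪ U₂ ∧
    (∃ γ c l, MarkedArc g (curve g ε) U₁ γ c l ∧ l.map Prod.snd = w₁) ∧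
    ∃ γ c l, MarkedArc g (curve g ε) U₂ γ c l ∧ l.map Prod.snd = w₂

namespace HasArcs

variable {g g' : Plane → ℝ} {ε : ℝ} {w₁ w₂ : List Mark}

theorem swap (h : HasArcs g ε w₁ w₂) : HasArcs g ε w₂ w₁ := by
  obtain ⟨U₁, U₂, hd, hc, h1, h2⟩ := h
  exact ⟨U₂, U₁, hd.symm, by rwa [union_comm], h2, h1⟩

theorem reverse_left (h : HasArcs g ε w₁ w₂) : HasArcs g ε w₁.reverse w₂ := by
  obtain ⟨U₁, U₂, hd, hc, ⟨γ, c, l, h1, rfl⟩, h2⟩ := h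
  refine ⟨U₁, U₂, hd, hc, ⟨_, _, _, h1.reverse, ?_⟩, h2⟩
  simp [List.map_reverse, Function.comp_def]

theorem reverse_right (h : HasArcs g ε w₁ w₂) : HasArcs g ε w₁ w₂.reverse :=
  h.swap.reverse_left.swap

/-- Each arc is connected as an image of the line, and the disjoint open sets U₁, U₂ separate the
two arcs; hence the arcs are exactly the components. -/
theorem hasConfiguration (h : HasArcs g ε w₁ w₂) : HasConfiguration g ε w₁ w₂ := by
  obtain ⟨U₁, U₂, hd, hc, ⟨γ₁, c₁, l₁, h1, rfl⟩, γ₂, c₂, l₂, h2, rfl⟩ := h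
  have key : ∀ {V W : Set Plane} {γ c l}, Disjoint V W → curve g ε ⊆ V ∪ W → IsOpen W →
      MarkedArc g (curve g ε) V γ c l →
      connectedComponentIn (curve g ε) (γ 0) = curve g ε ∩ V := by
    intro V W γ c l hVW hcov hW h
    refine Subset.antisymm (subset_inter (connectedComponentIn_subset _ _) ?_) ?_
    · exact isPreconnected_connectedComponentIn.subset_left_of_subset_union h.isOpen hW hVW
        ((connectedComponentIn_subset _ _).trans hcov)
        ⟨γ 0, mem_connectedComponentIn (h.mem 0).1, (h.mem 0).2⟩
    · rw [← h.range_eq]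
      refine (isPreconnected_range h.smooth.continuous).subset_connectedComponentIn
        (mem_range_self 0) ?_
      rw [h.range_eq]; exact inter_subset_left
  have k1 := key hd hc h2.isOpen h1
  have k2 := key hd.symm (by rwa [union_comm]) h1.isOpen h2
  refine ⟨γ₁ 0, (h1.mem 0).1, γ₂ 0, (h2.mem 0).1, ?_, ?_, k1 ▸ h1.hasWord, k2 ▸ h2.hasWord⟩
  · rw [k1, k2]
    intro e
    have := h1.mem 0
    rw [e] at this
    exact disjoint_left.1 hd (h1.mem 0).2 this.2
  · rw [k1, k2, ← inter_union_distrib_left, inter_eq_left.2 hc]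

/-- On each arc the diffeomorphism is γ' ∘ d ∘ c, where d is a diffeomorphism of the line matching
the marks. Since U₁ and U₂ are disjoint and open, the two formulas glue to a smooth map on their
union. -/
theorem sameGeometry (h : HasArcs g ε w₁ w₂) (h' : HasArcs g' ε w₁ w₂) :
    SameGeometry ε g g' := by
  classical
  obtain ⟨U₁, U₂, hd, hc, ⟨γ₁, c₁, l₁, h1, e1⟩, γ₂, c₂, l₂, h2, e2⟩ := h
  obtain ⟨U₁', U₂', hd', hc', ⟨γ₁', c₁', l₁', h1', e1'⟩, γ₂', c₂', l₂', h2', e2'⟩ := h'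
  have hmap : ∀ {l l' : List (ℝ × Mark)}, l.Pairwise (fun e e' => e.1 < e'.1) →
      l'.Pairwise (fun e e' => e.1 < e'.1) → l.map Prod.snd = l'.map Prod.snd →
      ∃ e : LineDiffeo, ∀ x m, (x, m) ∈ l ↔ (e.iso x, m) ∈ l' := by
    intro l l' hl hl' hs
    obtain ⟨e, he⟩ := exists_lineDiffeo_map (xs := l.map Prod.fst) (ys := l'.map Prod.fst)
      (by simpa using congrArg List.length hs) (List.pairwise_map.2 hl) (List.pairwise_map.2 hl')
    have : l.map (fun z => (e.iso z.1, z.2)) = l' := by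
      have hlen : l.length = l'.length := by simpa using congrArg List.length hs
      refine List.ext_getElem (by simpa using hlen) fun n i1 i2 => ?_
      have j1 : n < l.length := by simpa using i1
      have f1 : e.iso (l[n]).1 = (l'[n]).1 := by
        have := List.getElem_of_eq he (i := n) (by simpa using j1)
        simpa using this
      have f2 : (l[n]).2 = (l'[n]).2 := by
        have := List.getElem_of_eq hs (i := n) (by simpa using j1)
        simpa using this
      simp only [List.getElem_map]
      exact Prod.ext f1 f2
    refine ⟨e, fun x m => ?_⟩
    rw [← this, List.mem_map]
    constructor
    · exact fun h => ⟨_, h, rfl⟩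
    · rintro ⟨⟨y, n⟩, h, h2⟩
      simp only [Prod.mk.injEq, EmbeddingLike.apply_eq_iff_eq] at h2
      rwa [← h2.1, ← h2.2]
  obtain ⟨d₁, hd₁⟩ := hmap h1.sorted h1'.sorted (e1.trans e1'.symm)
  obtain ⟨d₂, hd₂⟩ := hmap h2.sorted h2'.sorted (e2.trans e2'.symm)
  have smooth : ∀ {V₁ V₂ : Set Plane} {a₁ a₂ : Plane → Plane}, IsOpen V₁ → IsOpen V₂ →
      Disjoint V₁ V₂ → ContDiffOn ℝ ∞ a₁ V₁ → ContDiffOn ℝ ∞ a₂ V₂ →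
      ContDiffOn ℝ ∞ (fun p => if p ∈ V₁ then a₁ p else a₂ p) (V₁ ∪ V₂) := by
    intro V₁ V₂ a₁ a₂ o1 o2 hV s1 s2
    refine ContDiffOn.union_of_isOpen (s1.congr fun p hp => if_pos hp)
      (s2.congr fun p hp => if_neg (disjoint_right.1 hV hp)) o1 o2
  have s1 := smooth h1.isOpen h2.isOpen hd
    ((h1'.smooth.comp d₁.smooth).comp_contDiffOn h1.smooth_inv)
    ((h2'.smooth.comp d₂.smooth).comp_contDiffOn h2.smooth_inv)
  have s2 := smooth h1'.isOpen h2'.isOpen hd'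
    ((h1.smooth.comp d₁.smooth_symm).comp_contDiffOn h1'.smooth_inv)
    ((h2.smooth.comp d₂.smooth_symm).comp_contDiffOn h2'.smooth_inv)
  set Φ : Plane → Plane := fun p =>
    if p ∈ U₁ then ((γ₁' ∘ d₁.iso) ∘ c₁) p else ((γ₂' ∘ d₂.iso) ∘ c₂) p
  set Ψ : Plane → Plane := fun p =>
    if p ∈ U₁' then ((γ₁ ∘ d₁.iso.symm) ∘ c₁') p else ((γ₂ ∘ d₂.iso.symm) ∘ c₂') p
  have Φ₁ : ∀ x, Φ (γ₁ x) = γ₁' (d₁.iso x) := fun x => by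
    simp [Φ, (h1.mem x).2, h1.left_inv]
  have Φ₂ : ∀ x, Φ (γ₂ x) = γ₂' (d₂.iso x) := fun x => by
    simp [Φ, disjoint_right.1 hd (h2.mem x).2, h2.left_inv]
  have Ψ₁ : ∀ x, Ψ (γ₁' x) = γ₁ (d₁.iso.symm x) := fun x => by
    simp [Ψ, (h1'.mem x).2, h1'.left_inv]
  have Ψ₂ : ∀ x, Ψ (γ₂' x) = γ₂ (d₂.iso.symm x) := fun x => by
    simp [Ψ, disjoint_right.1 hd' (h2'.mem x).2, h2'.left_inv]
  have cases : ∀ {P : Plane → Prop}, (∀ x, P (γ₁ x)) → (∀ x, P (γ₂ x)) →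
      ∀ p ∈ curve g ε, P p := by
    intro P a b p hp
    rcases hc hp with h | h
    · rw [← h1.right_inv ⟨hp, h⟩]; exact a _
    · rw [← h2.right_inv ⟨hp, h⟩]; exact b _
  have cases' : ∀ {P : Plane → Prop}, (∀ x, P (γ₁' x)) → (∀ x, P (γ₂' x)) →
      ∀ p ∈ curve g' ε, P p := by
    intro P a b p hp
    rcases hc' hp with h | h
    · rw [← h1'.right_inv ⟨hp, h⟩]; exact a _
    · rw [← h2'.right_inv ⟨hp, h⟩]; exact b _
  refine ⟨Φ, Ψ, U₁ ∪ U₂, U₁' ∪ U₂', h1.isOpen.union h2.isOpen, hc, s1,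
    h1'.isOpen.union h2'.isOpen, hc', s2, cases ?_ ?_, cases' ?_ ?_, cases ?_ ?_, cases' ?_ ?_,
    cases ?_ ?_⟩
  · intro x; rw [Φ₁]; exact (h1'.mem _).1
  · intro x; rw [Φ₂]; exact (h2'.mem _).1
  · intro x; rw [Ψ₁]; exact (h1.mem _).1
  · intro x; rw [Ψ₂]; exact (h2.mem _).1
  · intro x; rw [Φ₁, Ψ₁, OrderIso.symm_apply_apply]
  · intro x; rw [Φ₂, Ψ₂, OrderIso.symm_apply_apply]
  · intro x; rw [Ψ₁, Φ₁, OrderIso.apply_symm_apply]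
  · intro x; rw [Ψ₂, Φ₂, OrderIso.apply_symm_apply]
  · intro x
    rw [Φ₁]
    exact ⟨iff_of_false (h1.nonsing _) (h1'.nonsing _),
      (h1.infl x).trans ((hd₁ x _).trans (h1'.infl _).symm),
      (h1.vert x).trans ((hd₁ x _).trans (h1'.vert _).symm)⟩
  · intro x
    rw [Φ₂]
    exact ⟨iff_of_false (h2.nonsing _) (h2'.nonsing _),
      (h2.infl x).trans ((hd₂ x _).trans (h2'.infl _).symm),
      (h2.vert x).trans ((hd₂ x _).trans (h2'.vert _).symm)⟩

end HasArcs

/-- The interval is stretched to the whole line. The open set must shrink to the points where c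
takes values in the interval, because the inverse stretching is smooth only there. -/
theorem exists_markedArc_of_Ioo {g : Plane → ℝ} {K U : Set Plane} {γ : ℝ → Plane} {c : Plane → ℝ}
    {l : List (ℝ × Mark)} {a b : ℝ} (hab : a < b) (hU : IsOpen U)
    (hγ : ContDiffOn ℝ ∞ γ (Ioo a b)) (hc : ContDiffOn ℝ ∞ c U) (him : γ '' Ioo a b = K ∩ U)
    (hinv : ∀ x ∈ Ioo a b, c (γ x) = x) (hl : l.Pairwise fun e e' => e.1 < e'.1)
    (hlab : ∀ e ∈ l, e.1 ∈ Ioo a b)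
    (hi : ∀ x ∈ Ioo a b, IsInflection g (γ x) ↔ (x, Mark.i) ∈ l)
    (hv : ∀ x ∈ Ioo a b, IsVertex g (γ x) ↔ (x, Mark.v) ∈ l)
    (hs : ∀ x ∈ Ioo a b, ¬IsSingularPoint g (γ x)) :
    ∃ V ⊆ U, K ∩ U ⊆ V ∧ ∃ γ' c' l', MarkedArc g K V γ' c' l' ∧
      l'.map Prod.snd = l.map Prod.snd := by
  obtain ⟨θ, L, h1, h2, h3, h4, h5, h6⟩ := exists_line_diffeo_Ioo hab
  have hKU : K ∩ U = K ∩ (U ∩ c ⁻¹' Ioo a b) := by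
    refine Subset.antisymm (fun p hp => ⟨hp.1, hp.2, ?_⟩) (by gcongr; exact inter_subset_left)
    rw [← him] at hp
    obtain ⟨x, hx, rfl⟩ := hp
    rwa [mem_preimage, hinv x hx]
  have hmem : ∀ x m, (x, m) ∈ l.map (fun e => (L e.1, e.2)) ↔ (θ x, m) ∈ l := by
    intro x m
    simp only [List.mem_map, Prod.mk.injEq, Prod.exists]
    constructor
    · rintro ⟨y, n, h, rfl, rfl⟩; rwa [h6 y (hlab _ h)]
    · exact fun h => ⟨_, _, h, h5 x, rfl⟩
  refine ⟨U ∩ c ⁻¹' Ioo a b, inter_subset_left, fun p hp => (hKU ▸ hp).2, γ ∘ θ, L ∘ c,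
    l.map (fun e => (L e.1, e.2)), ⟨hc.continuousOn.isOpen_inter_preimage hU isOpen_Ioo, ?_,
      h4.comp (hc.mono inter_subset_left) fun p hp => hp.2, ?_, fun x => ?_, ?_, fun x => ?_,
      fun x => ?_, fun x => hs _ (h3 x)⟩, by simp [Function.comp_def]⟩
  · rw [← contDiffOn_univ]; exact hγ.comp h1.contDiffOn fun x _ => h3 x
  · rw [← hKU, ← him]
    ext p
    constructor
    · rintro ⟨x, rfl⟩; exact ⟨θ x, h3 x, rfl⟩
    · rintro ⟨x, hx, rfl⟩; exact ⟨L x, by simp [h6 x hx]⟩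
  · simp [hinv _ (h3 x), h5]
  · rw [List.pairwise_map]
    refine hl.imp_of_mem fun {e e'} he he' h => ?_
    rw [← h2.lt_iff_lt, h6 _ (hlab _ he), h6 _ (hlab _ he')]
    exact h
  · rw [hmem]; exact hi _ (h3 x)
  · rw [hmem]; exact hv _ (h3 x)

/-! ## Charts in which the curves of a family are hyperbolas -/

/-- In the chart `Φ` the curve `F_s = 0` is the hyperbola `u v = s`; the function `c` recovers the
first coordinate of the chart. -/
structure HypChart (F : Plane × ℝ → ℝ) (Φ : ℝ × ℝ → Plane) (c : Plane → ℝ) : Prop where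
  family : SmoothGermAt F 0
  smooth : SmoothGermAt Φ 0
  map_zero : Φ 0 = 0
  smooth_inv : SmoothGermAt c 0
  inv : ∀ᶠ z in 𝓝 0, c (Φ z) = z.1
  level : ∀ᶠ z in 𝓝 (0 : ℝ × ℝ), F (Φ z, z.1 * z.2) = 0
  regular : ∀ᶠ z in 𝓝 (0 : ℝ × ℝ), z.1 * z.2 ≠ 0 →
    fderiv ℝ (fun p => F (p, z.1 * z.2)) (Φ z) ≠ 0
  covers : ∀ N ∈ 𝓝 (0 : ℝ × ℝ), ∀ᶠ w in 𝓝 (0 : Plane × ℝ), F w = 0 →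
    ∃ z ∈ N, z.1 * z.2 = w.2 ∧ Φ z = w.1

/-- The part of the plane where the sign of the function `c` is `σ`. -/
def side (c : Plane → ℝ) (σ : ℝ) : Set Plane :=
  interior {p | ContDiffAt ℝ ∞ c p} ∩ {p | 0 < σ * c p}

theorem contDiffAt_of_mem_interior {c : Plane → ℝ} {p : Plane}
    (hp : p ∈ interior {p | ContDiffAt ℝ ∞ c p}) : ContDiffAt ℝ ∞ c p := by
  simpa only [mem_ofPred_eq] using interior_subset hp

theorem contDiffOn_side (c : Plane → ℝ) (σ : ℝ) : ContDiffOn ℝ ∞ c (side c σ) :=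
  fun _ hp => (contDiffAt_of_mem_interior hp.1).contDiffWithinAt

theorem isOpen_side (c : Plane → ℝ) (σ : ℝ) : IsOpen (side c σ) := by
  have h : ContinuousOn (fun p => σ * c p) (interior {p | ContDiffAt ℝ ∞ c p}) := fun p hp =>
    (continuousAt_const.mul (contDiffAt_of_mem_interior hp).continuousAt).continuousWithinAt
  exact h.isOpen_inter_preimage isOpen_interior isOpen_Ioi

theorem disjoint_side (c : Plane → ℝ) : Disjoint (side c 1) (side c (-1)) := by
  refine disjoint_left.2 fun p h1 h2 => ?_
  have h1 := h1.2
  have h2 := h2.2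
  simp only [mem_ofPred_eq] at h1 h2
  linarith

theorem curve_subset_ball {g : Plane → ℝ} {ε : ℝ} (hε : 0 < ε) {p : Plane} (hp : p ∈ curve g ε) :
    ‖p‖ < ε := by
  rw [Prod.norm_def]
  have := hp.1
  refine max_lt ?_ ?_
  · exact abs_lt_of_sq_lt_sq (by nlinarith [sq_nonneg p.2]) hε.le
  · exact abs_lt_of_sq_lt_sq (by nlinarith [sq_nonneg p.1]) hε.le

theorem HypChart.exists_covers {F : Plane × ℝ → ℝ} {Φ : ℝ × ℝ → Plane} {c : Plane → ℝ}
    (h : HypChart F Φ c) {N : Set (ℝ × ℝ)} (hN : N ∈ 𝓝 0) :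
    ∃ ε₀ > 0, ∀ ε : ℝ, 0 < ε → ε < ε₀ → ∀ s : ℝ, |s| < ε₀ →
      ∀ p ∈ curve (fun p => F (p, s)) ε, p ∈ interior {p | ContDiffAt ℝ ∞ c p} ∧
        ∃ z ∈ N, z.1 * z.2 = s ∧ Φ z = p ∧ c p = z.1 := by
  have h1 : interior {p | ContDiffAt ℝ ∞ c p} ∈ 𝓝 (0 : Plane) := interior_mem_nhds.2 h.smooth_inv
  obtain ⟨r, hr, hb⟩ := Metric.mem_nhds_iff.1 h1
  obtain ⟨r', hr', hb'⟩ := Metric.eventually_nhds_iff_ball.1 (h.covers _ (inter_mem hN h.inv))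
  refine ⟨min r r', lt_min hr hr', fun ε hε hε0 s hs p hp => ?_⟩
  have hpn := curve_subset_ball hε hp
  rw [lt_min_iff] at hε0 hs
  refine ⟨hb (mem_ball_zero_iff.2 (hpn.trans hε0.1)), ?_⟩
  have hm : (p, s) ∈ Metric.ball (0 : Plane × ℝ) r' := by
    rw [mem_ball_zero_iff, Prod.norm_def]
    exact max_lt (hpn.trans hε0.2) hs.2
  obtain ⟨z, hz, e1, e2⟩ := hb' _ hm hp.2
  dsimp only at e2
  exact ⟨z, hz.1, e1, e2, by rw [← e2]; exact hz.2⟩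

/-- On the hyperbola uv = s with s ≠ 0 the first coordinate never vanishes, so its sign separates
the two branches. -/
theorem HypChart.curve_subset_side {F : Plane × ℝ → ℝ} {Φ : ℝ × ℝ → Plane} {c : Plane → ℝ}
    (h : HypChart F Φ c) : ∃ ε₀ > 0, ∀ ε : ℝ, 0 < ε → ε < ε₀ → ∀ s : ℝ, |s| < ε₀ → s ≠ 0 →
      curve (fun p => F (p, s)) ε ⊆ side c 1 ∪ side c (-1) := by
  obtain ⟨ε₀, hε₀, H⟩ := h.exists_covers univ_mem
  refine ⟨ε₀, hε₀, fun ε h1 h2 s hs hs0 p hp => ?_⟩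
  obtain ⟨hi, z, -, e1, e2, e3⟩ := H ε h1 h2 s hs p hp
  have hz : z.1 ≠ 0 := left_ne_zero_of_mul (e1 ▸ hs0)
  rcases lt_or_gt_of_ne hz with hz | hz
  · right; exact ⟨hi, by simp only [mem_ofPred_eq, e3]; linarith⟩
  · left; exact ⟨hi, by simp only [mem_ofPred_eq, e3]; linarith⟩

/-! ### The arc in a given quadrant of the chart -/

theorem reflect_branch (α : ℝ → Plane) (σ : ℝ) :
    cross (deriv (fun t => α (σ * t)) 0) (deriv (deriv (fun t => α (σ * t))) 0) =
      σ ^ 3 * cross (deriv α 0) (deriv (deriv α) 0) ∧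
    vertNum (deriv (fun t => α (σ * t)) 0) (deriv (deriv (fun t => α (σ * t))) 0)
      (deriv (deriv (deriv (fun t => α (σ * t)))) 0) =
      σ ^ 6 * vertNum (deriv α 0) (deriv (deriv α) 0) (deriv (deriv (deriv α)) 0) := by
  have h : ∀ β : ℝ → Plane, deriv (fun t => β (σ * t)) = fun t => σ • deriv β (σ * t) :=
    fun β => funext fun t => deriv_comp_mul_left σ β t
  have h' : ∀ β : ℝ → Plane, deriv (fun t => σ • β t) = fun t => σ • deriv β t :=
    fun β => funext fun t => deriv_fun_const_smul_field σ β
  rw [h α, h', h (deriv α), h', h', h (deriv (deriv α))]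
  simp only [mul_zero, cross, vertNum, dotp, Prod.smul_fst, Prod.smul_snd, smul_eq_mul]
  constructor <;> ring

/-- Reflecting the chart to Ψ(u, v) = Φ(σu, τv) moves any quadrant to the positive one, where
`arc_word` applies; the arc there belongs to the parameter s = στq². -/
theorem HypChart.exists_arc {F : Plane × ℝ → ℝ} {Φ : ℝ × ℝ → Plane} {c : Plane → ℝ}
    (h : HypChart F Φ c) {a b a' b' d : ℝ}
    (hd : cross (fderiv ℝ Φ 0 (1, 0)) (fderiv ℝ Φ 0 (0, 1)) = d) (hd0 : d ≠ 0)
    (ha : cross (deriv (fun t => Φ (t, 0)) 0) (deriv (deriv (fun t => Φ (t, 0))) 0) = a)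
    (ha0 : a ≠ 0)
    (hb : vertNum (deriv (fun t => Φ (t, 0)) 0) (deriv (deriv (fun t => Φ (t, 0))) 0)
        (deriv (deriv (deriv (fun t => Φ (t, 0)))) 0) = b) (hb0 : b ≠ 0)
    (ha' : cross (deriv (fun t => Φ (0, t)) 0) (deriv (deriv (fun t => Φ (0, t))) 0) = a')
    (ha'0 : a' ≠ 0)
    (hb' : vertNum (deriv (fun t => Φ (0, t)) 0) (deriv (deriv (fun t => Φ (0, t))) 0)
        (deriv (deriv (deriv (fun t => Φ (0, t)))) 0) = b') (hb'0 : b' ≠ 0)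
    {σ τ : ℝ} (hσ : σ = 1 ∨ σ = -1) (hτ : τ = 1 ∨ τ = -1) :
    ∃ ε₀ > 0, ∀ ε : ℝ, 0 < ε → ε < ε₀ → ∀ᶠ q in 𝓝[>] (0 : ℝ), ∃ U ⊆ side c σ,
      curve (fun p => F (p, σ * τ * q ^ 2)) ε ∩ side c σ ⊆ U ∧ ∃ γ e l,
        MarkedArc (fun p => F (p, σ * τ * q ^ 2)) (curve (fun p => F (p, σ * τ * q ^ 2)) ε) U γ e l ∧
        l.map Prod.snd = (halfWord (-(σ * (a' * d))) (-(σ * τ * (b' * d)))).reverse ++ [Mark.v] ++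
          halfWord (τ * (a * d)) (σ * τ * (b * d)) := by
  have hσσ : σ * σ = 1 := by rcases hσ with rfl | rfl <;> norm_num
  have hττ : τ * τ = 1 := by rcases hτ with rfl | rfl <;> norm_num
  have hσ0 : σ ≠ 0 := left_ne_zero_of_mul (hσσ ▸ one_ne_zero)
  have hτ0 : τ ≠ 0 := left_ne_zero_of_mul (hττ ▸ one_ne_zero)
  set Ψ : ℝ × ℝ → Plane := fun z => Φ (σ * z.1, τ * z.2) with hΨdef
  have sr : SmoothGermAt (fun z : ℝ × ℝ => (σ * z.1, τ * z.2)) 0 :=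
    ContDiff.smoothGermAt (by fun_prop) 0
  have r0 : (σ * (0 : ℝ × ℝ).1, τ * (0 : ℝ × ℝ).2) = 0 := by simp
  have tr : Tendsto (fun z : ℝ × ℝ => (σ * z.1, τ * z.2)) (𝓝 0) (𝓝 0) :=
    Continuous.tendsto' (by fun_prop) _ _ r0
  have hΨ : SmoothGermAt Ψ 0 := h.smooth.comp_of_eq sr r0
  have hΨ0 : Ψ 0 = 0 := by simp only [hΨdef, r0]; exact h.map_zero
  have hfd : ∀ v : ℝ × ℝ, fderiv ℝ Ψ 0 v = fderiv ℝ Φ 0 (σ * v.1, τ * v.2) := by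
    intro v
    have h1 : HasFDerivAt (fun y : ℝ × ℝ => (σ * y.1, τ * y.2))
        ((σ • ContinuousLinearMap.fst ℝ ℝ ℝ).prod (τ • ContinuousLinearMap.snd ℝ ℝ ℝ)) 0 :=
      (hasFDerivAt_fst.const_mul σ).prodMk (hasFDerivAt_snd.const_mul τ)
    have h2 : HasFDerivAt Φ (fderiv ℝ Φ 0) (σ * (0 : ℝ × ℝ).1, τ * (0 : ℝ × ℝ).2) := by
      rw [r0]; exact h.smooth.hasFDerivAt
    have e : fderiv ℝ Ψ 0 = _ := (HasFDerivAt.comp (g := Φ) 0 h2 h1).fderiv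
    rw [e]; rfl
  have hdΨ : cross (fderiv ℝ Ψ 0 (1, 0)) (fderiv ℝ Ψ 0 (0, 1)) = σ * τ * d := by
    have e1 : (σ * 1, τ * 0) = σ • ((1 : ℝ), (0 : ℝ)) := by simp
    have e2 : (σ * 0, τ * 1) = τ • ((0 : ℝ), (1 : ℝ)) := by simp
    rw [hfd, hfd]
    dsimp only
    rw [e1, e2, map_smul, map_smul, ← hd]
    simp only [cross, Prod.smul_fst, Prod.smul_snd, smul_eq_mul]; ring
  have hdΨ0 : σ * τ * d ≠ 0 := mul_ne_zero (mul_ne_zero hσ0 hτ0) hd0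
  have bu : (fun t => Ψ (t, 0)) = fun t => (fun t => Φ (t, 0)) (σ * t) := by
    funext t; simp [hΨdef]
  have bv : (fun t => Ψ (0, t)) = fun t => (fun t => Φ (0, t)) (τ * t) := by
    funext t; simp [hΨdef]
  obtain ⟨eu1, eu2⟩ := reflect_branch (fun t => Φ (t, 0)) σ
  obtain ⟨ev1, ev2⟩ := reflect_branch (fun t => Φ (0, t)) τ
  rw [← bu, ha] at eu1
  rw [← bu, hb] at eu2
  rw [← bv, ha'] at ev1
  rw [← bv, hb'] at ev2
  obtain ⟨ρ₁, hρ₁, H₁⟩ := arc_word hΨ hΨ0 hdΨ hdΨ0 eu1 (mul_ne_zero (pow_ne_zero _ hσ0) ha0)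
    eu2 (mul_ne_zero (pow_ne_zero _ hσ0) hb0) ev1 (mul_ne_zero (pow_ne_zero _ hτ0) ha'0)
    ev2 (mul_ne_zero (pow_ne_zero _ hτ0) hb'0)
  obtain ⟨ρ₂, hρ₂, H₂⟩ := arc_domain hΨ hΨ0 (hdΨ ▸ hdΨ0)
  have tF : Tendsto (fun z : ℝ × ℝ => (Ψ z, σ * τ * (z.1 * z.2))) (𝓝 0) (𝓝 0) := by
    have : Tendsto (fun z : ℝ × ℝ => σ * τ * (z.1 * z.2)) (𝓝 0) (𝓝 0) :=
      Continuous.tendsto' (by fun_prop) _ _ (by simp)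
    have h2 := hΨ.continuousAt.tendsto
    rw [hΨ0] at h2
    exact h2.prodMk_nhds this
  have tΨ : Tendsto Ψ (𝓝 0) (𝓝 0) := by simpa [hΨ0] using hΨ.continuousAt.tendsto
  have good : ∀ᶠ z in 𝓝 (0 : ℝ × ℝ), (SmoothGermAt Ψ z ∧ SmoothGermAt (eul Ψ) z ∧
      SmoothGermAt (eul (eul Ψ)) z) ∧ c (Ψ z) = σ * z.1 ∧ F (Ψ z, σ * τ * (z.1 * z.2)) = 0 ∧
      (z.1 * z.2 ≠ 0 → fderiv ℝ (fun p => F (p, σ * τ * (z.1 * z.2))) (Ψ z) ≠ 0) ∧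
      SmoothGermAt F (Ψ z, σ * τ * (z.1 * z.2)) ∧
      Ψ z ∈ interior {p | ContDiffAt ℝ ∞ c p} := by
    filter_upwards [hΨ.eventually, hΨ.eul.eventually, hΨ.eul.eul.eventually, tr.eventually h.inv,
      tr.eventually h.level, tr.eventually h.regular, tF.eventually h.family.eventually,
      tΨ.eventually (interior_mem_nhds.2 h.smooth_inv)] with z g1 g2 g3 g4 g5 g6 g7 g8
    have e : σ * τ * (z.1 * z.2) = σ * z.1 * (τ * z.2) := by ring
    rw [e] at g7 ⊢
    refine ⟨⟨g1, g2, g3⟩, g4, g5, fun h0 => g6 ?_, g7, g8⟩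
    rw [← e]
    exact mul_ne_zero (mul_ne_zero hσ0 hτ0) h0
  obtain ⟨η, hη, G⟩ := Metric.eventually_nhds_iff_ball.1 good
  obtain ⟨ρ, hρ, l1, l2, l3⟩ : ∃ ρ > 0, ρ ≤ ρ₁ ∧ ρ ≤ ρ₂ ∧ ρ ≤ η :=
    ⟨min ρ₁ (min ρ₂ η), by positivity, by simp, by simp, by simp⟩
  -- Order of choices: the box size ρ is fixed first, ε₀ makes every small curve lie in the image of
  -- the ρ-box, ρ' is chosen after ε, and q last.
  obtain ⟨ε₀, hε₀, C⟩ := h.exists_covers (Metric.ball_mem_nhds (0 : ℝ × ℝ) hρ)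
  refine ⟨ε₀, hε₀, fun ε hε hεε₀ => ?_⟩
  obtain ⟨ρ', hρ', hρρ, B⟩ : ∃ ρ' > 0, ρ' ≤ ρ ∧ ∀ z ∈ Metric.ball (0 : ℝ × ℝ) ρ',
      dotp (Ψ z) (Ψ z) < ε ^ 2 := by
    have h1 : ∀ᶠ z in 𝓝 (0 : ℝ × ℝ), dotp (Ψ z) (Ψ z) < ε ^ 2 := by
      refine (hΨ.dotp hΨ).continuousAt.eventually (gt_mem_nhds ?_)
      beta_reduce
      rw [hΨ0]
      simp only [dotp, Prod.fst_zero, Prod.snd_zero, mul_zero, add_zero]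
      positivity
    obtain ⟨r, hr, hb⟩ := Metric.eventually_nhds_iff_ball.1 h1
    exact ⟨min r ρ, by positivity, min_le_right _ _, fun z hz =>
      hb z (Metric.ball_subset_ball (min_le_left _ _) hz)⟩
  have tq : Tendsto (fun q : ℝ => |σ * τ * q ^ 2|) (𝓝[>] 0) (𝓝 0) :=
    (Continuous.tendsto' (by fun_prop) _ _ (by simp)).mono_left nhdsWithin_le_nhds
  filter_upwards [self_mem_nhdsWithin, tq.eventually (gt_mem_nhds hε₀),
    nhdsWithin_le_nhds (gt_mem_nhds hρ'), H₁ ρ hρ l1 ρ' hρ' hρρ] with q hq hqs hqρ ⟨l, wl, L⟩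
  have hq : 0 < q := hq
  have hy1 : ∀ x, 0 < (hyp q x).1 := fun x => by simp only [hyp]; positivity
  have hyρ : ∀ x, (hyp q x).1 < ρ → (hyp q x).2 < ρ → hyp q x ∈ Metric.ball (0 : ℝ × ℝ) η :=
    fun x h1 h2 => hyp_mem_ball hq (h1.trans_le l3) (h2.trans_le l3)
  obtain ⟨α, β, hαβ, D⟩ := H₂ ρ l2 q hq (ε ^ 2) 0 (by simpa [hyp] using hqρ.trans_le hρρ)
    (by simpa [hyp] using hqρ.trans_le hρρ)
    (B _ (hyp_mem_ball hq (by simpa [hyp] using hqρ) (by simpa [hyp] using hqρ)))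
  have hD : ∀ x, x ∈ Ioo α β ↔ (hyp q x).1 < ρ ∧ (hyp q x).2 < ρ ∧
      dotp (Ψ (hyp q x)) (Ψ (hyp q x)) < ε ^ 2 := fun x => by rw [← D, mem_ofPred_eq]
  have hG : ∀ x ∈ Ioo α β, _ := fun x hx => G _ (hyρ x ((hD x).1 hx).1 ((hD x).1 hx).2.1)
  have hw : l.map Prod.snd = (halfWord (-(σ * (a' * d))) (-(σ * τ * (b' * d)))).reverse ++
      [Mark.v] ++ halfWord (τ * (a * d)) (σ * τ * (b * d)) := by
    rw [wl]
    -- The reflected chart has invariants σ³a, σ⁶b, τ³a', τ⁶b' and determinant στd; even powers of σ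
    -- and τ are 1.
    congr 2
    · congr 2
      · linear_combination (-τ ^ 2 * σ * a' * d - σ * a' * d) * hττ
      · linear_combination (-τ ^ 5 * σ * b' * d - τ ^ 3 * σ * b' * d - τ * σ * b' * d) * hττ
    · linear_combination (σ ^ 2 * τ * a * d + τ * a * d) * hσσ
    · linear_combination (σ ^ 5 * τ * b * d + σ ^ 3 * τ * b * d + σ * τ * b * d) * hσσ
  rw [← hw]
  have hcont : ∀ x ∈ Ioo α β, ∀ᶠ t in 𝓝 x, t ∈ Ioo α β := fun x hx => isOpen_Ioo.mem_nhds hx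
  have hder : ∀ x ∈ Ioo α β, HasDerivAt (fun t => Ψ (hyp q t)) (eul Ψ (hyp q x)) x :=
    fun x hx => hasDerivAt_comp_hyp (hG x hx).1.1
  -- The function c recovers σu along the arc, and the x-derivative of σu is σu ≠ 0, so the velocity
  -- cannot vanish.
  have hder0 : ∀ x ∈ Ioo α β, eul Ψ (hyp q x) ≠ 0 := by
    intro x hx h0
    have d1 := hder x hx
    rw [h0] at d1
    have d2 := ((contDiffAt_of_mem_interior (hG x hx).2.2.2.2.2).differentiableAt
      (by simp)).hasFDerivAt.comp_hasDerivAt x d1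
    have d3 : HasDerivAt (c ∘ fun t => Ψ (hyp q t)) (σ * (hyp q x).1) x := by
      refine HasDerivAt.congr_of_eventuallyEq ?_ ((hcont x hx).mono fun t ht => (hG t ht).2.1)
      exact ((hasDerivAt_fst_snd (hasDerivAt_hyp q x)).1).const_mul σ
    have := d2.unique d3
    rw [ContinuousLinearMap.map_zero] at this
    exact mul_ne_zero hσ0 (hy1 x).ne' this.symm
  have hmarks : ∀ x ∈ Ioo α β,
      (IsInflection (fun p => F (p, σ * τ * q ^ 2)) (Ψ (hyp q x)) ↔ (x, Mark.i) ∈ l) ∧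
      (IsVertex (fun p => F (p, σ * τ * q ^ 2)) (Ψ (hyp q x)) ↔ (x, Mark.v) ∈ l) ∧
      ¬IsSingularPoint (fun p => F (p, σ * τ * q ^ 2)) (Ψ (hyp q x)) := by
    intro x hx
    obtain ⟨-, -, -, g4, g5, -⟩ := hG x hx
    rw [hyp_mul] at g4 g5
    have hx' := (hD x).1 hx
    have := mark_iff_of_curve (g := fun p => F (p, σ * τ * q ^ 2)) (γ := fun t => Ψ (hyp q t))
      (γ₁ := fun t => eul Ψ (hyp q t)) (γ₂ := fun t => eul (eul Ψ) (hyp q t))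
      (γ₃ := fun t => eul (eul (eul Ψ)) (hyp q t)) (u := x)
      (g5.comp_of_eq ((contDiff_id.smoothGermAt _).prodMk (smoothGermAt_const _ _)) rfl)
      ((hcont x hx).mono fun t ht => by have := (hG t ht).2.2.1; rwa [hyp_mul] at this)
      ((hcont x hx).mono fun t ht => hder t ht)
      ((hcont x hx).mono fun t ht => hasDerivAt_comp_hyp (hG t ht).1.2.1)
      ((hcont x hx).mono fun t ht => hasDerivAt_comp_hyp (hG t ht).1.2.2)
      (hder0 x hx) (g4 (by positivity))
    exact ⟨this.1.trans (L.infl x hx'.1 hx'.2.1), this.2.1.trans (L.vert x hx'.1 hx'.2.1), this.2.2⟩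
  refine exists_markedArc_of_Ioo (γ := fun x => Ψ (hyp q x)) (c := fun p => Real.log (σ * c p / q))
    (l := l) hαβ (isOpen_side c σ) ?_ ?_ ?_ ?_ L.sorted ?_ (fun x hx => (hmarks x hx).1)
    (fun x hx => (hmarks x hx).2.1) (fun x hx => (hmarks x hx).2.2)
  · intro x hx
    have h1 : ContDiffAt ℝ ∞ (fun x => hyp q x) x :=
      (contDiff_hyp.comp (contDiff_prodMk_right q)).contDiffAt
    exact (ContDiffAt.comp (g := Ψ) x (hG x hx).1.1.contDiffAt h1).contDiffWithinAt
  · refine ContDiffOn.log ((contDiffOn_const.mul (contDiffOn_side c σ)).div_const q) fun p hp => ?_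
    have : 0 < σ * c p := hp.2
    positivity
  · ext p
    constructor
    · rintro ⟨x, hx, rfl⟩
      obtain ⟨-, g2, g3, -, -, g6⟩ := hG x hx
      rw [hyp_mul] at g3
      refine ⟨⟨?_, g3⟩, g6, ?_⟩
      · have := ((hD x).1 hx).2.2
        simp only [dotp] at this
        linarith
      · show 0 < σ * c (Ψ (hyp q x))
        rw [g2, ← mul_assoc, hσσ, one_mul]
        exact hy1 x
    · rintro ⟨hp, hps⟩
      obtain ⟨-, z, hz, e1, e2, e3⟩ := C ε hε hεε₀ _ hqs p hp
      have hpos : 0 < σ * c p := hps.2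
      rw [e3] at hpos
      have hE : Real.exp (Real.log (σ * z.1 / q)) = σ * z.1 / q := Real.exp_log (by positivity)
      -- A curve point with chart coordinates z has reflected coordinates with product q² and first
      -- one positive, so it lies on the branch at x = log(σz₁/q).
      have hprod : σ * z.1 * (τ * z.2) = q ^ 2 := by
        linear_combination σ * τ * e1 + τ * τ * q ^ 2 * hσσ + q ^ 2 * hττ
      have hh : hyp q (Real.log (σ * z.1 / q)) = (σ * z.1, τ * z.2) := by
        rw [hyp, Real.exp_neg, hE]
        refine Prod.ext ?_ ?_
        · field_simp
        · have hτz : τ * z.2 = q ^ 2 / (σ * z.1) := by rw [eq_div_iff hpos.ne']; linarith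
          simp only [hτz]
          rw [inv_div]; ring
      have hrz : (σ * (σ * z.1), τ * (τ * z.2)) = z :=
        Prod.ext (by linear_combination z.1 * hσσ) (by linear_combination z.2 * hττ)
      have hΨp : Ψ (hyp q (Real.log (σ * z.1 / q))) = p := by
        rw [hh, ← e2]; simp only [hΨdef, hrz]
      refine ⟨Real.log (σ * z.1 / q), (hD _).2 ⟨?_, ?_, ?_⟩, hΨp⟩
      · have h1 := (norm_fst_le z).trans_lt (mem_ball_zero_iff.1 hz)
        rw [hh]
        refine lt_of_le_of_lt (le_abs_self _) ?_
        rcases hσ with rfl | rfl <;> simpa using h1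
      · have h1 := (norm_snd_le z).trans_lt (mem_ball_zero_iff.1 hz)
        rw [hh]
        refine lt_of_le_of_lt (le_abs_self _) ?_
        rcases hτ with rfl | rfl <;> simpa using h1
      · rw [hΨp]
        have := hp.1
        simp only [dotp]
        linarith
  · intro x hx
    rw [(hG x hx).2.1, ← mul_assoc, hσσ, one_mul]
    simp only [hyp]
    rw [mul_div_cancel_left₀ _ hq.ne', Real.log_exp]
  · intro e he
    obtain ⟨h1, h2⟩ := L.small e he
    exact (hD _).2 ⟨h1.trans_le hρρ, h2.trans_le hρρ, B _ (hyp_mem_ball hq h1 h2)⟩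

/-! ## Similarities -/

/-- The norm identity at (1, 0), (0, 1) and (1, 1) makes the images of the basis orthogonal and
equally long; the determinant δ then satisfies δ² = c⁴ but may have either sign. -/
theorem IsSimilarity.exists_equiv {A : Plane →ₗ[ℝ] Plane} (hA : IsSimilarity A) :
    ∃ (T : Plane ≃L[ℝ] Plane) (δ m : ℝ), (∀ p, T p = A p) ∧ δ ≠ 0 ∧ 0 < m ∧
      (∀ v w, cross (T v) (T w) = δ * cross v w) ∧ ∀ v w, dotp (T v) (T w) = m * dotp v w := by
  obtain ⟨c, hc, h⟩ := hA
  have hinj : Function.Injective A := by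
    rw [← LinearMap.ker_eq_bot, LinearMap.ker_eq_bot']
    intro p hp
    have := h p
    rw [hp] at this
    have h0 : p.1 ^ 2 + p.2 ^ 2 = 0 := by
      have : c ^ 2 * (p.1 ^ 2 + p.2 ^ 2) = 0 := by rw [← this]; simp
      exact (mul_eq_zero.1 this).resolve_left (by positivity)
    exact Prod.ext (pow_eq_zero_iff two_ne_zero |>.1 (by nlinarith [sq_nonneg p.1, sq_nonneg p.2]))
      (pow_eq_zero_iff two_ne_zero |>.1 (by nlinarith [sq_nonneg p.1, sq_nonneg p.2]))
  set T := (LinearEquiv.ofInjectiveEndo A hinj).toContinuousLinearEquiv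
  have hT : ∀ p, T p = A p := fun p => rfl
  have hAv : ∀ v : Plane, A v = v.1 • A (1, 0) + v.2 • A (0, 1) := fun v => by
    rw [← map_smul, ← map_smul, ← map_add]; congr 1; simp
  have e1 := h (1, 0)
  have e2 := h (0, 1)
  have e3 := h (1, 1)
  rw [hAv (1, 1)] at e3
  set w₁ := A (1, 0)
  set w₂ := A (0, 1)
  simp only [Prod.fst_add, Prod.snd_add, Prod.smul_fst, Prod.smul_snd, smul_eq_mul] at e1 e2 e3
  have e4 : w₁.1 * w₂.1 + w₁.2 * w₂.2 = 0 := by linarith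
  have hδ : cross w₁ w₂ ^ 2 = c ^ 4 := by
    simp only [cross]
    linear_combination (w₂.1 ^ 2 + w₂.2 ^ 2) * e1 + c ^ 2 * e2 - (w₁.1 * w₂.1 + w₁.2 * w₂.2) * e4
  refine ⟨T, cross w₁ w₂, c ^ 2, hT, fun h0 => ?_, by positivity, fun v w => ?_, fun v w => ?_⟩
  · rw [h0] at hδ
    have : 0 < c ^ 4 := by positivity
    norm_num at hδ
    linarith
  · rw [hT, hT, hAv v, hAv w]
    simp only [cross, Prod.fst_add, Prod.snd_add, Prod.smul_fst, Prod.smul_snd, smul_eq_mul]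
    ring
  · rw [hT, hT, hAv v, hAv w]
    simp only [dotp, Prod.fst_add, Prod.snd_add, Prod.smul_fst, Prod.smul_snd, smul_eq_mul]
    linear_combination (v.1 * w.1) * e1 + (v.2 * w.2) * e2 + (v.1 * w.2 + v.2 * w.1) * e4

theorem HypChart.of_linear {F : Plane × ℝ → ℝ} {Φ : ℝ × ℝ → Plane} {c : Plane → ℝ}
    (T : Plane ≃L[ℝ] Plane) (hF : SmoothGermAt F 0)
    (h : HypChart (fun w => F (T w.1, w.2)) Φ c) :
    HypChart F (fun z => T (Φ z)) (fun p => c (T.symm p)) where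
  family := hF
  smooth := h.smooth.clm_comp (T : Plane →L[ℝ] Plane)
  map_zero := by rw [h.map_zero, T.map_zero]
  smooth_inv := h.smooth_inv.comp_of_eq (T.symm.contDiff.smoothGermAt 0) T.symm.map_zero
  inv := by simpa using h.inv
  level := h.level
  regular := by
    filter_upwards [h.regular] with z hz h0 h1
    apply hz h0
    have := T.comp_right_fderiv (f := fun p => F (p, z.1 * z.2)) (x := Φ z)
    rw [h1] at this
    exact this.trans (by ext <;> simp)
  covers := by
    intro N hN
    have ht : Tendsto (fun w : Plane × ℝ => (T.symm w.1, w.2)) (𝓝 0) (𝓝 0) :=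
      Continuous.tendsto' (by fun_prop) _ _ (by simp)
    filter_upwards [ht.eventually (h.covers N hN)] with w hw h0
    obtain ⟨z, hz, e1, e2⟩ := hw (by simpa using h0)
    exact ⟨z, hz, e1, by rw [e2]; simp⟩

/-- The invariants are built from determinants and inner products, so a similarity only rescales
them. This is why the η's can be computed for f ∘ A instead of f. -/
theorem linear_branch (T : Plane ≃L[ℝ] Plane) {δ m : ℝ}
    (hc : ∀ v w, cross (T v) (T w) = δ * cross v w) (hm : ∀ v w, dotp (T v) (T w) = m * dotp v w)
    (α : ℝ → Plane) :
    cross (deriv (fun t => T (α t)) 0) (deriv (deriv (fun t => T (α t))) 0) =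
      δ * cross (deriv α 0) (deriv (deriv α) 0) ∧
    vertNum (deriv (fun t => T (α t)) 0) (deriv (deriv (fun t => T (α t))) 0)
      (deriv (deriv (deriv (fun t => T (α t)))) 0) =
      m * δ * vertNum (deriv α 0) (deriv (deriv α) 0) (deriv (deriv (deriv α)) 0) := by
  have h : ∀ β : ℝ → Plane, deriv (fun t => T (β t)) = fun t => T (deriv β t) := by
    intro β
    funext t
    rw [← fderiv_apply_one_eq_deriv, ← fderiv_apply_one_eq_deriv]
    have := T.comp_fderiv (f := β) (x := t)
    exact congrArg (fun L => L 1) this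
  rw [h α, h (deriv α), h (deriv (deriv α))]
  simp only [vertNum, hc, hm]
  exact ⟨trivial, by ring⟩

/-! ## The two arcs of a curve of the family -/

/-- The word of the arc in the quadrant with the signs `σ` and `τ`. -/
def arcWord (η₁ η₂ η₃ η₄ σ τ : ℝ) : List Mark :=
  (halfWord (σ * η₂) (σ * τ * η₄)).reverse ++ [Mark.v] ++ halfWord (τ * η₁) (σ * τ * η₃)

theorem halfWord_mul {k m : ℝ} (hk : 0 < k) (hm : 0 < m) (s t : ℝ) :
    halfWord (k * s) (m * t) = halfWord s t := by
  simp only [halfWord, mul_neg_iff, hk, hk.not_gt, hm, mul_pos_iff_of_pos_left]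
  simp

/-- The chart is built in normalised coordinates and transported by the similarity. Its two axes map
to the two branches, whose invariants were found from Taylor coefficients. -/
theorem exists_chart_arcs {f : Plane → ℝ} {A : Plane →ₗ[ℝ] Plane} (hf : IsA1Minus f)
    (hA : IsNormalizing f A) (h1 : eta1 (f ∘ A) ≠ 0) (h2 : eta2 (f ∘ A) ≠ 0)
    (h3 : eta3 (f ∘ A) ≠ 0) (h4 : eta4 (f ∘ A) ≠ 0) {F : Plane × ℝ → ℝ} (hF : IsDeformation f F)
    (hκ : 0 < fderiv ℝ F 0 (0, 1)) :
    ∃ Φ c, HypChart F Φ c ∧ ∀ {σ τ : ℝ}, (σ = 1 ∨ σ = -1) → (τ = 1 ∨ τ = -1) →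
      ∃ ε₀ > 0, ∀ ε : ℝ, 0 < ε → ε < ε₀ → ∀ᶠ q in 𝓝[>] (0 : ℝ), ∃ U ⊆ side c σ,
        curve (fun p => F (p, σ * τ * q ^ 2)) ε ∩ side c σ ⊆ U ∧ ∃ γ e l,
          MarkedArc (fun p => F (p, σ * τ * q ^ 2)) (curve (fun p => F (p, σ * τ * q ^ 2)) ε)
            U γ e l ∧
          l.map Prod.snd =
            arcWord (eta1 (f ∘ A)) (eta2 (f ∘ A)) (eta3 (f ∘ A)) (eta4 (f ∘ A)) σ τ := by
  obtain ⟨T, δ, m, hT, hδ, hm, hTc, hTd⟩ := hA.1.exists_equiv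
  obtain ⟨hfs, f00, f10, f01, -⟩ := hf
  set g : Plane → ℝ := f ∘ A with hg
  have hgT : g = f ∘ T := by funext p; simp [hg, hT]
  have sg : SmoothGermAt g 0 := by
    rw [hgT]; exact hfs.comp_of_eq (T.contDiff.smoothGermAt 0) (map_zero T)
  obtain ⟨⟨t10, t01⟩, -⟩ := partials_zero_eq_taylorCoeff f
  have f0 : fderiv ℝ f 0 = 0 := by
    ext <;> simp
    · exact t10.trans f10
    · exact t01.trans f01
  have g0 : fderiv ℝ g 0 = 0 := by
    rw [hgT, T.comp_right_fderiv, map_zero, f0, ContinuousLinearMap.zero_comp]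
  obtain ⟨⟨u10, u01⟩, -⟩ := partials_zero_eq_taylorCoeff g
  have g10 : taylorCoeff g 1 0 = 0 := by rw [← u10]; simp [dx, g0]
  have g01 : taylorCoeff g 0 1 = 0 := by rw [← u01]; simp [dy, g0]
  have g00 : taylorCoeff g 0 0 = 0 := by
    have : f 0 = 0 := by simpa [taylorCoeff] using f00
    simp [taylorCoeff, hg, this]
  have sFT : SmoothGermAt (fun w : Plane × ℝ => F (T w.1, w.2)) 0 := by
    refine hF.1.comp_of_eq (f := fun w : Plane × ℝ => (T w.1, w.2))
      (ContDiff.smoothGermAt ?_ 0) (by simp)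
    exact (T.contDiff.comp contDiff_fst).prodMk contDiff_snd
  have eFT : ∀ᶠ p in 𝓝 (0 : Plane), F (T p, 0) = g p := by
    have ht : Tendsto T (𝓝 0) (𝓝 0) := T.continuous.tendsto' _ _ (map_zero T)
    filter_upwards [ht.eventually hF.2] with p hp
    rw [hp, hgT]; rfl
  have kFT : fderiv ℝ (fun w : Plane × ℝ => F (T w.1, w.2)) 0 (0, 1) = fderiv ℝ F 0 (0, 1) := by
    have d1 : HasDerivAt (fun t : ℝ => F (T 0, t)) (fderiv ℝ F 0 (0, 1)) 0 := by
      refine HasFDerivAt.comp_hasDerivAt (l := F) (f := fun t : ℝ => (T 0, t)) (0 : ℝ) ?_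
        ((hasDerivAt_const _ _).prodMk (hasDerivAt_id _))
      rw [T.map_zero]; exact hF.1.hasFDerivAt
    have d2 : HasDerivAt (fun t : ℝ => F (T 0, t))
        (fderiv ℝ (fun w : Plane × ℝ => F (T w.1, w.2)) 0 (0, 1)) 0 :=
      HasFDerivAt.comp_hasDerivAt (l := fun w : Plane × ℝ => F (T w.1, w.2))
        (f := fun t : ℝ => ((0 : Plane), t)) (0 : ℝ) sFT.hasFDerivAt
        ((hasDerivAt_const _ _).prodMk (hasDerivAt_id _))
    exact d2.unique d1
  obtain ⟨κ, hκd⟩ : ∃ κ, κ = fderiv ℝ F 0 (0, 1) := ⟨_, rfl⟩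
  rw [← hκd] at hκ kFT
  obtain ⟨Φ, c, sΦ, Φ0, sc, cΦ, Φ1, Φ2, lev, reg, cov⟩ :=
    exists_chart sFT sg eFT g00 g10 g01 hA.2.1 hA.2.2 kFT hκ.ne'
  have H : HypChart F (fun z => T (Φ z)) (fun p => c (T.symm p)) :=
    HypChart.of_linear T hF.1 ⟨sFT, sΦ, Φ0, sc, cΦ, lev, reg, cov⟩
  refine ⟨_, _, H, ?_⟩
  have branch : ∀ v : ℝ × ℝ, v.1 * v.2 = 0 →
      SmoothGermAt (fun t : ℝ => Φ (t • v)) 0 ∧ Φ ((0 : ℝ) • v) = 0 ∧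
      (∀ᶠ t in 𝓝 (0 : ℝ), g (Φ (t • v)) = 0) ∧
      deriv (fun t : ℝ => Φ (t • v)) 0 = fderiv ℝ Φ 0 v := by
    intro v hv
    have hs : SmoothGermAt (fun t : ℝ => Φ (t • v)) 0 :=
      sΦ.comp_of_eq (f := fun t : ℝ => t • v) (ContDiff.smoothGermAt (by fun_prop) 0) (by simp)
    have h0 : Φ ((0 : ℝ) • v) = 0 := by rw [zero_smul, Φ0]
    refine ⟨hs, h0, ?_, ?_⟩
    · have t1 : Tendsto (fun t : ℝ => t • v) (𝓝 0) (𝓝 0) :=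
        Continuous.tendsto' (by fun_prop) _ _ (by simp)
      have t2 : Tendsto (fun t : ℝ => Φ (t • v)) (𝓝 0) (𝓝 0) := by
        have := hs.continuousAt.tendsto; rwa [h0] at this
      filter_upwards [t1.eventually lev, t2.eventually eFT] with t e1 e2
      have e3 : (t • v).1 * (t • v).2 = 0 := by
        simp only [Prod.smul_fst, Prod.smul_snd, smul_eq_mul]
        linear_combination t ^ 2 * hv
      rw [e3] at e1
      rw [← e2, e1]
    · have : HasDerivAt (fun t : ℝ => t • v) v 0 := by
        simpa using (hasDerivAt_id (0 : ℝ)).smul_const v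
      exact (HasFDerivAt.comp_hasDerivAt (l := Φ) (0 : ℝ) (by simpa using sΦ.hasFDerivAt) this).deriv
  have eu : (fun t : ℝ => Φ (t • ((1 : ℝ), (0 : ℝ)))) = fun t => Φ (t, 0) := by funext t; simp
  have ev : (fun t : ℝ => Φ (t • ((0 : ℝ), (1 : ℝ)))) = fun t => Φ (0, t) := by funext t; simp
  obtain ⟨bu1, bu2, bu3, bu4⟩ := branch (1, 0) (by simp)
  obtain ⟨bv1, bv2, bv3, bv4⟩ := branch (0, 1) (by simp)
  obtain ⟨cu1, cu2⟩ := first_branch sg g10 g01 hA.2.1 hA.2.2 bu1 bu2 bu3 (bu4.trans Φ1)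
  -- The scale ζ of the second branch is -κ with κ = ∂F/∂s, because V = -v/k and k(0) = κ.
  obtain ⟨cv1, cv2⟩ := second_branch sg g10 g01 hA.2.1 hA.2.2 bv1 bv2 bv3
    (neg_ne_zero.2 hκ.ne') (bv4.trans Φ2)
  rw [eu] at cu1 cu2
  rw [ev] at cv1 cv2
  obtain ⟨lu1, lu2⟩ := linear_branch T hTc hTd fun t => Φ (t, 0)
  obtain ⟨lv1, lv2⟩ := linear_branch T hTc hTd fun t => Φ (0, t)
  rw [cu1] at lu1
  rw [cu2] at lu2
  rw [cv1] at lv1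
  rw [cv2] at lv2
  have hfd : ∀ v, fderiv ℝ (fun z => T (Φ z)) 0 v = T (fderiv ℝ Φ 0 v) := fun v => by
    have := T.comp_fderiv (f := Φ) (x := 0)
    exact congrArg (fun L => L v) this
  have hd : cross (fderiv ℝ (fun z => T (Φ z)) 0 (1, 0)) (fderiv ℝ (fun z => T (Φ z)) 0 (0, 1)) =
      -(δ * κ) := by
    rw [hfd, hfd, hTc, Φ1, Φ2]; simp only [cross]; ring
  have n1 : δ * (-2 * eta1 g) ≠ 0 := by positivity
  have n3 : m * δ * (-6 * eta3 g) ≠ 0 := by positivity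
  have hκ0 : -κ ≠ 0 := neg_ne_zero.2 hκ.ne'
  have n2 : δ * (-2 * (-κ) ^ 3 * eta2 g) ≠ 0 :=
    mul_ne_zero hδ (mul_ne_zero (mul_ne_zero (by norm_num) (pow_ne_zero _ hκ0)) h2)
  have n4 : m * δ * (6 * (-κ) ^ 6 * eta4 g) ≠ 0 := mul_ne_zero (mul_ne_zero hm.ne' hδ)
    (mul_ne_zero (mul_ne_zero (by norm_num) (pow_ne_zero _ hκ0)) h4)
  intro σ τ hσ hτ
  have key := H.exists_arc hd (neg_ne_zero.2 (mul_ne_zero hδ hκ.ne')) lu1 n1 lu2 n3 lv1 n2 lv2 n4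
    hσ hτ
  have hw : (halfWord (-(σ * (δ * (-2 * (-κ) ^ 3 * eta2 g) * -(δ * κ))))
        (-(σ * τ * (m * δ * (6 * (-κ) ^ 6 * eta4 g) * -(δ * κ))))).reverse ++ [Mark.v] ++
      halfWord (τ * (δ * (-2 * eta1 g) * -(δ * κ))) (σ * τ * (m * δ * (-6 * eta3 g) * -(δ * κ))) =
      arcWord (eta1 g) (eta2 g) (eta3 g) (eta4 g) σ τ := by
    -- After multiplication by d = -δκ the similarity's determinant occurs only as δ². The powers of
    -- κ include odd ones, which is where κ > 0 is needed.
    rw [arcWord, ← halfWord_mul (k := 2 * δ ^ 2 * κ ^ 4) (m := 6 * m * δ ^ 2 * κ ^ 7)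
      (by positivity) (by positivity) (σ * eta2 g),
      ← halfWord_mul (k := 2 * δ ^ 2 * κ) (m := 6 * m * δ ^ 2 * κ)
      (by positivity) (by positivity) (τ * eta1 g)]
    have e : ∀ {s s' t t' : ℝ}, s = s' → t = t' → halfWord s t = halfWord s' t' := by
      rintro _ _ _ _ rfl rfl; rfl
    refine congrArg₂ (fun x y => x.reverse ++ [Mark.v] ++ y) (e ?_ ?_) (e ?_ ?_) <;> ring
  rw [hw] at key
  exact key

/-! ### Both arcs of F_t = 0 for each sign of t -/

/-- For small parameters `t > 0` the curve `F_t = 0` consists of two marked arcs with the words `w₁`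
and `w₂`, and the curve `F_{-t} = 0` of two with the words `w₃` and `w₄`. -/
def SideArcs (F : Plane × ℝ → ℝ) (w₁ w₂ w₃ w₄ : List Mark) : Prop :=
  ∃ ε₀ > 0, ∀ ε : ℝ, 0 < ε → ε < ε₀ → ∃ δ > 0, ∀ t : ℝ, 0 < t → t < δ →
    HasArcs (fun p => F (p, t)) ε w₁ w₂ ∧ HasArcs (fun p => F (p, -t)) ε w₃ w₄

theorem tendsto_sqrt_nhdsGT_zero : Tendsto Real.sqrt (𝓝[>] 0) (𝓝[>] 0) := by
  refine tendsto_nhdsWithin_iff.2 ⟨?_, ?_⟩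
  · exact (Real.continuous_sqrt.tendsto' 0 0 Real.sqrt_zero).mono_left nhdsWithin_le_nhds
  · filter_upwards [self_mem_nhdsWithin] with t ht using Real.sqrt_pos.2 ht

/-- Quadrants with στ = 1 carry the arcs for t = q² > 0, those with στ = -1 the arcs for t = -q² <
0; the sign σ distinguishes the two arcs of one curve. -/
theorem sideArcs {f : Plane → ℝ} {A : Plane →ₗ[ℝ] Plane} (hf : IsA1Minus f)
    (hA : IsNormalizing f A) (h1 : eta1 (f ∘ A) ≠ 0) (h2 : eta2 (f ∘ A) ≠ 0)
    (h3 : eta3 (f ∘ A) ≠ 0) (h4 : eta4 (f ∘ A) ≠ 0) {F : Plane × ℝ → ℝ} (hF : IsDeformation f F)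
    (hκ : 0 < fderiv ℝ F 0 (0, 1)) {w : ℝ → ℝ → List Mark}
    (hw : w = arcWord (eta1 (f ∘ A)) (eta2 (f ∘ A)) (eta3 (f ∘ A)) (eta4 (f ∘ A))) :
    SideArcs F (w 1 1) (w (-1) (-1)) (w 1 (-1)) (w (-1) 1) := by
  obtain ⟨Φ, c, H, arcs⟩ := exists_chart_arcs hf hA h1 h2 h3 h4 hF hκ
  rw [← hw] at arcs
  obtain ⟨ε₁, p1, a1⟩ := arcs (σ := 1) (τ := 1) (Or.inl rfl) (Or.inl rfl)
  obtain ⟨ε₂, p2, a2⟩ := arcs (σ := -1) (τ := -1) (Or.inr rfl) (Or.inr rfl)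
  obtain ⟨ε₃, p3, a3⟩ := arcs (σ := 1) (τ := -1) (Or.inl rfl) (Or.inr rfl)
  obtain ⟨ε₄, p4, a4⟩ := arcs (σ := -1) (τ := 1) (Or.inr rfl) (Or.inl rfl)
  obtain ⟨ε₅, p5, cov⟩ := H.curve_subset_side
  refine ⟨min (min (min ε₁ ε₂) (min ε₃ ε₄)) ε₅, by positivity, fun ε hε hε0 => ?_⟩
  simp only [lt_min_iff] at hε0
  obtain ⟨⟨⟨l1, l2⟩, l3, l4⟩, l5⟩ := hε0
  have tq := tendsto_sqrt_nhdsGT_zero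
  have hsmall : ∀ᶠ t in 𝓝[>] (0 : ℝ), t < ε₅ := nhdsWithin_le_nhds (gt_mem_nhds p5)
  have ev : ∀ᶠ t in 𝓝[>] (0 : ℝ), HasArcs (fun p => F (p, t)) ε (w 1 1) (w (-1) (-1)) ∧
      HasArcs (fun p => F (p, -t)) ε (w 1 (-1)) (w (-1) 1) := by
    filter_upwards [self_mem_nhdsWithin, hsmall, tq.eventually (a1 ε hε l1),
      tq.eventually (a2 ε hε l2), tq.eventually (a3 ε hε l3), tq.eventually (a4 ε hε l4)]
      with t ht hts b1 b2 b3 b4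
    have ht : 0 < t := ht
    rw [Real.sq_sqrt ht.le] at b1 b2 b3 b4
    rw [show (1 : ℝ) * 1 * t = t by ring] at b1
    rw [show (-1 : ℝ) * -1 * t = t by ring] at b2
    rw [show (1 : ℝ) * -1 * t = -t by ring] at b3
    rw [show (-1 : ℝ) * 1 * t = -t by ring] at b4
    have join : ∀ {s : ℝ} {U V : Set Plane} {w₁ w₂ : List Mark}, |s| < ε₅ → s ≠ 0 →
        U ⊆ side c 1 → curve (fun p => F (p, s)) ε ∩ side c 1 ⊆ U →
        V ⊆ side c (-1) → curve (fun p => F (p, s)) ε ∩ side c (-1) ⊆ V →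
        (∃ γ e l, MarkedArc (fun p => F (p, s)) (curve (fun p => F (p, s)) ε) U γ e l ∧
          l.map Prod.snd = w₁) →
        (∃ γ e l, MarkedArc (fun p => F (p, s)) (curve (fun p => F (p, s)) ε) V γ e l ∧
          l.map Prod.snd = w₂) → HasArcs (fun p => F (p, s)) ε w₁ w₂ := by
      intro s U V w₁ w₂ hs hs0 hU cU hV cV m1 m2
      refine ⟨U, V, (disjoint_side c).mono hU hV, fun p hp => ?_, m1, m2⟩
      exact (cov ε hε l5 s hs hs0 hp).imp (fun h => cU ⟨hp, h⟩) fun h => cV ⟨hp, h⟩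
    obtain ⟨U₁, i1, j1, k1⟩ := b1
    obtain ⟨U₂, i2, j2, k2⟩ := b2
    obtain ⟨U₃, i3, j3, k3⟩ := b3
    obtain ⟨U₄, i4, j4, k4⟩ := b4
    have hta : |t| < ε₅ := by rwa [abs_of_pos ht]
    exact ⟨join hta ht.ne' i1 j1 i2 j2 k1 k2,
      join (by rwa [abs_neg]) (neg_ne_zero.2 ht.ne') i3 j3 i4 j4 k3 k4⟩
  obtain ⟨δ, hδ, hsub⟩ := mem_nhdsGT_iff_exists_Ioo_subset.1 ev
  exact ⟨δ, hδ, fun t h1 h2 => hsub ⟨h1, h2⟩⟩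

theorem SideArcs.comp_neg {F : Plane × ℝ → ℝ} {w₁ w₂ w₃ w₄ : List Mark}
    (h : SideArcs (fun z => F (z.1, -z.2)) w₁ w₂ w₃ w₄) : SideArcs F w₃ w₄ w₁ w₂ := by
  obtain ⟨ε₀, hε₀, H⟩ := h
  refine ⟨ε₀, hε₀, fun ε h1 h2 => ?_⟩
  obtain ⟨δ, hδ, H⟩ := H ε h1 h2
  refine ⟨δ, hδ, fun t h3 h4 => ?_⟩
  have := H t h3 h4
  simp only [neg_neg] at this
  exact this.symm

/-! ## Curves with the same germ -/

/-- Needed at parameter 0, where the curve is singular and not a union of arcs, but both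
deformations restrict to f. -/
theorem sameGeometry_of_eqOn {g g' : Plane → ℝ} {ε : ℝ} (hε : 0 < ε)
    (h : EqOn g g' (Metric.ball 0 ε)) : SameGeometry ε g g' := by
  have hev : ∀ p ∈ curve g ε, g =ᶠ[𝓝 p] g' := fun p hp =>
    h.eventuallyEq_of_mem (Metric.isOpen_ball.mem_nhds
      (mem_ball_zero_iff.2 (curve_subset_ball hε hp)))
  have hcurve : curve g ε = curve g' ε := by
    have key : ∀ {a b : Plane → ℝ}, EqOn a b (Metric.ball 0 ε) → curve a ε ⊆ curve b ε :=
      fun hab p hp => ⟨hp.1, (hab (mem_ball_zero_iff.2 (curve_subset_ball hε hp))).symm.trans hp.2⟩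
    exact Subset.antisymm (key h) (key h.symm)
  refine ⟨id, id, univ, univ, isOpen_univ, subset_univ _, contDiffOn_id, isOpen_univ,
    subset_univ _, contDiffOn_id, fun p hp => hcurve ▸ hp, fun p hp => hcurve ▸ hp,
    fun _ _ => rfl, fun _ _ => rfl, fun p hp => ?_⟩
  have e := hev p hp
  have x1 := dx_congr e
  have y1 := dy_congr e
  have xx := dx_congr x1
  have xy := dx_congr y1
  have yy := dy_congr y1
  have xxx := (dx_congr xx).self_of_nhds
  have xxy := (dx_congr xy).self_of_nhds
  have xyy := (dx_congr yy).self_of_nhds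
  have yyy := (dy_congr yy).self_of_nhds
  simp only [id, IsSingularPoint, IsInflection, IsVertex, inflFun, vertFun, e.self_of_nhds,
    x1.self_of_nhds, y1.self_of_nhds, xx.self_of_nhds, xy.self_of_nhds, yy.self_of_nhds,
    xxx, xxy, xyy, yyy, and_self]

theorem sameGeometry_refl (ε : ℝ) (g : Plane → ℝ) : SameGeometry ε g g :=
  ⟨id, id, univ, univ, isOpen_univ, subset_univ _, contDiffOn_id, isOpen_univ, subset_univ _,
    contDiffOn_id, fun _ hp => hp, fun _ hp => hp, fun _ _ => rfl, fun _ _ => rfl,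
    fun _ _ => ⟨Iff.rfl, Iff.rfl, Iff.rfl⟩⟩

/-! ## The stratification of the line by sign -/

/-- The strata of the line: the two half-lines and the origin. -/
def signStrata : Set (Set ℝ) := {Iio 0, {0}, Ioi 0}

theorem isSmoothSubmanifold_of_isOpen {S : Set ℝ} (hS : IsOpen S) : IsSmoothSubmanifold S := by
  intro x hx
  refine ⟨OpenPartialHomeomorph.ofSet S hS, ⊤, hx, contDiffOn_id, contDiffOn_id, ?_⟩
  simp

theorem isStratification_signStrata : IsStratification univ signStrata where
  finite := by simp [signStrata]
  connected := by
    rintro S (rfl | rfl | rfl)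
    exacts [isConnected_Iio, isConnected_singleton, isConnected_Ioi]
  smooth := by
    rintro S (rfl | rfl | rfl)
    · exact isSmoothSubmanifold_of_isOpen isOpen_Iio
    · intro x hx
      exact ⟨OpenPartialHomeomorph.refl ℝ, ⊥, trivial, contDiffOn_id, contDiffOn_id, by simp⟩
    · exact isSmoothSubmanifold_of_isOpen isOpen_Ioi
  disjoint := by
    rintro S (rfl | rfl | rfl) T (rfl | rfl | rfl) hST <;>
      first
      | exact absurd rfl hST
      | (refine disjoint_left.2 fun x h1 h2 => ?_
         simp only [id, mem_Iio, mem_Ioi, mem_singleton_iff] at h1 h2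
         linarith)
  covers := by
    refine eq_univ_of_forall fun x => ?_
    rcases lt_trichotomy x 0 with h | h | h
    · exact ⟨Iio 0, by simp [signStrata], h⟩
    · exact ⟨{0}, by simp [signStrata], h⟩
    · exact ⟨Ioi 0, by simp [signStrata], h⟩
  frontier := by
    rintro S (rfl | rfl | rfl) T (rfl | rfl | rfl) ⟨x, h1, h2⟩ <;>
      simp only [closure_Iio, closure_Ioi, closure_singleton, mem_Iio, mem_Ioi, mem_Iic, mem_Ici,
        mem_singleton_iff] at h1 h2 ⊢ <;>
      first
      | (exfalso; linarith)
      | (intro y hy; simp only [mem_Iio, mem_Ioi, mem_Iic, mem_Ici, mem_singleton_iff] at hy ⊢; linarith)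

theorem SideArcs.isGeometricStratification {F : Plane × ℝ → ℝ} {w₁ w₂ w₃ w₄ : List Mark}
    (h : SideArcs F w₁ w₂ w₃ w₄) : IsGeometricStratification F signStrata := by
  obtain ⟨ε₀, hε₀, H⟩ := h
  refine ⟨ε₀, hε₀, fun ε h1 h2 => ?_⟩
  obtain ⟨δ, hδ, H⟩ := H ε h1 h2
  refine ⟨Ioo (-δ) δ, Ioo_mem_nhds (by linarith) hδ, ?_⟩
  rintro S (rfl | rfl | rfl) s₁ ⟨i1, j1⟩ s₂ ⟨i2, j2⟩
  · have a := (H (-s₁) (neg_pos.2 i1) (by linarith [j1.1])).2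
    have b := (H (-s₂) (neg_pos.2 i2) (by linarith [j2.1])).2
    rw [neg_neg] at a b
    exact a.sameGeometry b
  · rw [mem_singleton_iff.1 i1, mem_singleton_iff.1 i2]
    exact sameGeometry_refl _ _
  · exact (H s₁ i1 j1.2).1.sameGeometry (H s₂ i2 j2.2).1

/-- The homeomorphism of parameters is multiplication by the sign s. Away from 0 corresponding
curves have equal words; at 0 they coincide near the origin. -/
theorem frsEquivalent_of_sideArcs {f : Plane → ℝ} {F G : Plane × ℝ → ℝ} {w₁ w₂ w₃ w₄ : List Mark}
    (hF : ∀ᶠ p in 𝓝 (0 : Plane), F (p, 0) = f p) (hG : ∀ᶠ p in 𝓝 (0 : Plane), G (p, 0) = f p)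
    {s : ℝ} (hs : s = 1 ∨ s = -1) (aF : SideArcs (fun z => F (z.1, s * z.2)) w₁ w₂ w₃ w₄)
    (aG : SideArcs G w₁ w₂ w₃ w₄) : FRSEquivalent F G := by
  have hss : s * s = 1 := by rcases hs with rfl | rfl <;> norm_num
  have hs0 : s ≠ 0 := left_ne_zero_of_mul (hss ▸ one_ne_zero)
  have gF : IsGeometricStratification F signStrata := by
    rcases hs with rfl | rfl
    · simp only [one_mul] at aF; exact aF.isGeometricStratification
    · simp only [neg_mul, one_mul] at aF; exact aF.comp_neg.isGeometricStratification
  refine ⟨(Homeomorph.mulLeft₀ s hs0).toOpenPartialHomeomorph, signStrata, signStrata, trivial,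
    mul_zero s, isStratification_signStrata, gF, isStratification_signStrata,
    aG.isGeometricStratification, ?_, ?_⟩
  · rintro S hS
    show (fun x => s * x) '' S ∈ signStrata
    rcases hs with rfl | rfl
    · simpa using hS
    · rcases hS with rfl | rfl | rfl <;> simp [signStrata]
  · obtain ⟨ε₁, p1, H₁⟩ := aF
    obtain ⟨ε₂, p2, H₂⟩ := aG
    obtain ⟨ε₃, p3, H₃⟩ := Metric.eventually_nhds_iff_ball.1 (hF.and hG)
    refine ⟨min ε₁ (min ε₂ ε₃), by positivity, fun ε hε hε0 => ?_⟩
    simp only [lt_min_iff] at hε0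
    obtain ⟨δ₁, d1, H₁⟩ := H₁ ε hε hε0.1
    obtain ⟨δ₂, d2, H₂⟩ := H₂ ε hε hε0.2.1
    have hδ : 0 < min δ₁ δ₂ := lt_min d1 d2
    refine ⟨Ioo (-min δ₁ δ₂) (min δ₁ δ₂), Ioo_mem_nhds (by linarith) hδ, ?_⟩
    rintro t ⟨-, ht⟩
    show SameGeometry ε (fun p => F (p, t)) (fun p => G (p, s * t))
    have habs : |s * t| < min δ₁ δ₂ := by
      have : |s * t| = |t| := by rcases hs with rfl | rfl <;> simp
      rw [this]; exact abs_lt.2 ht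
    have ht' : t = s * (s * t) := by linear_combination -t * hss
    generalize s * t = u at *
    subst ht'
    rw [lt_min_iff] at habs
    rcases lt_trichotomy u 0 with hu | rfl | hu
    · rw [abs_of_neg hu] at habs
      have a := (H₁ (-u) (neg_pos.2 hu) habs.1).2
      have b := (H₂ (-u) (neg_pos.2 hu) habs.2).2
      rw [neg_neg] at a b
      exact a.sameGeometry b
    · rw [mul_zero]
      refine sameGeometry_of_eqOn hε fun p hp => ?_
      obtain ⟨e1, e2⟩ := H₃ p (Metric.ball_subset_ball hε0.2.2.le hp)
      exact e1.trans e2.symm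
    · rw [abs_of_pos hu] at habs
      exact (H₁ u hu habs.1).1.sameGeometry (H₂ u hu habs.2).1

/-! ## Versality -/

theorem isDeformation_levelDeformation {f : Plane → ℝ} (hf : SmoothGermAt f 0) :
    IsDeformation f (levelDeformation f) :=
  ⟨(hf.comp_of_eq (smoothGermAt_fst 0) rfl).add (smoothGermAt_snd 0),
    Eventually.of_forall fun _ => add_zero _⟩

theorem fderiv_levelDeformation {f : Plane → ℝ} (hf : SmoothGermAt f 0) :
    fderiv ℝ (levelDeformation f) 0 (0, 1) = 1 := by
  have h1 : HasDerivAt (fun t : ℝ => levelDeformation f (0, t))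
      (fderiv ℝ (levelDeformation f) 0 (0, 1)) 0 :=
    HasFDerivAt.comp_hasDerivAt (l := levelDeformation f) (f := fun t : ℝ => ((0 : Plane), t))
      (0 : ℝ) (isDeformation_levelDeformation hf).1.hasFDerivAt
      ((hasDerivAt_const _ _).prodMk (hasDerivAt_id _))
  exact h1.unique ((hasDerivAt_id (0 : ℝ)).const_add (f 0))

/-- Test versality on G = f + v and differentiate at the origin in v. The left side gives 1. If
∂F/∂s were 0, then dF would vanish at 0, f being singular there, and the right side would be only
the v-derivative of ψ, which is 0. -/
theorem IsVersalDeformation.fderiv_ne_zero {f : Plane → ℝ} {F : Plane × ℝ → ℝ} (hf : IsA1Minus f)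
    (hF : IsVersalDeformation f F) : fderiv ℝ F 0 (0, 1) ≠ 0 := by
  intro hκ
  obtain ⟨hfs, f00, f10, f01, -⟩ := hf
  obtain ⟨⟨sF, eF⟩, hv⟩ := hF
  have f0 : f 0 = 0 := by simpa [taylorCoeff] using f00
  obtain ⟨⟨t10, t01⟩, -⟩ := partials_zero_eq_taylorCoeff f
  have df0 : fderiv ℝ f 0 = 0 := by
    ext <;> simp
    · exact t10.trans f10
    · exact t01.trans f01
  have dF0 : fderiv ℝ F 0 = 0 := by
    have h1 : ∀ v : Plane, fderiv ℝ F 0 (v, 0) = 0 := by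
      intro v
      have d1 : HasFDerivAt (fun p : Plane => F (p, 0))
          ((fderiv ℝ F 0).comp ((ContinuousLinearMap.id ℝ Plane).prod 0)) 0 :=
        HasFDerivAt.comp (g := F) (f := fun p : Plane => (p, (0 : ℝ))) (0 : Plane) sF.hasFDerivAt
          ((hasFDerivAt_id _).prodMk (hasFDerivAt_const _ _))
      have d2 := d1.unique (hfs.hasFDerivAt.congr_of_eventuallyEq eF)
      have := congrArg (fun L => L v) d2
      simpa [df0] using this
    refine ContinuousLinearMap.ext fun w => ?_
    have : w = (w.1, 0) + w.2 • ((0 : Plane), (1 : ℝ)) := by ext <;> simp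
    rw [this, map_add, map_smul, h1, hκ]
    simp
  let G : Plane × (Fin 1 → ℝ) → ℝ := fun z => f z.1 + z.2 0
  have sG : IsDeformation f G := by
    refine ⟨(hfs.comp_of_eq (smoothGermAt_fst 0) rfl).add (ContDiff.smoothGermAt ?_ 0),
      Eventually.of_forall fun _ => by simp [G]⟩
    exact (contDiff_apply ℝ ℝ (0 : Fin 1)).comp contDiff_snd
  obtain ⟨h, φ, ψ, sh, h0, sφ, eφ, sψ, eψ, ψ0, e⟩ := hv 1 G sG
  have φ0 : φ 0 = 0 := eφ.self_of_nhds
  let u : Fin 1 → ℝ := fun _ => 1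
  have tv : Tendsto (fun t : ℝ => ((0 : Plane), t • u)) (𝓝 0) (𝓝 0) :=
    Continuous.tendsto' (by fun_prop) _ _ (by simp)
  have e1 : ∀ᶠ t in 𝓝 (0 : ℝ), t = ψ (F (φ (0, t • u), h (t • u)), t • u) := by
    filter_upwards [tv.eventually e] with t ht
    simpa [G, f0, u] using ht
  have dv : HasDerivAt (fun t : ℝ => ((0 : Plane), t • u)) (0, u) 0 := by
    have : HasDerivAt (fun t : ℝ => t • u) u 0 := by
      simpa using (hasDerivAt_id (0 : ℝ)).smul_const u
    exact (hasDerivAt_const _ _).prodMk this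
  have z0 : ((0 : Plane), (0 : ℝ) • u) = 0 := by simp
  have du : HasDerivAt (fun t : ℝ => t • u) u 0 := by
    simpa using (hasDerivAt_id (0 : ℝ)).smul_const u
  have dφ : HasDerivAt (fun t : ℝ => φ (0, t • u)) (fderiv ℝ φ 0 (0, u)) 0 :=
    HasFDerivAt.comp_hasDerivAt (l := φ) (0 : ℝ) (by rw [z0]; exact sφ.hasFDerivAt) dv
  have dh : HasDerivAt (fun t : ℝ => h (t • u)) (fderiv ℝ h 0 u) 0 :=
    HasFDerivAt.comp_hasDerivAt (l := h) (0 : ℝ) (by rw [zero_smul]; exact sh.hasFDerivAt) du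
  have w0 : (φ (0, (0 : ℝ) • u), h ((0 : ℝ) • u)) = 0 := by
    rw [z0, zero_smul, φ0, h0]; rfl
  have dFF : HasDerivAt (fun t : ℝ => F (φ (0, t • u), h (t • u))) 0 0 := by
    have := HasFDerivAt.comp_hasDerivAt (l := F) (f := fun t : ℝ => (φ (0, t • u), h (t • u)))
      (l' := fderiv ℝ F 0) (0 : ℝ) (by rw [w0]; exact sF.hasFDerivAt) (dφ.prodMk dh)
    rwa [dF0] at this
  have F0 : F 0 = 0 := by
    have := eF.self_of_nhds
    rw [f0] at this; exact this
  have x0 : (F (φ (0, (0 : ℝ) • u), h ((0 : ℝ) • u)), (0 : ℝ) • u) = 0 := by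
    rw [w0, F0, zero_smul]; rfl
  have dψ : HasDerivAt (fun t : ℝ => ψ (F (φ (0, t • u), h (t • u)), t • u))
      (fderiv ℝ ψ 0 (0, u)) 0 :=
    HasFDerivAt.comp_hasDerivAt (l := ψ)
      (f := fun t : ℝ => (F (φ (0, t • u), h (t • u)), t • u)) (0 : ℝ)
      (by rw [x0]; exact sψ.hasFDerivAt) (dFF.prodMk du)
  -- Preservation of the zero level is essential: otherwise translations in the target would absorb
  -- the parameter v and the test would say nothing about F.
  have dψ0 : fderiv ℝ ψ 0 (0, u) = 0 := by
    have d1 : HasDerivAt (fun t : ℝ => ψ (0, t • u)) (fderiv ℝ ψ 0 (0, u)) 0 :=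
      HasFDerivAt.comp_hasDerivAt (l := ψ) (f := fun t : ℝ => ((0 : ℝ), t • u)) (0 : ℝ)
        (by rw [zero_smul]; exact sψ.hasFDerivAt) ((hasDerivAt_const _ _).prodMk du)
    have tu : Tendsto (fun t : ℝ => t • u) (𝓝 0) (𝓝 0) :=
      Continuous.tendsto' (by fun_prop) _ _ (by simp)
    exact d1.unique ((hasDerivAt_const (0 : ℝ) (0 : ℝ)).congr_of_eventuallyEq (tu.eventually ψ0))
  rw [dψ0] at dψ
  have := (hasDerivAt_id (0 : ℝ)).unique (dψ.congr_of_eventuallyEq e1)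
  exact one_ne_zero this

/-! ## Matching the words -/

/-- The pairs of words `w, w'` and `v, v'` agree up to the order and the orientations of the two
arcs. -/
def SameWords (w w' v v' : List Mark) : Prop :=
  ((v = w ∨ v = w.reverse) ∧ (v' = w' ∨ v' = w'.reverse)) ∨
  ((v = w' ∨ v = w'.reverse) ∧ (v' = w ∨ v' = w.reverse))

theorem HasArcs.of_sameWords {g : Plane → ℝ} {ε : ℝ} {w w' v v' : List Mark}
    (h : HasArcs g ε w w') (hw : SameWords w w' v v') : HasArcs g ε v v' := by
  have key : ∀ {w w' v v' : List Mark}, HasArcs g ε w w' → (v = w ∨ v = w.reverse) →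
      (v' = w' ∨ v' = w'.reverse) → HasArcs g ε v v' := by
    rintro w w' v v' h (rfl | rfl) (rfl | rfl)
    exacts [h, h.reverse_right, h.reverse_left, h.reverse_left.reverse_right]
  rcases hw with ⟨h1, h2⟩ | ⟨h1, h2⟩
  · exact key h h1 h2
  · exact key h.swap h1 h2

theorem SideArcs.hasTransition {F : Plane × ℝ → ℝ} {w₁ w₂ w₃ w₄ v₁ v₂ v₃ v₄ : List Mark}
    (h : SideArcs F w₁ w₂ w₃ w₄)
    (hv : (SameWords w₁ w₂ v₁ v₂ ∧ SameWords w₃ w₄ v₃ v₄) ∨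
      (SameWords w₃ w₄ v₁ v₂ ∧ SameWords w₁ w₂ v₃ v₄)) : HasTransition F v₁ v₂ v₃ v₄ := by
  obtain ⟨ε₀, hε₀, H⟩ := h
  have pos : ∀ {v v'}, SameWords w₁ w₂ v v' → HasConfigurationOnSide F 1 v v' := by
    intro v v' hw
    refine ⟨ε₀, hε₀, fun ε h1 h2 => ?_⟩
    obtain ⟨δ, hδ, H⟩ := H ε h1 h2
    refine ⟨δ, hδ, fun t h3 h4 => ?_⟩
    rw [one_mul]
    exact ((H t h3 h4).1.of_sameWords hw).hasConfiguration
  have neg : ∀ {v v'}, SameWords w₃ w₄ v v' → HasConfigurationOnSide F (-1) v v' := by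
    intro v v' hw
    refine ⟨ε₀, hε₀, fun ε h1 h2 => ?_⟩
    obtain ⟨δ, hδ, H⟩ := H ε h1 h2
    refine ⟨δ, hδ, fun t h3 h4 => ?_⟩
    rw [neg_one_mul]
    exact ((H t h3 h4).2.of_sameWords hw).hasConfiguration
  rcases hv with ⟨a, b⟩ | ⟨a, b⟩
  · exact Or.inl ⟨pos a, neg b⟩
  · exact Or.inr ⟨neg a, pos b⟩

theorem exists_sign {η : ℝ} (h : η ≠ 0) : ∃ k s : ℝ, 0 < k ∧ (s = 1 ∨ s = -1) ∧ η = k * s := by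
  rcases lt_or_gt_of_ne h with h | h
  · exact ⟨-η, -1, by linarith, Or.inr rfl, by ring⟩
  · exact ⟨η, 1, h, Or.inl rfl, by ring⟩

/-- Only the signs of the η's enter the words, so each may be replaced by ±1. -/
theorem arcWord_mul {k₁ k₂ k₃ k₄ : ℝ} (h1 : 0 < k₁) (h2 : 0 < k₂) (h3 : 0 < k₃) (h4 : 0 < k₄)
    (s₁ s₂ s₃ s₄ : ℝ) : arcWord (k₁ * s₁) (k₂ * s₂) (k₃ * s₃) (k₄ * s₄) = arcWord s₁ s₂ s₃ s₄ := by
  funext σ τ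
  rw [arcWord, mul_left_comm, mul_left_comm _ k₄, halfWord_mul h2 h4, mul_left_comm τ,
    mul_left_comm _ k₃, halfWord_mul h1 h3, arcWord]

/-- With every η equal to ±1 there are sixteen cases, each settled by writing out four words and
comparing them up to reversal, order of the arcs and sign of t. -/
theorem SideArcs.transitions {η₁ η₂ η₃ η₄ : ℝ} (h1 : η₁ ≠ 0) (h2 : η₂ ≠ 0)
    (h3 : η₃ ≠ 0) (h4 : η₄ ≠ 0) {F : Plane × ℝ → ℝ}
    (h : SideArcs F (arcWord η₁ η₂ η₃ η₄ 1 1) (arcWord η₁ η₂ η₃ η₄ (-1) (-1))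
      (arcWord η₁ η₂ η₃ η₄ 1 (-1)) (arcWord η₁ η₂ η₃ η₄ (-1) 1)) :
    (η₃ * η₄ < 0 → HasTransition F [.v, .i, .v, .i] [.v, .v] [.v, .i, .v] [.v, .v, .i]) ∧
    (0 < η₃ * η₄ → 0 < η₁ * η₂ * η₃ →
      HasTransition F [.v, .i] [.v, .i] [.v, .i, .v, .i, .v] [.v, .v, .v]) ∧
    (0 < η₃ * η₄ → η₁ * η₂ * η₃ < 0 →
      HasTransition F [.i, .v, .i] [.v] [.v, .v, .i, .v] [.v, .v, .i, .v]) := by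
  obtain ⟨k₁, s₁, p1, e1, rfl⟩ := exists_sign h1
  obtain ⟨k₂, s₂, p2, e2, rfl⟩ := exists_sign h2
  obtain ⟨k₃, s₃, p3, e3, rfl⟩ := exists_sign h3
  obtain ⟨k₄, s₄, p4, e4, rfl⟩ := exists_sign h4
  rw [arcWord_mul p1 p2 p3 p4] at h
  have q1 : k₃ * s₃ * (k₄ * s₄) = k₃ * k₄ * (s₃ * s₄) := by ring
  have q2 : k₁ * s₁ * (k₂ * s₂) * (k₃ * s₃) = k₁ * k₂ * k₃ * (s₁ * s₂ * s₃) := by ring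
  have q3 : 0 < k₃ * k₄ := by positivity
  have q4 : 0 < k₁ * k₂ * k₃ := by positivity
  have neg_iff : ∀ {k x : ℝ}, 0 < k → (k * x < 0 ↔ x < 0) := fun hk => by
    simp [mul_neg_iff, hk, hk.not_gt]
  rw [q1, q2, neg_iff q3, mul_pos_iff_of_pos_left q3, mul_pos_iff_of_pos_left q4, neg_iff q4]
  refine ⟨fun a => h.hasTransition ?_, fun a b => h.hasTransition ?_,
    fun a b => h.hasTransition ?_⟩
  all_goals
    rcases e1 with rfl | rfl <;> rcases e2 with rfl | rfl <;> rcases e3 with rfl | rfl <;>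
      rcases e4 with rfl | rfl <;> norm_num at a <;> try norm_num at b
  all_goals norm_num [SameWords, arcWord, halfWord]

end PlaneCurve

end

/-! ### The theorem: equivalence to f + t and the three configurations -/

open PlaneCurve in
theorem mainTheorem1 (f : Plane → ℝ) (A : Plane →ₗ[ℝ] Plane)
    (hf : IsA1Minus f) (hA : IsNormalizing f A)
    (h1 : eta1 (f ∘ A) ≠ 0) (h2 : eta2 (f ∘ A) ≠ 0)
    (h3 : eta3 (f ∘ A) ≠ 0) (h4 : eta4 (f ∘ A) ≠ 0) :
    (∀ F : Plane × ℝ → ℝ, IsVersalDeformation f F → FRSEquivalent F (levelDeformation f)) ∧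
    (eta3 (f ∘ A) * eta4 (f ∘ A) < 0 →
      HasTransition (levelDeformation f)
        [.v, .i, .v, .i] [.v, .v] [.v, .i, .v] [.v, .v, .i]) ∧
    (0 < eta3 (f ∘ A) * eta4 (f ∘ A) → 0 < eta1 (f ∘ A) * eta2 (f ∘ A) * eta3 (f ∘ A) →
      HasTransition (levelDeformation f)
        [.v, .i] [.v, .i] [.v, .i, .v, .i, .v] [.v, .v, .v]) ∧
    (0 < eta3 (f ∘ A) * eta4 (f ∘ A) → eta1 (f ∘ A) * eta2 (f ∘ A) * eta3 (f ∘ A) < 0 →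
      HasTransition (levelDeformation f)
        [.i, .v, .i] [.v] [.v, .v, .i, .v] [.v, .v, .i, .v]) := by
  have hL := isDeformation_levelDeformation hf.1
  have aL := sideArcs hf hA h1 h2 h3 h4 hL (by rw [fderiv_levelDeformation hf.1]; norm_num) rfl
  refine ⟨fun F hF => ?_, SideArcs.transitions h1 h2 h3 h4 aL⟩
  have hFd := hF.1
  have hκ := hF.fderiv_ne_zero hf
  -- Versality gives a nonzero derivative of either sign; reversing the parameter when it is
  -- negative makes the word computation apply to both families with identical words.
  obtain ⟨s, hs, hpos⟩ : ∃ s : ℝ, (s = 1 ∨ s = -1) ∧ 0 < s * fderiv ℝ F 0 (0, 1) := by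
    rcases lt_or_gt_of_ne hκ with h | h
    · exact ⟨-1, Or.inr rfl, by linarith⟩
    · exact ⟨1, Or.inl rfl, by linarith⟩
  have sm : Filter.Tendsto (fun z : Plane × ℝ => (z.1, s * z.2)) (nhds 0) (nhds 0) :=
    Continuous.tendsto' (by fun_prop) _ _ (by simp)
  have z0 : ((0 : Plane × ℝ).1, s * (0 : Plane × ℝ).2) = 0 := by simp
  have hFs : SmoothGermAt (fun z : Plane × ℝ => F (z.1, s * z.2)) 0 :=
    hFd.1.comp_of_eq (f := fun z : Plane × ℝ => (z.1, s * z.2))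
      (ContDiff.smoothGermAt (by fun_prop) 0) z0
  have hD : IsDeformation f (fun z : Plane × ℝ => F (z.1, s * z.2)) :=
    ⟨hFs, by simpa using hFd.2⟩
  have hder : fderiv ℝ (fun z : Plane × ℝ => F (z.1, s * z.2)) 0 (0, 1) =
      s * fderiv ℝ F 0 (0, 1) := by
    have d1 : HasFDerivAt (fun z : Plane × ℝ => (z.1, s * z.2))
        ((ContinuousLinearMap.fst ℝ Plane ℝ).prod (s • ContinuousLinearMap.snd ℝ Plane ℝ)) 0 :=
      hasFDerivAt_fst.prodMk (hasFDerivAt_snd.const_mul s)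
    have d2 := HasFDerivAt.comp (g := F) (0 : Plane × ℝ) (by rw [z0]; exact hFd.1.hasFDerivAt) d1
    have e : fderiv ℝ (fun z : Plane × ℝ => F (z.1, s * z.2)) 0 = _ := d2.fderiv
    rw [e]
    have : ((0 : Plane), s) = s • ((0 : Plane), (1 : ℝ)) := by simp
    simp only [ContinuousLinearMap.comp_apply, ContinuousLinearMap.prod_apply,
      ContinuousLinearMap.coe_fst', _root_.smul_apply, ContinuousLinearMap.coe_snd', smul_eq_mul,
      mul_one]
    rw [this, map_smul, smul_eq_mul]
  exact frsEquivalent_of_sideArcs hFd.2 hL.2 hs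
    (sideArcs hf hA h1 h2 h3 h4 hD (by rw [hder]; exact hpos) rfl) aL
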